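/- **Setting.** Let $(X,d)$ be a locally compact, separable, complete metric space with at least two points, $m$ a Radon measure on $X$ with full support, and $p\in(1,\infty)$. A functional $\mathcal E\colon\mathcal F\to[0,\infty)$ on a real vector space is called a *$p$-energy form* if $\mathcal E^{1/p}$ is a seminorm. Let $\mathcal F_p\subset L^p(X,m)$ be a linear subspace, $\mathcal E_p\colon \mathcal F_p\to[0,\infty)$ a $p$-energy form and $\{\Gamma_p\langle u\rangle\}_{u\in\mathcal F_p}$ a family of finite Borel measures on $X$ such that: 1. for every $u\in\mathcal F_p$ and every $1$-Lipschitz $\varphi\colon\mathbb R\to\mathbb R$ with $\varphi(0)=0$, $\varphi(u)\in\mathcal F_p$ and $\mathcal E_p(\varphi(u))\le\mathcal E_p(u)$; and $\mathcal E_p(u)=0$ implies that $u$ is ($m$-a.e.) constant; 2. $\mathcal F_p$ with the norm $\|u\|_{L^p}+\mathcal E_p(u)^{1/p}$ is a reflexive Banach space; 3. $\mathcal F_p\cap C_c(X)$ is dense in $\mathcal F_p$, and dense in $C_c(X)$ for the uniform norm; 4. for every Borel set $A$, $u\mapsto\Gamma_p\langle u\rangle(A)$ is a $p$-energy form on $\mathcal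 F_p$; 5. $\mathcal E_p(u)=\Gamma_p\langle u\rangle(X)$ for every $u\in\mathcal F_p$; 6. if $u,v\in\mathcal F_p\cap C_c(X)$ and $u-v$ is constant on an open set $U$, then $\Gamma_p\langle u\rangle$ and $\Gamma_p\langle v\rangle$ coincide on the Borel subsets of $U$. Let $\Psi\colon(0,\infty)\to(0,\infty)$ be a continuous increasing bijection for which there are $C_\Psi\ge1$ and $\beta_1,\beta_2>0$ with $C_\Psi^{-1}(R/r)^{\beta_1}\le\Psi(R)/\Psi(r)\le C_\Psi(R/r)^{\beta_2}$ for $0<r\le R$. Write $B(x,r)=\{y: d(x,y)<r\}$. * **(VD)**: there is $c\ge1$ with $m(B(x,2r))\le c\,m(B(x,r))$ for all $x\in X$, $r>0$. * **PI$_p(\Psi)$**: there are $C_P>0$, $A_P\ge1$ with $\int_{B(x,r)}|u-u_{B(x,r)}|^p\,dm\le C_P\Psi(r)\,\Gamma_p\langle u\rangle(B(x,A_Pr))$ for all $x\in X$, $r>0$, $u\in\mathcal F_p$, where $u_B$ is the mean of $u$ over $B$. * **cap$_p(\Psi)_\le$**: there are $C,A_1,A_2>1$ such that for all $x\in X$ and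 $0<R<\operatorname{diam}(X)/A_2$, $\inf\{\mathcal E_p(u): u\in\mathcal F_p,\ u=1\ \text{a.e. on } B(x,R),\ u=0\ \text{a.e. on } X\setminus B(x,A_1R)\}\le C\,m(B(x,R))/\Psi(R)$ (with $\inf\emptyset=\infty$). For an open set $\Omega\subset X$, $\mathcal F_{p,\mathrm{loc}}(\Omega)$ is the set of measurable $u\colon\Omega\to\mathbb R$ (modulo null sets) such that for each open $A$ relatively compact in $\Omega$ some $u^\#\in\mathcal F_p$ satisfies $u=u^\#$ a.e. on $A$. For such $u$ and Borel $E\subset\Omega$, $\Gamma_p\langle u\rangle(E)$ is the limit of $\Gamma_p\langle u^\#\rangle(E\cap A)$ as $A$ increases to $\Omega$. Let $\mathcal F_p(\Omega)$ be the set of $u\in\mathcal F_{p,\mathrm{loc}}(\Omega)$ with $\int_\Omega|u|^p\,dm+\Gamma_p\langle u\rangle(\Omega)<\infty$. An open set $\Omega\ne X$ satisfies **(E)** if every $f\in\mathcal F_p(\Omega)$ agrees a.e. on $\Omega$ with some $F\in\mathcal F_p$ such that $\Gamma_p\langle F\rangle(\partial\Omega)=0$. **Mollifiers.** Let $\{\rho_\varepsilon\}_{\varepsilon>0}$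 be measurable functions $X\times X\to[0,\infty]$. For $C_\rho\in(0,\infty)$ let (L) be the following condition: *either* for all $\varepsilon>0$ and all $x,y$ with $0<d(x,y)\le1$ $$\rho_\varepsilon(x,y)\ge C_\rho^{-1}\frac{\Psi(d(x,y))}{\Psi(\varepsilon)}\frac{\mathbf 1_{B(y,\varepsilon)}(x)}{m(B(y,\varepsilon))},$$ *or* there are Radon measures $\nu_\varepsilon$ on $(0,\infty)$ with $\liminf_{\varepsilon\downarrow0}\int_{(0,\delta)}\Psi\,d\nu_\varepsilon\ge C_\rho^{-1}$ for all $\delta>0$ such that for all $\varepsilon>0$ and all $x,y$ with $0<d(x,y)\le1$ $$\rho_\varepsilon(x,y)\ge\Psi(d(x,y))\frac{\nu_\varepsilon((d(x,y),\infty))}{m(B(y,d(x,y)))}.$$ *Assumption 1.* For some $C_\rho\in(0,\infty)$: (i) for each $\varepsilon>0$ there are $d_j(\varepsilon)\ge0$, $j\ge1$, with $\sum_jd_j(\varepsilon)\le C_\rho$ and, whenever $0<d(x,y)<1$, $$\rho_\varepsilon(x,y)\le\sum_{j\ge1}d_j(\varepsilon)\frac{\mathbf 1_{B(y,2^{-j+1})\setminus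 B(y,2^{-j})}(x)}{m(B(y,2^{-j+1}))};$$ (ii) for every $\delta>0$, both $\operatorname{ess\,sup}_{y}\int_{X\setminus B(y,\delta)}\frac{\rho_\varepsilon(x,y)}{\Psi(d(x,y))}\,m(dx)$ and $\operatorname{ess\,sup}_{y}\int_{X\setminus B(y,\delta)}\frac{\rho_\varepsilon(y,x)}{\Psi(d(x,y))}\,m(dx)$ tend to $0$ as $\varepsilon\downarrow0$; (iii) (L) holds. *Assumption 2.* For some $C_\rho\in(0,\infty)$: (i) for each $\varepsilon>0$ there are $d_j(\varepsilon)\ge0$, $j\ge1$, with $\sum_jd_j(\varepsilon)\le C_\rho$ and, for all $x\ne y$, $$\rho_\varepsilon(x,y)\le\sum_{j\ge1}d_j(\varepsilon)\frac{\mathbf 1_{B(y,2^{-j+1}\varepsilon)\setminus B(y,2^{-j}\varepsilon)}(x)}{m(B(y,2^{-j+1}\varepsilon))};$$ (ii) (L) holds. **Theorem.** Assume (VD), PI$_p(\Psi)$ and cap$_p(\Psi)_\le$, and let $\{\rho_\varepsilon\}_{\varepsilon>0}$ satisfy Assumption 1 or Assumption 2. Put $$I_\varepsilon(u;\Omega)=\int_\Omega\int_\Omega\frac{|u(x)-u(y)|^p}{\Psi(d(x,y))}\rho_\varepsilon(x,y)\,m(dx)\,m(dy)$$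 (the integrand being $0$ for $x=y$). Then there is $C\in[1,\infty)$ such that for every open $\Omega\subset X$ satisfying (E) and every $u\in\mathcal F_p(\Omega)$, $$C^{-1}\Gamma_p\langle u\rangle(\Omega)\le\liminf_{\varepsilon\downarrow0}I_\varepsilon(u;\Omega)\le\limsup_{\varepsilon\downarrow0}I_\varepsilon(u;\Omega)\le C\,\Gamma_p\langle u\rangle(\Omega).$$ Moreover, if $\{\rho_\varepsilon\}$ satisfies Assumption 2, then for every $u\in\mathcal F_p$, $$\sup_{\varepsilon>0}I_\varepsilon(u;X)\le C\liminf_{\varepsilon\downarrow0}I_\varepsilon(u;X).$$ -/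

import Mathlib

open MeasureTheory Filter Set
open scoped ENNReal NNReal Topology

noncomputable section

instance fact_one_le_ofReal (p : ℝ) [hp : Fact (1 < p)] : Fact (1 ≤ ENNReal.ofReal p) :=
  ⟨by rw [← ENNReal.ofReal_one]; exact ENNReal.ofReal_le_ofReal hp.out.le⟩

/-- A functional `E` on a real vector space is a `p`-energy form if it is nonnegative and
`E ^ (1/p)` is a seminorm. -/
def IsPEnergyForm {V : Type*} [AddCommGroup V] [Module ℝ V] (p : ℝ) (E : V → ℝ) : Prop :=
  (∀ u, 0 ≤ E u) ∧ ∃ s : Seminorm ℝ V, ∀ u, s u = E u ^ (1 / p)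

/-- A `p`-energy form on `(X, m)` whose domain is a linear subspace of `L^p(X, m)`. -/
structure PEnergyForm {X : Type*} [MeasurableSpace X] (m : Measure X) (p : ℝ)
    [Fact (1 < p)] where
  domain : Submodule ℝ (Lp ℝ (ENNReal.ofReal p) m)
  energy : domain → ℝ
  isPEnergyForm : IsPEnergyForm p energy

namespace PEnergyForm

variable {X : Type*} [MeasurableSpace X] {m : Measure X} {p : ℝ} [Fact (1 < p)]

/-- The domain of the form as a space of its own; it carries the norm
`‖u‖_{L^p} + E(u)^{1/p}`, not the norm induced from `L^p`. -/
def Dom (𝓔 : PEnergyForm m p) : Type _ := 𝓔.domain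

instance (𝓔 : PEnergyForm m p) : AddCommGroup 𝓔.Dom := inferInstanceAs (AddCommGroup 𝓔.domain)

instance (𝓔 : PEnergyForm m p) : Module ℝ 𝓔.Dom := inferInstanceAs (Module ℝ 𝓔.domain)

/-- The underlying element of `L^p(X, m)`. -/
def Dom.toLp {𝓔 : PEnergyForm m p} (u : 𝓔.Dom) : Lp ℝ (ENNReal.ofReal p) m :=
  Subtype.val (p := fun v => v ∈ 𝓔.domain) u

/-- The energy `E(u)`. -/
def E (𝓔 : PEnergyForm m p) (u : 𝓔.Dom) : ℝ := 𝓔.energy u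

instance (𝓔 : PEnergyForm m p) : Norm 𝓔.Dom := ⟨fun u => ‖u.toLp‖ + 𝓔.E u ^ (1 / p)⟩

theorem normedSpaceCore (𝓔 : PEnergyForm m p) : NormedSpace.Core ℝ 𝓔.Dom := by
  obtain ⟨h0, s, hs⟩ := 𝓔.isPEnergyForm
  have key : ∀ u : 𝓔.Dom, ‖u‖ = ‖u.toLp‖ + s u := fun u => by
    rw [hs u]; rfl
  refine ⟨⟨fun u => ?_, fun c u => ?_, fun u v => ?_⟩, fun u => ⟨fun h => ?_, fun h => ?_⟩⟩
  · rw [key]; exact add_nonneg (norm_nonneg _) (apply_nonneg s _)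
  · rw [key, key]
    have h1 : ‖(c • u).toLp‖ = ‖c‖ * ‖u.toLp‖ := norm_smul c u.toLp
    have h2 : s (c • u : 𝓔.domain) = ‖c‖ * s u := map_smul_eq_mul s c u
    rw [h1, mul_add]; exact congrArg _ h2
  · rw [key, key, key]
    have h1 : ‖(u + v).toLp‖ ≤ ‖u.toLp‖ + ‖v.toLp‖ := norm_add_le u.toLp v.toLp
    have h2 : s (u + v : 𝓔.domain) ≤ s u + s v := map_add_le_add s u v
    have h3 : s (u + v) ≤ s u + s v := h2
    linarith
  · rw [key] at h
    have h1 : ‖u.toLp‖ = 0 := 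
      ((add_eq_zero_iff_of_nonneg (norm_nonneg _) (apply_nonneg s _)).1 h).1
    exact Subtype.ext (norm_eq_zero.1 h1)
  · subst h
    rw [key]
    have h1 : ‖(0 : 𝓔.Dom).toLp‖ = 0 := norm_zero (E := Lp ℝ (ENNReal.ofReal p) m)
    have h2 : s (0 : 𝓔.domain) = 0 := map_zero s
    rw [h1, zero_add]; exact h2

instance (𝓔 : PEnergyForm m p) : NormedAddCommGroup 𝓔.Dom :=
  NormedAddCommGroup.ofCore 𝓔.normedSpaceCore

instance (𝓔 : PEnergyForm m p) : NormedSpace ℝ 𝓔.Dom := NormedSpace.ofCore 𝓔.normedSpaceCore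

/-- `f` is a continuous, compactly supported representative of `u`. -/
def IsCcRep [TopologicalSpace X] {𝓔 : PEnergyForm m p} (u : 𝓔.Dom) (f : X → ℝ) : Prop :=
  Continuous f ∧ HasCompactSupport f ∧ u.toLp =ᵐ[m] f

end PEnergyForm

/-- A `p`-energy form `(E, F)` on `(X, m)` with `F ⊆ L^p(X, m)`, together with a family of finite
Borel measures `Γ⟨u⟩`, `u ∈ F` (the `p`-energy measures). -/
structure PEnergyStructure {X : Type*} [MetricSpace X] [MeasurableSpace X]
    (m : Measure X) (p : ℝ) [Fact (1 < p)] extends PEnergyForm m p where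
  /-- The energy measure `Γ⟨u⟩`. -/
  Γ : toPEnergyForm.Dom → Measure X
  finite_Γ : ∀ u, IsFiniteMeasure (Γ u)
  /-- Lipschitz contraction property. -/
  lipschitz_contraction : ∀ (u : toPEnergyForm.Dom) (φ : ℝ → ℝ), LipschitzWith 1 φ → φ 0 = 0 →
    ∃ v : toPEnergyForm.Dom, v.toLp =ᵐ[m] (fun x => φ (u.toLp x)) ∧
      toPEnergyForm.E v ≤ toPEnergyForm.E u
  /-- Functions of zero energy are constant. -/
  const_of_energy_eq_zero : ∀ u : toPEnergyForm.Dom, toPEnergyForm.E u = 0 →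
    ∃ c : ℝ, u.toLp =ᵐ[m] (fun _ => c)
  complete : CompleteSpace toPEnergyForm.Dom
  reflexive : Function.Surjective (NormedSpace.inclusionInDoubleDual ℝ toPEnergyForm.Dom)
  /-- `F ∩ C_c(X)` is dense in `F`. -/
  dense_Cc : Dense {u : toPEnergyForm.Dom | ∃ f, PEnergyForm.IsCcRep u f}
  /-- `F ∩ C_c(X)` is dense in `C_c(X)` for the uniform norm. -/
  dense_in_Cc : ∀ f : X → ℝ, Continuous f → HasCompactSupport f → ∀ η : ℝ, 0 < η →
    ∃ (u : toPEnergyForm.Dom) (g : X → ℝ), PEnergyForm.IsCcRep u g ∧ ∀ x, |f x - g x| < η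
  /-- `u ↦ Γ⟨u⟩(A) ^ (1/p)` is a seminorm for every Borel set `A`. -/
  isPEnergyForm_Γ : ∀ A : Set X, MeasurableSet A → IsPEnergyForm p (fun u => (Γ u).real A)
  Γ_univ : ∀ u, Γ u univ = ENNReal.ofReal (toPEnergyForm.E u)
  /-- Strong locality. -/
  strongly_local : ∀ (u v : toPEnergyForm.Dom) (f g : X → ℝ),
    PEnergyForm.IsCcRep u f → PEnergyForm.IsCcRep v g → ∀ U : Set X, IsOpen U →
    (∃ c : ℝ, ∀ x ∈ U, f x - g x = c) → (Γ u).restrict U = (Γ v).restrict U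

/-- The volume doubling property (VD). -/
def VolumeDoubling {X : Type*} [MetricSpace X] [MeasurableSpace X] (m : Measure X) : Prop :=
  ∃ c : ℝ≥0, 1 ≤ c ∧ ∀ (x : X) (r : ℝ), 0 < r →
    m (Metric.ball x (2 * r)) ≤ c * m (Metric.ball x r)

/-- Scale functions: increasing homeomorphisms of `(0, ∞)` with two-sided power bounds on the
quotients `Ψ R / Ψ r`. The values of `Ψ` outside `(0, ∞)` are irrelevant. -/
structure IsScaleFunction (Ψ : ℝ → ℝ) : Prop where
  continuousOn : ContinuousOn Ψ (Ioi 0)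
  strictMonoOn : StrictMonoOn Ψ (Ioi 0)
  bijOn : BijOn Ψ (Ioi 0) (Ioi 0)
  scaling : ∃ C β₁ β₂ : ℝ, 1 ≤ C ∧ 0 < β₁ ∧ 0 < β₂ ∧ ∀ r R : ℝ, 0 < r → r ≤ R →
    C⁻¹ * (R / r) ^ β₁ ≤ Ψ R / Ψ r ∧ Ψ R / Ψ r ≤ C * (R / r) ^ β₂

namespace PEnergyStructure

variable {X : Type*} [MetricSpace X] [MeasurableSpace X] {m : Measure X} {p : ℝ} [Fact (1 < p)]

/-- The `(p,p)`-Poincaré inequality `PI_p(Ψ)`. -/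
def Poincare (𝓔 : PEnergyStructure m p) (Ψ : ℝ → ℝ) : Prop :=
  ∃ C A : ℝ, 0 < C ∧ 1 ≤ A ∧ ∀ (x : X) (r : ℝ), 0 < r → ∀ u : 𝓔.Dom,
    ∫⁻ y in Metric.ball x r,
        ENNReal.ofReal (|u.toLp y - ⨍ z in Metric.ball x r, u.toLp z ∂m| ^ p) ∂m
      ≤ ENNReal.ofReal (C * Ψ r) * 𝓔.Γ u (Metric.ball x (A * r))

/-- The set `F_p(E₁, E₀)` of all `u ∈ F_p` with `u = 1` a.e. on `E₁` and `u = 0` a.e. on `E₀`. -/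
def cutoffs (𝓔 : PEnergyStructure m p) (E₁ E₀ : Set X) : Set 𝓔.Dom :=
  {u | (∀ᵐ x ∂m, x ∈ E₁ → u.toLp x = 1) ∧ ∀ᵐ x ∂m, x ∈ E₀ → u.toLp x = 0}

/-- The `p`-capacity upper estimate `cap_p(Ψ)_≤`. The infimum is taken in `[0, ∞]`. -/
def CapacityUpper (𝓔 : PEnergyStructure m p) (Ψ : ℝ → ℝ) : Prop :=
  ∃ C A₁ A₂ : ℝ, 1 < C ∧ 1 < A₁ ∧ 1 < A₂ ∧ ∀ (x : X) (R : ℝ), 0 < R →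
    ENNReal.ofReal R < Metric.ediam (univ : Set X) / ENNReal.ofReal A₂ →
    ⨅ u ∈ 𝓔.cutoffs (Metric.ball x R) (Metric.ball x (A₁ * R))ᶜ, ENNReal.ofReal (𝓔.E u)
      ≤ ENNReal.ofReal C * (m (Metric.ball x R) / ENNReal.ofReal (Ψ R))

end PEnergyStructure

/-- `A` is an open set which is relatively compact in the open set `U`. -/
def IsRelCompactOpen {X : Type*} [TopologicalSpace X] (A U : Set X) : Prop :=
  IsOpen A ∧ IsCompact (closure A) ∧ closure A ⊆ U

namespace PEnergyStructure

variable {X : Type*} [MetricSpace X] [MeasurableSpace X] {m : Measure X} {p : ℝ} [Fact (1 < p)]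

/-- `u ∈ F_{p,loc}(U)`; only the values of `u` on `U` matter, up to null sets. -/
def MemLoc (𝓔 : PEnergyStructure m p) (U : Set X) (u : X → ℝ) : Prop :=
  AEMeasurable u (m.restrict U) ∧
    ∀ A, IsRelCompactOpen A U → ∃ v : 𝓔.Dom, u =ᵐ[m.restrict A] v.toLp

/-- The local energy measure `Γ_{p,U}⟨u⟩(B)` of a Borel set `B ⊆ U`, for `u ∈ F_{p,loc}(U)`: the
value `Γ⟨v⟩(B ∩ A)`, where `v ∈ F_p` agrees with `u` a.e. on `A`, does not depend on `v` and is
nondecreasing in the relatively compact open subset `A` of `U`; one takes its limit as `A`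
exhausts `U`, that is, its supremum. -/
def localΓ (𝓔 : PEnergyStructure m p) (U : Set X) (u : X → ℝ) (B : Set X) : ℝ≥0∞ :=
  ⨆ (A : Set X) (_ : IsRelCompactOpen A U) (v : 𝓔.Dom) (_ : u =ᵐ[m.restrict A] v.toLp),
    𝓔.Γ v (B ∩ A)

/-- `u ∈ F_p(U)`. -/
def MemOn (𝓔 : PEnergyStructure m p) (U : Set X) (u : X → ℝ) : Prop :=
  𝓔.MemLoc U u ∧ ∫⁻ x in U, ENNReal.ofReal (|u x| ^ p) ∂m + 𝓔.localΓ U u U < ∞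

/-- The extension property (E) of a set `Ω` (meant for open sets). -/
def ExtensionProperty (𝓔 : PEnergyStructure m p) (Ω : Set X) : Prop :=
  Ω ≠ univ ∧ ∀ f : X → ℝ, 𝓔.MemOn Ω f →
    ∃ F : 𝓔.Dom, f =ᵐ[m.restrict Ω] F.toLp ∧ 𝓔.Γ F (frontier Ω) = 0

end PEnergyStructure

section Mollifiers

variable {X : Type*} [MetricSpace X] [MeasurableSpace X]

/-- Lower bounds for a family of mollifiers: either the first bound holds throughout, or the
second one does. Radon measures on `(0, ∞)` are represented by measures on `ℝ` that are finite on
compact subsets of `(0, ∞)`; their behaviour on `(-∞, 0]` plays no role. -/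
def KernelLower (m : Measure X) (Ψ : ℝ → ℝ) (ρ : ℝ → X → X → ℝ≥0∞) (Cρ : ℝ≥0) : Prop :=
  (∀ ε : ℝ, 0 < ε → ∀ x y : X, 0 < dist x y → dist x y ≤ 1 →
    (Cρ : ℝ≥0∞)⁻¹ * (ENNReal.ofReal (Ψ (dist x y)) / ENNReal.ofReal (Ψ ε)) *
        ((Metric.ball y ε).indicator (fun _ => (1 : ℝ≥0∞)) x / m (Metric.ball y ε))
      ≤ ρ ε x y) ∨
  ∃ ν : ℝ → Measure ℝ,
    (∀ ε : ℝ, 0 < ε → ∀ K ⊆ Ioi (0 : ℝ), IsCompact K → ν ε K < ∞) ∧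
    (∀ δ : ℝ, 0 < δ → (Cρ : ℝ≥0∞)⁻¹ ≤
      liminf (fun ε => ∫⁻ t in Ioo 0 δ, ENNReal.ofReal (Ψ t) ∂(ν ε)) (𝓝[>] (0 : ℝ))) ∧
    ∀ ε : ℝ, 0 < ε → ∀ x y : X, 0 < dist x y → dist x y ≤ 1 →
      ENNReal.ofReal (Ψ (dist x y)) * (ν ε (Ioi (dist x y)) / m (Metric.ball y (dist x y)))
        ≤ ρ ε x y

/-- `∑_{j ≥ 0} a_j 1_{B(y, 2^{-j} R) \ B(y, 2^{-j-1} R)}(x) / m(B(y, 2^{-j} R))`; the index is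
shifted by one, so `a_j` is the coefficient usually written `d_{j+1}`. -/
def dyadicKernel (m : Measure X) (a : ℕ → ℝ≥0) (R : ℝ) (x y : X) : ℝ≥0∞ :=
  ∑' j : ℕ, (a j : ℝ≥0∞) *
    ((Metric.ball y ((1 / 2) ^ j * R) \ Metric.ball y ((1 / 2) ^ (j + 1) * R)).indicator
      (fun _ => (1 : ℝ≥0∞)) x / m (Metric.ball y ((1 / 2) ^ j * R)))

/-- The assumption on nonlocal mollifiers: dyadic upper bound at distances less than one,
vanishing of the tails (in both variables), and the lower bounds. -/
def NonlocalKernel (m : Measure X) (Ψ : ℝ → ℝ) (ρ : ℝ → X → X → ℝ≥0∞) : Prop :=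
  ∃ Cρ : ℝ≥0, 0 < Cρ ∧
    (∃ a : ℝ → ℕ → ℝ≥0, ∀ ε : ℝ, 0 < ε → ∑' j, (a ε j : ℝ≥0∞) ≤ Cρ ∧
      ∀ x y : X, 0 < dist x y → dist x y < 1 → ρ ε x y ≤ dyadicKernel m (a ε) 1 x y) ∧
    (∀ δ : ℝ, 0 < δ →
      Tendsto (fun ε => essSup (fun y => ∫⁻ x in (Metric.ball y δ)ᶜ,
        ρ ε x y / ENNReal.ofReal (Ψ (dist x y)) ∂m) m) (𝓝[>] (0 : ℝ)) (𝓝 0) ∧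
      Tendsto (fun ε => essSup (fun y => ∫⁻ x in (Metric.ball y δ)ᶜ,
        ρ ε y x / ENNReal.ofReal (Ψ (dist x y)) ∂m) m) (𝓝[>] (0 : ℝ)) (𝓝 0)) ∧
    KernelLower m Ψ ρ Cρ

/-- The assumption on local mollifiers: dyadic upper bound at scale `ε` and the lower bounds. -/
def LocalKernel (m : Measure X) (Ψ : ℝ → ℝ) (ρ : ℝ → X → X → ℝ≥0∞) : Prop :=
  ∃ Cρ : ℝ≥0, 0 < Cρ ∧
    (∃ a : ℝ → ℕ → ℝ≥0, ∀ ε : ℝ, 0 < ε → ∑' j, (a ε j : ℝ≥0∞) ≤ Cρ ∧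
      ∀ x y : X, 0 < dist x y → ρ ε x y ≤ dyadicKernel m (a ε) ε x y) ∧
    KernelLower m Ψ ρ Cρ

/-- `∫_Ω ∫_Ω |u(x) - u(y)|^p / Ψ(d(x,y)) k(x,y) m(dx) m(dy)`; the integrand vanishes on the
diagonal. -/
def nonlocalEnergy (m : Measure X) (p : ℝ) (Ψ : ℝ → ℝ) (k : X → X → ℝ≥0∞) (Ω : Set X)
    (u : X → ℝ) : ℝ≥0∞ :=
  ∫⁻ y in Ω, ∫⁻ x in Ω,
    ENNReal.ofReal (|u x - u y| ^ p) / ENNReal.ofReal (Ψ (dist x y)) * k x y ∂m ∂m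

end Mollifiers

end

/-! Everything is compared with the Korevaar–Schoen energies `ksEnergy` at scale r: the double
integral of |u(x) - u(y)|^p over pairs in Ω with d(x,y) < r, normalised by m(B(y,r)).

Upper bound. The Poincaré inequality on the balls of an r-net, with bounded overlap, bounds this
energy by CΨ(r) times the Γ⟨u⟩-mass of a κr-neighbourhood of Ω (`exists_ksEnergy_le`). A dyadic
kernel superposes such energies over scales; Ψ cancels and only the summable weights remain
(`exists_dyadicKernel_le`). Under Assumption 1 the distances beyond δ add a tail that vanishes as ε
↓ 0. Shrinking the neighbourhood leaves the mass of the closure of Ω, and (E) makes the boundary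
negligible for the extension.

Lower bound. The capacity estimate provides partitions of unity at scale r with controlled energy
(`exists_partition`). The sum of c_n ψ_n, with c_n a typical value of u near the n-th net point, has
energy at most C `ksEnergy` / Ψ(r) on the r-interior of U, and its L^p distance to u tends to 0
because `ksEnergy` = O(Ψ(r)) (`exists_approximation`). Reflexivity makes energy measures lower
semicontinuous along L^p-convergent sequences of bounded energy (`exists_limit`), so Γ⟨u⟩(U) ≤ C
liminf `ksEnergy` / Ψ(r) (`exists_Γ_le_liminf`). Condition (L) bounds the nonlocal energy below by
the Korevaar–Schoen energy at scale ε, or by a ν_ε-superposition of these energies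
(`KernelLower.liminf_le`).

The local estimates need strong locality on all of F_p, not only on C_c. No Leibniz rule is assumed:
products of bounded functions are controlled by polarisation and the Lipschitz contraction property.
For local kernels the upper bound on X holds at every ε, which together with the lower bound gives
the final claim. -/

/-! ### Weak compactness in reflexive spaces -/

/-- In the bidual, the half-spaces containing C n cut a ball in a weak-* compact set
(Banach–Alaoglu). These sets decrease and hence share a point; surjectivity brings it back to V, and
Hahn–Banach places it in every C n. -/
theorem exists_mem_iInter_of_reflexive {V : Type*} [NormedAddCommGroup V] [NormedSpace ℝ V]
    (hV : Function.Surjective (NormedSpace.inclusionInDoubleDual ℝ V)) (C : ℕ → Set V)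
    (hanti : Antitone C) (hne : ∀ n, (C n).Nonempty) (hclosed : ∀ n, IsClosed (C n))
    (hconv : ∀ n, Convex ℝ (C n)) (R : ℝ) (hR : C 0 ⊆ Metric.closedBall 0 R) :
    ∃ x, ∀ n, x ∈ C n := by
  let K : ℕ → Set (WeakDual ℝ (StrongDual ℝ V)) := fun n =>
    (WeakDual.toStrongDual ⁻¹' Metric.closedBall (0 : StrongDual ℝ (StrongDual ℝ V)) R) ∩
      ⋂ (f : StrongDual ℝ V) (c : ℝ) (_ : ∀ x ∈ C n, f x ≤ c), {φ | φ f ≤ c}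
  have hKclosed : ∀ n, IsClosed (⋂ (f : StrongDual ℝ V) (c : ℝ) (_ : ∀ x ∈ C n, f x ≤ c),
      {φ : WeakDual ℝ (StrongDual ℝ V) | φ f ≤ c}) := fun n =>
    isClosed_iInter fun f => isClosed_iInter fun c => isClosed_iInter fun _ =>
      isClosed_le (WeakDual.eval_continuous f) continuous_const
  have hball := WeakDual.isCompact_closedBall (𝕜 := ℝ) (0 : StrongDual ℝ (StrongDual ℝ V)) R
  have hKc : ∀ n, IsCompact (K n) := fun n => hball.inter_right (hKclosed n)
  obtain ⟨φ, hφ⟩ := IsCompact.nonempty_iInter_of_sequence_nonempty_isCompact_isClosed K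
    (fun n => inter_subset_inter_right _ (iInter₂_mono fun f c =>
      iInter_mono' fun h => ⟨fun x hx => h x (hanti n.le_succ hx), subset_rfl⟩))
    (fun n => by
      obtain ⟨x, hx⟩ := hne n
      refine ⟨StrongDual.toWeakDual (NormedSpace.inclusionInDoubleDual ℝ V x), ?_, ?_⟩
      · have h1 := hR (hanti (Nat.zero_le n) hx)
        simp only [mem_closedBall_zero_iff] at h1
        have h2 : NormedSpace.inclusionInDoubleDual ℝ V x ∈
            Metric.closedBall (0 : StrongDual ℝ (StrongDual ℝ V)) R :=
          (mem_closedBall_zero_iff (E := StrongDual ℝ (StrongDual ℝ V))).2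
            ((NormedSpace.double_dual_bound ℝ V x).trans h1)
        exact h2
      · simp only [mem_iInter]
        intro f c h
        exact h x hx)
    (hKc 0) (fun n => (hKc n).isClosed)
  obtain ⟨x, hx⟩ := hV (WeakDual.toStrongDual φ)
  refine ⟨x, fun n => ?_⟩
  by_contra hxn
  obtain ⟨f, c, hfc, hcx⟩ := geometric_hahn_banach_closed_point (hconv n) (hclosed n) hxn
  have h1 := (mem_iInter.1 hφ n).2
  simp only [mem_iInter] at h1
  have h2 : φ f ≤ c := h1 f c fun x hx => (hfc x hx).le
  have h3 : f x = φ f := by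
    rw [← NormedSpace.dual_def ℝ V x f, hx]; rfl
  linarith

/-! ### Energy seminorms and lower semicontinuity -/

namespace PEnergyForm

variable {X : Type*} [MeasurableSpace X] {m : Measure X} {p : ℝ} [Fact (1 < p)]

theorem Dom.toLp_add {𝓔 : PEnergyForm m p} (u v : 𝓔.Dom) : (u + v).toLp = u.toLp + v.toLp := rfl

theorem Dom.toLp_sub {𝓔 : PEnergyForm m p} (u v : 𝓔.Dom) : (u - v).toLp = u.toLp - v.toLp := rfl

theorem Dom.toLp_smul {𝓔 : PEnergyForm m p} (c : ℝ) (u : 𝓔.Dom) :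
    (c • u).toLp = c • u.toLp := rfl

theorem E_nonneg (𝓔 : PEnergyForm m p) (u : 𝓔.Dom) : 0 ≤ 𝓔.E u := 𝓔.isPEnergyForm.1 u

end PEnergyForm

theorem enorm_Lp_rpow {X : Type*} [MeasurableSpace X] {m : Measure X} {p : ℝ} [hp : Fact (1 < p)]
    (f : Lp ℝ (ENNReal.ofReal p) m) :
    ∫⁻ x, ENNReal.ofReal (|f x| ^ p) ∂m = ENNReal.ofReal ‖f‖ ^ p := by
  have hp0 : 0 < p := zero_lt_one.trans hp.out
  rw [ofReal_norm, Lp.enorm_def,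
    eLpNorm_eq_lintegral_rpow_enorm_toReal (by simpa using hp0) ENNReal.ofReal_ne_top,
    ENNReal.toReal_ofReal hp0.le, ← ENNReal.rpow_mul, one_div_mul_cancel hp0.ne', ENNReal.rpow_one]
  refine lintegral_congr fun x => ?_
  rw [← ENNReal.ofReal_rpow_of_nonneg (abs_nonneg _) hp0.le, Real.enorm_eq_ofReal_abs]

namespace PEnergyStructure

variable {X : Type*} [MetricSpace X] [MeasurableSpace X] {m : Measure X} {p : ℝ} [hp : Fact (1 < p)]

/-- The seminorm `Γ⟨u⟩(A) ^ (1/p)`. -/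
noncomputable def semi (𝓔 : PEnergyStructure m p) (A : Set X) (u : 𝓔.Dom) : ℝ :=
  (𝓔.Γ u).real A ^ (1 / p)

variable (𝓔 : PEnergyStructure m p)

instance (u : 𝓔.Dom) : IsFiniteMeasure (𝓔.Γ u) := 𝓔.finite_Γ u

omit hp in
theorem exponent_pos [hp : Fact (1 < p)] : 0 < p := zero_lt_one.trans hp.out

theorem semi_nonneg (A : Set X) (u : 𝓔.Dom) : 0 ≤ 𝓔.semi A u :=
  Real.rpow_nonneg measureReal_nonneg _

theorem semi_add_le {A : Set X} (hA : MeasurableSet A) (u v : 𝓔.Dom) :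
    𝓔.semi A (u + v) ≤ 𝓔.semi A u + 𝓔.semi A v := by
  obtain ⟨-, s, hs⟩ := 𝓔.isPEnergyForm_Γ A hA
  simp only [semi, ← hs]
  exact map_add_le_add s u v

theorem semi_smul {A : Set X} (hA : MeasurableSet A) (c : ℝ) (u : 𝓔.Dom) :
    𝓔.semi A (c • u) = |c| * 𝓔.semi A u := by
  obtain ⟨-, s, hs⟩ := 𝓔.isPEnergyForm_Γ A hA
  simp only [semi, ← hs]
  exact map_smul_eq_mul s c u

theorem semi_zero {A : Set X} (hA : MeasurableSet A) : 𝓔.semi A 0 = 0 := by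
  have := 𝓔.semi_smul hA 0 0
  simpa using this

theorem semi_sub_le {A : Set X} (hA : MeasurableSet A) (u v : 𝓔.Dom) :
    𝓔.semi A (u - v) ≤ 𝓔.semi A u + 𝓔.semi A v := by
  have h1 := 𝓔.semi_add_le hA u ((-1 : ℝ) • v)
  rw [𝓔.semi_smul hA] at h1
  simpa [sub_eq_add_neg] using h1

theorem semi_univ (u : 𝓔.Dom) : 𝓔.semi univ u = 𝓔.E u ^ (1 / p) := by
  rw [semi, Measure.real, 𝓔.Γ_univ, ENNReal.toReal_ofReal (𝓔.E_nonneg u)]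

theorem semi_mono {A B : Set X} (h : A ⊆ B) (u : 𝓔.Dom) : 𝓔.semi A u ≤ 𝓔.semi B u :=
  Real.rpow_le_rpow measureReal_nonneg (measureReal_mono h)
    (one_div_nonneg.2 exponent_pos.le)

theorem norm_eq (u : 𝓔.Dom) : ‖u‖ = ‖u.toLp‖ + 𝓔.semi univ u := by
  rw [semi_univ]; rfl

theorem semi_le_norm (A : Set X) (u : 𝓔.Dom) : 𝓔.semi A u ≤ ‖u‖ := by
  rw [norm_eq]
  exact (𝓔.semi_mono (subset_univ A) u).trans (le_add_of_nonneg_left (norm_nonneg _))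

theorem ofReal_semi_rpow (A : Set X) (u : 𝓔.Dom) : ENNReal.ofReal (𝓔.semi A u) ^ p = 𝓔.Γ u A := by
  rw [semi, ENNReal.ofReal_rpow_of_nonneg (Real.rpow_nonneg measureReal_nonneg _) exponent_pos.le,
    ← Real.rpow_mul measureReal_nonneg, one_div_mul_cancel exponent_pos.ne', Real.rpow_one,
    ofReal_measureReal]

theorem Γ_le_iff (A : Set X) (u : 𝓔.Dom) {c : ℝ} (hc : 0 ≤ c) :
    𝓔.semi A u ≤ c ↔ 𝓔.Γ u A ≤ ENNReal.ofReal c ^ p := by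
  rw [← ofReal_semi_rpow, ENNReal.rpow_le_rpow_iff exponent_pos, ENNReal.ofReal_le_ofReal_iff hc]

theorem semi_eq_zero_iff (A : Set X) (u : 𝓔.Dom) : 𝓔.semi A u = 0 ↔ 𝓔.Γ u A = 0 := by
  rw [← ofReal_semi_rpow, ENNReal.rpow_eq_zero_iff_of_pos exponent_pos, ENNReal.ofReal_eq_zero]
  exact ⟨fun h => h.le, fun h => le_antisymm h (𝓔.semi_nonneg A u)⟩

theorem continuous_semi {A : Set X} (hA : MeasurableSet A) : Continuous (𝓔.semi A) := by
  refine (LipschitzWith.of_le_add fun u v => ?_).continuous (K := 1)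
  have h1 := 𝓔.semi_add_le hA v (u - v)
  rw [add_sub_cancel] at h1
  rw [dist_eq_norm]
  linarith [𝓔.semi_le_norm A (u - v)]

theorem isClosed_setOf_semi_le {A : Set X} (hA : MeasurableSet A) (c : ℝ) :
    IsClosed {u : 𝓔.Dom | 𝓔.semi A u ≤ c} :=
  isClosed_le (𝓔.continuous_semi hA) continuous_const

theorem convex_setOf_semi_le {A : Set X} (hA : MeasurableSet A) (c : ℝ) :
    Convex ℝ {u : 𝓔.Dom | 𝓔.semi A u ≤ c} := by
  intro u hu v hv a b ha hb hab
  have h1 := 𝓔.semi_add_le hA (a • u) (b • v)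
  rw [𝓔.semi_smul hA, 𝓔.semi_smul hA, abs_of_nonneg ha, abs_of_nonneg hb] at h1
  have hu' : 𝓔.semi A u ≤ c := hu
  have hv' : 𝓔.semi A v ≤ c := hv
  show 𝓔.semi A (a • u + b • v) ≤ c
  calc _ ≤ a * 𝓔.semi A u + b * 𝓔.semi A v := h1
    _ ≤ a * c + b * c := by gcongr
    _ = c := by rw [← add_mul, hab, one_mul]

/-- A sequence bounded in energy which converges in `L^p` has its limit in the domain, and
upper bounds on energy measures pass to the limit. -/
theorem exists_limit (u : ℕ → 𝓔.Dom) (R : ℝ) (hR : ∀ n, 𝓔.semi univ (u n) ≤ R)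
    (f : Lp ℝ (ENNReal.ofReal p) m) (hf : Tendsto (fun n => (u n).toLp) atTop (𝓝 f)) :
    ∃ v : 𝓔.Dom, v.toLp = f ∧ ∀ A, MeasurableSet A → ∀ c,
      (∀ᶠ n in atTop, 𝓔.semi A (u n) ≤ c) → 𝓔.semi A v ≤ c := by
  obtain ⟨R', hR'⟩ := (Metric.isBounded_range_of_tendsto _ hf).exists_norm_le
  -- A common point of the closed convex hulls of the tails replaces a weak limit: it satisfies
  -- every closed convex condition that holds along some tail, both closeness to `f` in L^p and
  -- bounds on a seminorm.
  let C : ℕ → Set 𝓔.Dom := fun n => closure (convexHull ℝ (u '' Ici n))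
  have hsub : ∀ n, ∀ S : Set 𝓔.Dom, IsClosed S → Convex ℝ S → (∀ k ≥ n, u k ∈ S) → C n ⊆ S := by
    intro n S h1 h2 h3
    refine closure_minimal (convexHull_min ?_ h2) h1
    rintro _ ⟨k, hk, rfl⟩
    exact h3 k hk
  obtain ⟨v, hv⟩ := exists_mem_iInter_of_reflexive 𝓔.reflexive C
    (fun i j hij => closure_mono (convexHull_mono (image_mono (Ici_subset_Ici.2 hij))))
    (fun n => ⟨u n, subset_closure (subset_convexHull ℝ _ ⟨n, self_mem_Ici, rfl⟩)⟩)
    (fun n => isClosed_closure) (fun n => (convex_convexHull ℝ _).closure) (R' + R)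
    (hsub 0 _ Metric.isClosed_closedBall (convex_closedBall _ _) fun k _ => by
      rw [mem_closedBall_zero_iff, norm_eq]
      exact add_le_add (hR' _ ⟨k, rfl⟩) (hR k))
  have hcont : Continuous (fun w : 𝓔.Dom => w.toLp) := by
    refine (LipschitzWith.of_dist_le_mul (K := 1) fun a b => ?_).continuous
    rw [dist_eq_norm, dist_eq_norm, ← PEnergyForm.Dom.toLp_sub, 𝓔.norm_eq (a - b)]
    simp only [NNReal.coe_one, one_mul]
    exact le_add_of_nonneg_right (𝓔.semi_nonneg _ _)
  refine ⟨v, ?_, fun A hA c hc => ?_⟩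
  · refine eq_of_forall_dist_le fun η hη => ?_
    obtain ⟨N, hN⟩ := (Metric.tendsto_atTop.1 hf) η hη
    refine hsub N {w : 𝓔.Dom | dist w.toLp f ≤ η}
      (isClosed_le (hcont.dist continuous_const) continuous_const) ?_
      (fun k hk => (hN k hk).le) (hv N)
    intro a ha b hb s t hs ht hst
    exact convex_closedBall f η (x := a.toLp) ha (y := b.toLp) hb hs ht hst
  · obtain ⟨N, hN⟩ := eventually_atTop.1 hc
    exact hsub N _ (𝓔.isClosed_setOf_semi_le hA c) (𝓔.convex_setOf_semi_le hA c) hN (hv N)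

/-- The function `f` represents an element of the domain with `E ^ (1/p) ≤ e`. -/
def EnergyLE (f : X → ℝ) (e : ℝ) : Prop :=
  ∃ v : 𝓔.Dom, v.toLp =ᵐ[m] f ∧ 𝓔.semi univ v ≤ e

end PEnergyStructure

/-! ### Truncation, Lipschitz calculus and cutoff functions -/

/-- Truncation of `t` at the levels `-k` and `k`. -/
def clamp (k t : ℝ) : ℝ := max (-k) (min t k)

theorem lipschitzWith_clamp (k : ℝ) : LipschitzWith 1 (clamp k) :=
  (LipschitzWith.id.min_const k).const_max (-k)

theorem clamp_zero {k : ℝ} (hk : 0 ≤ k) : clamp k 0 = 0 := by simp [clamp, hk]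

theorem abs_clamp_le {k : ℝ} (hk : 0 ≤ k) (t : ℝ) : |clamp k t| ≤ k :=
  abs_le.2 ⟨le_max_left _ _, max_le (by linarith) (min_le_right _ _)⟩

theorem clamp_eq_self {k t : ℝ} (h : |t| ≤ k) : clamp k t = t := by
  rw [abs_le] at h
  rw [clamp, min_eq_left h.2, max_eq_right h.1]

theorem abs_clamp_sub_clamp_le (k s t : ℝ) : |clamp k s - clamp k t| ≤ |s - t| := by
  simpa [Real.dist_eq] using (lipschitzWith_clamp k).dist_le_mul s t

theorem abs_clamp_sub_le {k : ℝ} (hk : 0 ≤ k) (t : ℝ) : |clamp k t - t| ≤ |t| := by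
  rcases le_total 0 t with ht | ht
  · have h1 : clamp k t ≤ t := max_le (by linarith) (min_le_left _ _)
    have h2 : 0 ≤ clamp k t := le_max_of_le_right (le_min ht hk)
    rw [abs_le, abs_of_nonneg ht]; constructor <;> linarith
  · have h1 : t ≤ clamp k t := le_max_of_le_right (le_min le_rfl (by linarith))
    have h2 : clamp k t ≤ 0 := max_le (by linarith) ((min_le_left _ _).trans ht)
    rw [abs_le, abs_of_nonpos ht]; constructor <;> linarith

/-- The square is not globally Lipschitz; truncated at 2 it is, and it is unchanged at sums and
differences of numbers in [-1, 1]. This serves the polarisation in `EnergyLE.mul`. -/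
theorem lipschitzWith_sq_clamp : LipschitzWith 4 (fun t => clamp 2 t ^ 2) := by
  refine LipschitzWith.of_dist_le_mul fun s t => ?_
  rw [Real.dist_eq, Real.dist_eq]
  have h1 := abs_clamp_sub_clamp_le 2 s t
  have h2 := abs_clamp_le (k := 2) (by norm_num) s
  have h3 := abs_clamp_le (k := 2) (by norm_num) t
  have h4 : |clamp 2 s + clamp 2 t| ≤ 4 := (abs_add_le _ _).trans (by linarith)
  rw [show clamp 2 s ^ 2 - clamp 2 t ^ 2 = (clamp 2 s + clamp 2 t) * (clamp 2 s - clamp 2 t) by ring,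
    abs_mul]
  exact mul_le_mul h4 h1 (abs_nonneg _) (by norm_num)

namespace PEnergyStructure

variable {X : Type*} [MetricSpace X] [MeasurableSpace X] {m : Measure X} {p : ℝ} [hp : Fact (1 < p)]
variable {𝓔 : PEnergyStructure m p}

theorem EnergyLE.congr {f g : X → ℝ} {e : ℝ} (h : 𝓔.EnergyLE f e) (hfg : f =ᵐ[m] g) :
    𝓔.EnergyLE g e := by
  obtain ⟨v, hv, hve⟩ := h
  exact ⟨v, hv.trans hfg, hve⟩

theorem EnergyLE.mono {f : X → ℝ} {e e' : ℝ} (h : 𝓔.EnergyLE f e) (hee : e ≤ e') :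
    𝓔.EnergyLE f e' := by
  obtain ⟨v, hv, hve⟩ := h
  exact ⟨v, hv, hve.trans hee⟩

theorem energyLE_self (u : 𝓔.Dom) : 𝓔.EnergyLE u.toLp (𝓔.semi univ u) := ⟨u, ae_eq_rfl, le_rfl⟩

theorem energyLE_zero : 𝓔.EnergyLE (fun _ => 0) 0 :=
  ⟨0, Lp.coeFn_zero ℝ (ENNReal.ofReal p) m, (𝓔.semi_zero MeasurableSet.univ).le⟩

theorem EnergyLE.add {f g : X → ℝ} {e e' : ℝ} (hf : 𝓔.EnergyLE f e) (hg : 𝓔.EnergyLE g e') :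
    𝓔.EnergyLE (fun x => f x + g x) (e + e') := by
  obtain ⟨v, hv, hve⟩ := hf
  obtain ⟨w, hw, hwe⟩ := hg
  refine ⟨v + w, ?_, (𝓔.semi_add_le MeasurableSet.univ v w).trans (add_le_add hve hwe)⟩
  rw [PEnergyForm.Dom.toLp_add]
  filter_upwards [Lp.coeFn_add v.toLp w.toLp, hv, hw] with x h1 h2 h3
  rw [h1, Pi.add_apply, h2, h3]

theorem EnergyLE.const_mul {f : X → ℝ} {e : ℝ} (hf : 𝓔.EnergyLE f e) (c : ℝ) :
    𝓔.EnergyLE (fun x => c * f x) (|c| * e) := by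
  obtain ⟨v, hv, hve⟩ := hf
  refine ⟨c • v, ?_, ?_⟩
  · rw [PEnergyForm.Dom.toLp_smul]
    filter_upwards [Lp.coeFn_smul c v.toLp, hv] with x h1 h2
    rw [h1, Pi.smul_apply, h2, smul_eq_mul]
  · rw [𝓔.semi_smul MeasurableSet.univ]
    exact mul_le_mul_of_nonneg_left hve (abs_nonneg c)

theorem EnergyLE.sub {f g : X → ℝ} {e e' : ℝ} (hf : 𝓔.EnergyLE f e) (hg : 𝓔.EnergyLE g e') :
    𝓔.EnergyLE (fun x => f x - g x) (e + e') := by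
  simpa [sub_eq_add_neg] using hf.add (hg.const_mul (-1))

theorem energyLE_sum {ι : Type*} (s : Finset ι) {f : ι → X → ℝ} {e : ι → ℝ}
    (h : ∀ i ∈ s, 𝓔.EnergyLE (f i) (e i)) :
    𝓔.EnergyLE (fun x => ∑ i ∈ s, f i x) (∑ i ∈ s, e i) := by
  classical
  induction s using Finset.induction_on with
  | empty => simpa using energyLE_zero
  | insert a s ha ih =>
    simp only [Finset.sum_insert ha]
    exact (h a (Finset.mem_insert_self a s)).add
      (ih fun i hi => h i (Finset.mem_insert_of_mem hi))

/-- The contraction property covers 1-Lipschitz maps only, so φ is divided by L and the result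
multiplied back. -/
theorem EnergyLE.comp_lipschitz {f : X → ℝ} {e : ℝ} (hf : 𝓔.EnergyLE f e) {L : ℝ≥0} {φ : ℝ → ℝ}
    (hφ : LipschitzWith L φ) (hφ0 : φ 0 = 0) : 𝓔.EnergyLE (fun x => φ (f x)) (L * e) := by
  rcases eq_or_ne L 0 with rfl | hL
  · have h1 : ∀ t, φ t = 0 := fun t => by
      have := hφ.dist_le_mul t 0
      simpa [hφ0] using this
    simpa [h1] using energyLE_zero
  have hL' : (0 : ℝ) < L := by positivity
  obtain ⟨v, hv, hve⟩ := hf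
  obtain ⟨w, hw, hwe⟩ := 𝓔.lipschitz_contraction v (fun t => (L : ℝ)⁻¹ * φ t)
    (LipschitzWith.of_dist_le_mul fun s t => by
      have h1 := hφ.dist_le_mul s t
      rw [Real.dist_eq] at h1
      rw [Real.dist_eq, ← mul_sub, abs_mul, abs_of_pos (inv_pos.2 hL'), inv_mul_le_iff₀ hL']
      simpa using h1) (by simp [hφ0])
  have h2 : 𝓔.EnergyLE (fun x => (L : ℝ)⁻¹ * φ (f x)) e := by
    refine ⟨w, ?_, le_trans ?_ hve⟩
    · filter_upwards [hw, hv] with x h1 h2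
      rw [h1, h2]
    · rw [semi_univ, semi_univ]
      exact Real.rpow_le_rpow (𝓔.E_nonneg w) hwe (one_div_nonneg.2 exponent_pos.le)
  have h3 := h2.const_mul L
  rw [abs_of_pos hL'] at h3
  refine h3.congr (Eventually.of_forall fun x => ?_)
  show (L : ℝ) * ((L : ℝ)⁻¹ * φ (f x)) = φ (f x)
  rw [mul_inv_cancel_left₀ hL'.ne']

theorem EnergyLE.clamp {f : X → ℝ} {e : ℝ} (hf : 𝓔.EnergyLE f e) {k : ℝ} (hk : 0 ≤ k) :
    𝓔.EnergyLE (fun x => clamp k (f x)) e := by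
  simpa using hf.comp_lipschitz (lipschitzWith_clamp k) (clamp_zero hk)

/-- Polarisation: fg = ((f+g)² - (f-g)²)/4. Each square has energy at most 4(e + e'), which gives
the constant 2. -/
theorem EnergyLE.mul {f g : X → ℝ} {e e' : ℝ} (hf : 𝓔.EnergyLE f e) (hg : 𝓔.EnergyLE g e')
    (hf1 : ∀ x, |f x| ≤ 1) (hg1 : ∀ x, |g x| ≤ 1) :
    𝓔.EnergyLE (fun x => f x * g x) (2 * (e + e')) := by
  have h1 := ((hf.add hg).comp_lipschitz lipschitzWith_sq_clamp
    (by simp [_root_.clamp])).const_mul (1 / 4)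
  have h2 := ((hf.sub hg).comp_lipschitz lipschitzWith_sq_clamp
    (by simp [_root_.clamp])).const_mul (1 / 4)
  have h3 := h1.sub h2
  rw [abs_of_pos (by norm_num : (0 : ℝ) < 1 / 4)] at h3
  simp only [NNReal.coe_ofNat] at h3
  refine (h3.congr (Eventually.of_forall fun x => ?_)).mono (by linarith)
  have ha := abs_add_le (f x) (g x)
  have hb := abs_sub (f x) (g x)
  have hf1 := hf1 x
  have hg1 := hg1 x
  simp only
  rw [clamp_eq_self (by linarith), clamp_eq_self (by linarith)]
  ring

theorem EnergyLE.mul_of_le {f g : X → ℝ} {e e' : ℝ} (hf : 𝓔.EnergyLE f e) (hg : 𝓔.EnergyLE g e')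
    {M : ℝ} (hM : 0 < M) (hf1 : ∀ x, |f x| ≤ 1) (hg1 : ∀ x, |g x| ≤ M) :
    𝓔.EnergyLE (fun x => f x * g x) (2 * (M * e + e')) := by
  have h1 := (hf.mul (hg.const_mul M⁻¹) hf1 fun x => by
    rw [abs_mul, abs_of_pos (inv_pos.2 hM), inv_mul_le_iff₀ hM, mul_one]; exact hg1 x).const_mul M
  rw [abs_of_pos hM, abs_of_pos (inv_pos.2 hM)] at h1
  refine (h1.congr (Eventually.of_forall fun x => ?_)).mono ?_
  · field_simp
  · field_simp; rfl

theorem tendsto_toLp_of_tendsto_lintegral {u : ℕ → 𝓔.Dom} {g : ℕ → X → ℝ}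
    {f : Lp ℝ (ENNReal.ofReal p) m} (hu : ∀ n, (u n).toLp =ᵐ[m] g n)
    (h : Tendsto (fun n => ∫⁻ x, ENNReal.ofReal (|g n x - f x| ^ p) ∂m) atTop (𝓝 0)) :
    Tendsto (fun n => (u n).toLp) atTop (𝓝 f) := by
  rw [tendsto_iff_norm_sub_tendsto_zero]
  have h1 : ∀ n, ∫⁻ x, ENNReal.ofReal (|g n x - f x| ^ p) ∂m
      = ENNReal.ofReal ‖(u n).toLp - f‖ ^ p := fun n => by
    rw [← enorm_Lp_rpow]
    refine lintegral_congr_ae ?_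
    filter_upwards [hu n, Lp.coeFn_sub (u n).toLp f] with x h1 h2
    rw [h2, Pi.sub_apply, h1]
  simp only [h1] at h
  have h2 := h.ennrpow_const (1 / p)
  rw [ENNReal.zero_rpow_of_pos (one_div_pos.2 exponent_pos)] at h2
  simp only [← ENNReal.rpow_mul, mul_one_div_cancel (exponent_pos (p := p)).ne',
    ENNReal.rpow_one] at h2
  have h3 := (ENNReal.tendsto_toReal ENNReal.zero_ne_top).comp h2
  simpa [Function.comp_def, ENNReal.toReal_ofReal (norm_nonneg _)] using h3

/-- The truncations of u converge to u in L^p without increasing the energy, so lower semicontinuity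
applies. This reduces estimates to bounded functions, for which products stay in the domain. -/
theorem Γ_le_of_forall_clamp (u : 𝓔.Dom) {A : Set X} (hA : MeasurableSet A) {c : ℝ≥0∞}
    (h : ∀ k : ℕ, ∀ v : 𝓔.Dom, v.toLp =ᵐ[m] (fun x => clamp k (u.toLp x)) → 𝓔.Γ v A ≤ c) :
    𝓔.Γ u A ≤ c := by
  rcases eq_or_ne c ∞ with rfl | hc
  · exact le_top
  choose v hv hve using fun k : ℕ => (energyLE_self u).clamp (Nat.cast_nonneg k)
  have hlim : Tendsto (fun k => (v k).toLp) atTop (𝓝 u.toLp) := by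
    refine tendsto_toLp_of_tendsto_lintegral hv ?_
    have hp0 : 0 < p := exponent_pos
    have hmeas : Measurable u.toLp := (Lp.stronglyMeasurable u.toLp).measurable
    have := tendsto_lintegral_of_dominated_convergence (μ := m)
      (F := fun (k : ℕ) x => ENNReal.ofReal (|clamp k (u.toLp x) - u.toLp x| ^ p))
      (f := fun _ => 0) (fun x => ENNReal.ofReal (|u.toLp x| ^ p))
      (fun k => by
        have := (lipschitzWith_clamp k).continuous.measurable.comp hmeas
        exact ((this.sub hmeas).abs.pow_const p).ennreal_ofReal)
      (fun k => Eventually.of_forall fun x => ENNReal.ofReal_le_ofReal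
        (Real.rpow_le_rpow (abs_nonneg _) (abs_clamp_sub_le (Nat.cast_nonneg k) _) hp0.le))
      (by rw [enorm_Lp_rpow]; exact (ENNReal.rpow_lt_top_of_nonneg hp0.le ENNReal.ofReal_ne_top).ne)
      (Eventually.of_forall fun x => by
        refine tendsto_const_nhds.congr' ?_
        obtain ⟨N, hN⟩ := exists_nat_ge |u.toLp x|
        filter_upwards [eventually_ge_atTop N] with k hk
        rw [clamp_eq_self (hN.trans (by exact_mod_cast hk)), sub_self, abs_zero,
          Real.zero_rpow hp0.ne', ENNReal.ofReal_zero])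
    simpa using this
  obtain ⟨w, hw, hwA⟩ := 𝓔.exists_limit v _ hve _ hlim
  obtain rfl : w = u := Subtype.ext hw
  lift c to ℝ≥0 using hc
  have h1 : (c : ℝ≥0∞) = ENNReal.ofReal ((c : ℝ) ^ (1 / p)) ^ p := by
    rw [ENNReal.ofReal_rpow_of_nonneg (by positivity) exponent_pos.le,
      ← Real.rpow_mul (by positivity), one_div_mul_cancel exponent_pos.ne', Real.rpow_one,
      ENNReal.ofReal_coe_nnreal]
  rw [h1, ← Γ_le_iff _ _ _ (by positivity)]
  refine hwA A hA _ (Eventually.of_forall fun k => ?_)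
  rw [Γ_le_iff _ _ _ (by positivity), ← h1]
  exact h k (v k) (hv k)

/-- A Urysohn function is approximated uniformly within 1/4 by an element of the domain; a piecewise
linear map then flattens the values above 3/4 to 1 and those below 1/4 to 0. -/
theorem exists_cutoff [LocallyCompactSpace X] (𝓔 : PEnergyStructure m p) {K A : Set X}
    (hK : IsCompact K) (hA : IsOpen A) (hKA : K ⊆ A) :
    ∃ (h : 𝓔.Dom) (g : X → ℝ) (V : Set X), PEnergyForm.IsCcRep h g ∧ (∀ x, 0 ≤ g x ∧ g x ≤ 1) ∧
      IsOpen V ∧ K ⊆ V ∧ (∀ x ∈ V, g x = 1) ∧ ∀ x, x ∉ A → g x = 0 := by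
  obtain ⟨f, hf1, hfc, hfA, -⟩ := exists_continuousMap_one_of_isCompact_subset_isOpen hK hA hKA
  obtain ⟨u, g, ⟨hgc, hgs, hug⟩, hfg⟩ :=
    𝓔.dense_in_Cc f f.continuous hfc (1 / 4) (by norm_num)
  let φ : ℝ → ℝ := fun t => max 0 (min (2 * (t - 1 / 4)) 1)
  have hφ0 : φ 0 = 0 := by norm_num [φ]
  have hφ : LipschitzWith 2 φ := by
    refine LipschitzWith.const_max (LipschitzWith.min_const ?_ 1) 0
    refine LipschitzWith.of_dist_le_mul fun s t => ?_
    rw [Real.dist_eq, Real.dist_eq, ← mul_sub, abs_mul]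
    norm_num
  obtain ⟨h, hh, -⟩ := (EnergyLE.congr (energyLE_self u) hug).comp_lipschitz hφ hφ0
  refine ⟨h, fun x => φ (g x), {x | 3 / 4 < g x}, ⟨hφ.continuous.comp hgc, ?_, hh⟩,
    fun x => ⟨le_max_left _ _, max_le zero_le_one (min_le_right _ _)⟩,
    isOpen_lt continuous_const hgc, fun x hx => ?_, fun x hx => ?_, fun x hx => ?_⟩
  · exact hgs.comp_left hφ0
  · have h1 := abs_lt.1 (hfg x)
    rw [hf1 hx] at h1
    simp only [Pi.one_apply] at h1
    show 3 / 4 < g x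
    linarith
  · have h1 : 3 / 4 < g x := hx
    show max 0 (min (2 * (g x - 1 / 4)) 1) = 1
    rw [min_eq_right (by linarith), max_eq_right zero_le_one]
  · have h1 := abs_lt.1 (hfg x)
    have h2 : f x = 0 := image_eq_zero_of_notMem_tsupport fun h => hx (hfA h)
    rw [h2] at h1
    show max 0 (min (2 * (g x - 1 / 4)) 1) = 0
    exact max_eq_left ((min_le_left _ _).trans (by linarith))

theorem isCcRep_zero : PEnergyForm.IsCcRep (0 : 𝓔.Dom) (fun _ => (0 : ℝ)) :=
  ⟨continuous_const, HasCompactSupport.zero, Lp.coeFn_zero ℝ (ENNReal.ofReal p) m⟩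

theorem Γ_eq_zero_of_isCcRep {u : 𝓔.Dom} {f : X → ℝ} (hu : PEnergyForm.IsCcRep u f)
    {U : Set X} (hU : IsOpen U) {c : ℝ} (hc : ∀ x ∈ U, f x = c) : 𝓔.Γ u U = 0 := by
  have h1 := 𝓔.strongly_local u 0 f (fun _ => 0) hu isCcRep_zero U hU ⟨c, fun x hx => by simp [hc x hx]⟩
  rw [← Measure.restrict_apply_self, h1, Measure.restrict_apply_self]
  have h2 := 𝓔.semi_zero MeasurableSet.univ
  rw [semi_eq_zero_iff] at h2
  exact measure_mono_null (subset_univ U) h2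

/-! ### Strong locality on the whole domain -/

section Locality

variable [LocallyCompactSpace X] [TopologicalSpace.SeparableSpace X] [BorelSpace X]

/-- Locality is given only for C_c functions. Near a point of A take a cutoff η supported in A and
elements g_n of C_c approximating w: the functions (1 - η) clamp(g_n) vanish where η = 1, so they
have no energy there. Since ηw = 0 they converge to w in L^p, and the product rule bounds their
energies, so the limit has no energy there either. -/
theorem Γ_eq_zero_of_bounded (w : 𝓔.Dom) {M : ℝ} (hM : 0 < M) (hwM : ∀ᵐ y ∂m, |w.toLp y| ≤ M)
    {A : Set X} (hA : IsOpen A) (hw : ∀ᵐ y ∂m, y ∈ A → w.toLp y = 0) : 𝓔.Γ w A = 0 := by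
  have : SecondCountableTopology X := UniformSpace.secondCountable_of_separable X
  refine measure_null_of_locally_null A fun x hx => ?_
  obtain ⟨h, η, V, ⟨hηc, hηs, hhη⟩, hη01, hV, hxV, hη1, hη0⟩ :=
    𝓔.exists_cutoff isCompact_singleton hA (singleton_subset_iff.2 hx)
  refine ⟨V, mem_nhdsWithin_of_mem_nhds (hV.mem_nhds (hxV rfl)), ?_⟩
  obtain ⟨v, hv, hvw⟩ := mem_closure_iff_seq_limit.1 (𝓔.dense_Cc w)
  choose g hgc hgs hvg using hv
  obtain ⟨R, hR⟩ := (Metric.isBounded_range_of_tendsto _ hvw).exists_norm_le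
  have hcont : ∀ n, Continuous fun y => clamp M (g n y) := fun n =>
    (lipschitzWith_clamp M).continuous.comp (hgc n)
  have hE : ∀ n, 𝓔.EnergyLE (fun y => clamp M (g n y)) R := fun n =>
    (((energyLE_self (v n)).congr (hvg n)).clamp hM.le).mono
      ((𝓔.semi_le_norm _ _).trans (hR _ ⟨n, rfl⟩))
  have hηle : ∀ y, |η y| ≤ 1 := fun y => abs_le.2 ⟨by linarith [(hη01 y).1], (hη01 y).2⟩
  have hk : ∀ n, 𝓔.EnergyLE (fun y => clamp M (g n y) - η y * clamp M (g n y))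
      (R + 2 * (M * 𝓔.semi univ h + R)) := fun n =>
    (hE n).sub (((energyLE_self h).congr hhη).mul_of_le (hE n) hM hηle
      fun y => abs_clamp_le hM.le _)
  choose k hkrep hkE using hk
  have hkCc : ∀ n, PEnergyForm.IsCcRep (k n)
      (fun y => clamp M (g n y) - η y * clamp M (g n y)) := fun n => by
    refine ⟨(hcont n).sub (hηc.mul (hcont n)), ?_, hkrep n⟩
    refine HasCompactSupport.sub ((hgs n).comp_left (clamp_zero hM.le)) ?_
    exact HasCompactSupport.mul_left ((hgs n).comp_left (clamp_zero hM.le))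
  have hlim : Tendsto (fun n => (k n).toLp) atTop (𝓝 w.toLp) := by
    rw [tendsto_iff_norm_sub_tendsto_zero]
    rw [tendsto_iff_norm_sub_tendsto_zero] at hvw
    refine squeeze_zero (fun n => norm_nonneg _) (fun n => ?_) hvw
    refine le_trans ?_ (show ‖(v n - w).toLp‖ ≤ ‖v n - w‖ from
      le_add_of_nonneg_right (Real.rpow_nonneg (𝓔.E_nonneg _) _))
    rw [PEnergyForm.Dom.toLp_sub]
    refine Lp.norm_le_norm_of_ae_le ?_
    filter_upwards [hkrep n, Lp.coeFn_sub (k n).toLp w.toLp, Lp.coeFn_sub (v n).toLp w.toLp,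
      hvg n, hw, hwM] with y h1 h2 h3 h4 h5 h6
    rw [h2, h3, Pi.sub_apply, Pi.sub_apply, h1, h4, Real.norm_eq_abs, Real.norm_eq_abs]
    have h7 : η y * w.toLp y = 0 := by
      by_cases hy : y ∈ A
      · rw [h5 hy, mul_zero]
      · rw [hη0 y hy, zero_mul]
    have h8 := abs_clamp_sub_clamp_le M (g n y) (w.toLp y)
    rw [clamp_eq_self h6] at h8
    rw [show clamp M (g n y) - η y * clamp M (g n y) - w.toLp y
      = (1 - η y) * (clamp M (g n y) - w.toLp y) - η y * w.toLp y by ring, h7, sub_zero, abs_mul]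
    refine le_trans ?_ h8
    refine mul_le_of_le_one_left (abs_nonneg _) ?_
    rw [abs_le]; constructor <;> linarith [(hη01 y).1, (hη01 y).2]
  obtain ⟨w', hw', hwA⟩ := 𝓔.exists_limit k _ hkE _ hlim
  obtain rfl : w' = w := Subtype.ext hw'
  rw [← semi_eq_zero_iff]
  refine le_antisymm (hwA V hV.measurableSet 0 (Eventually.of_forall fun n => ?_)) (𝓔.semi_nonneg _ _)
  exact ((𝓔.semi_eq_zero_iff _ _).2 (Γ_eq_zero_of_isCcRep (hkCc n) hV (c := 0) fun y hy => by
    rw [hη1 y hy]; ring)).le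

theorem Γ_eq_zero (w : 𝓔.Dom) {A : Set X} (hA : IsOpen A)
    (hw : ∀ᵐ y ∂m, y ∈ A → w.toLp y = 0) : 𝓔.Γ w A = 0 := by
  refine le_antisymm (Γ_le_of_forall_clamp w hA.measurableSet fun k v hv => ?_) zero_le
  refine (Γ_eq_zero_of_bounded v (M := k + 1) (by positivity) ?_ hA ?_).le
  · filter_upwards [hv] with y hy
    rw [hy]
    exact (abs_clamp_le (Nat.cast_nonneg k) _).trans (by linarith)
  · filter_upwards [hv, hw] with y hy hwy hyA
    rw [hy, hwy hyA, clamp_zero (Nat.cast_nonneg k)]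

/-- Strong locality for general elements of the domain. -/
theorem Γ_eq_of_sub_eq_const (u v : 𝓔.Dom) {A B : Set X} (hA : IsOpen A) (c : ℝ)
    (h : ∀ᵐ y ∂m, y ∈ A → u.toLp y - v.toLp y = c) (hBA : B ⊆ A) (hB : MeasurableSet B) :
    𝓔.Γ u B = 𝓔.Γ v B := by
  have : SecondCountableTopology X := UniformSpace.secondCountable_of_separable X
  have h0 : 𝓔.Γ (u - v) A = 0 := by
    refine measure_null_of_locally_null A fun x hx => ?_
    obtain ⟨g, η, V, hgη, hη01, hV, hxV, hη1, hη0⟩ :=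
      𝓔.exists_cutoff isCompact_singleton hA (singleton_subset_iff.2 hx)
    refine ⟨V ∩ A, inter_mem (mem_nhdsWithin_of_mem_nhds (hV.mem_nhds (hxV rfl)))
      self_mem_nhdsWithin, ?_⟩
    have hVA : IsOpen (V ∩ A) := hV.inter hA
    have h1 : 𝓔.semi (V ∩ A) g = 0 := (𝓔.semi_eq_zero_iff _ _).2
      (Γ_eq_zero_of_isCcRep hgη hVA fun y hy => hη1 y hy.1)
    -- Constants need not belong to the domain; c times a cutoff equal to 1 on V takes the place of
    -- the constant c there.
    have h2 : 𝓔.semi (V ∩ A) (u - v - c • g) = 0 := by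
      refine (𝓔.semi_eq_zero_iff _ _).2 (Γ_eq_zero _ hVA ?_)
      rw [PEnergyForm.Dom.toLp_sub, PEnergyForm.Dom.toLp_sub, PEnergyForm.Dom.toLp_smul]
      filter_upwards [h, hgη.2.2, Lp.coeFn_sub (u.toLp - v.toLp) (c • g.toLp),
        Lp.coeFn_sub u.toLp v.toLp, Lp.coeFn_smul c g.toLp] with y h3 h4 h5 h6 h7 hy
      rw [h5, Pi.sub_apply, h6, Pi.sub_apply, h7, Pi.smul_apply, h3 hy.2, h4, hη1 y hy.1]
      simp
    rw [← semi_eq_zero_iff]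
    refine le_antisymm ?_ (𝓔.semi_nonneg _ _)
    have h3 := 𝓔.semi_add_le hVA.measurableSet (u - v - c • g) (c • g)
    rwa [sub_add_cancel, 𝓔.semi_smul hVA.measurableSet, h1, h2, mul_zero, add_zero] at h3
  have h1 : 𝓔.semi B (u - v) = 0 := (𝓔.semi_eq_zero_iff _ _).2 (measure_mono_null hBA h0)
  rw [← ofReal_semi_rpow, ← ofReal_semi_rpow]
  congr 2
  refine le_antisymm ?_ ?_
  · have h2 := 𝓔.semi_add_le hB v (u - v)
    rwa [add_sub_cancel, h1, add_zero] at h2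
  · have h2 := 𝓔.semi_sub_le hB u (u - v)
    rwa [sub_sub_cancel, h1, add_zero] at h2

end Locality

end PEnergyStructure

/-! ### Separated nets, doubling and bounded overlap -/

/-- A set whose points have mutual distances at least `ε`. -/
def Separated {X : Type*} [MetricSpace X] (Z : Set X) (ε : ℝ) : Prop :=
  Z.Pairwise fun a b => ε ≤ dist a b

theorem exists_maximal_separated (X : Type*) [MetricSpace X] {ε : ℝ} (hε : 0 < ε) :
    ∃ Z : Set X, Separated Z ε ∧ ∀ x, ∃ z ∈ Z, dist x z < ε := by
  obtain ⟨Z, hZ⟩ := zorn_subset {Z : Set X | Separated Z ε} fun c hc hchain =>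
    ⟨⋃₀ c, (pairwise_sUnion hchain.directedOn).2 fun s hs => hc hs, fun s hs => subset_sUnion_of_mem hs⟩
  refine ⟨Z, hZ.prop, fun x => ?_⟩
  by_contra! hx
  have h1 : Separated (insert x Z) ε := by
    exact pairwise_insert.2 ⟨hZ.prop, fun b hb _ => ⟨hx b hb, by rw [dist_comm]; exact hx b hb⟩⟩
  have h2 : x ∈ Z := hZ.le_of_ge h1 (subset_insert x Z) (mem_insert x Z)
  have h3 := hx x h2
  rw [dist_self] at h3
  linarith

section Doubling

variable {X : Type*} [MetricSpace X] [MeasurableSpace X] {m : Measure X}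

theorem VolumeDoubling.measure_ball_lt_top [IsLocallyFiniteMeasure m] (hVD : VolumeDoubling m)
    (x : X) (r : ℝ) : m (Metric.ball x r) < ∞ := by
  obtain ⟨c, -, hc⟩ := hVD
  obtain ⟨U, hU, hmU⟩ := m.finiteAt_nhds x
  obtain ⟨r₀, hr₀, hrU⟩ := Metric.mem_nhds_iff.1 hU
  have h : ∀ k : ℕ, m (Metric.ball x (2 ^ k * r₀)) < ∞ := by
    intro k
    induction k with
    | zero => simpa using (measure_mono hrU).trans_lt hmU
    | succ k ih =>
      rw [pow_succ', mul_assoc]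
      exact (hc x _ (by positivity)).trans_lt (ENNReal.mul_lt_top ENNReal.coe_lt_top ih)
  obtain ⟨k, hk⟩ := pow_unbounded_of_one_lt (r / r₀) (one_lt_two (α := ℝ))
  refine (measure_mono (Metric.ball_subset_ball ?_)).trans_lt (h k)
  exact ((div_lt_iff₀ hr₀).1 hk).le

/-- Comparison of the measures of balls under doubling. -/
theorem VolumeDoubling.exists_compare (hVD : VolumeDoubling m) (K : ℝ) :
    ∃ D : ℝ≥0, 1 ≤ D ∧ ∀ (x y : X) (r s : ℝ), 0 < r → s + dist x y ≤ K * r →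
      m (Metric.ball y s) ≤ D * m (Metric.ball x r) := by
  obtain ⟨c, hc1, hc⟩ := hVD
  obtain ⟨k, hk⟩ := pow_unbounded_of_one_lt K (one_lt_two (α := ℝ))
  refine ⟨c ^ k, one_le_pow₀ hc1, fun x y r s hr hs => ?_⟩
  have h : ∀ k : ℕ, m (Metric.ball x (2 ^ k * r)) ≤ (c ^ k : ℝ≥0) * m (Metric.ball x r) := by
    intro k
    induction k with
    | zero => simp
    | succ k ih =>
      rw [pow_succ', mul_assoc]
      refine (hc x _ (by positivity)).trans ?_
      rw [pow_succ', ENNReal.coe_mul, mul_assoc]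
      gcongr
  refine (measure_mono (Metric.ball_subset_ball' ?_)).trans (h k)
  rw [dist_comm]
  exact hs.trans (mul_le_mul_of_nonneg_right hk.le hr.le)

variable [OpensMeasurableSpace X] [IsLocallyFiniteMeasure m] [m.IsOpenPosMeasure]

/-- Packing: the balls of radius ε/2 about the points of Z are disjoint, lie in one ball of
comparable radius, and each carries at least the fraction 1/D of its mass. -/
theorem VolumeDoubling.exists_card_le (hVD : VolumeDoubling m) (K : ℝ) :
    ∃ N : ℕ, ∀ (Z : Set X) (ε : ℝ), 0 < ε → Separated Z ε → ∀ x : X,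
      (Z ∩ Metric.ball x (K * ε)).encard ≤ N := by
  -- The large ball has radius (|K|+1)ε and its centre lies within |K|ε of z; the sum (2|K|+1)ε is
  -- expressed in units of ε/2.
  obtain ⟨D, -, hD⟩ := hVD.exists_compare (2 * (2 * |K| + 1))
  obtain ⟨N, hN⟩ := exists_nat_ge D
  refine ⟨N, fun Z ε hε hZ x => ?_⟩
  by_contra! hlt
  obtain ⟨T, hT, hTcard⟩ := exists_subset_encard_eq (Order.add_one_le_of_lt hlt)
  have hTfin : T.Finite := finite_of_encard_eq_coe (k := N + 1) (by simpa using hTcard)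
  lift T to Finset X using hTfin
  rw [encard_coe_eq_coe_finsetCard] at hTcard
  have hcard : T.card = N + 1 := by exact_mod_cast hTcard
  have hK : K * ε ≤ |K| * ε := mul_le_mul_of_nonneg_right (le_abs_self K) hε.le
  set B := Metric.ball x ((|K| + 1) * ε) with hB
  have hKε : 0 ≤ |K| * ε := by positivity
  have hBpos : 0 < m B := Metric.measure_ball_pos m x (by positivity)
  have hBfin : m B < ∞ := hVD.measure_ball_lt_top x _
  have h1 : ∑ z ∈ T, m (Metric.ball z (ε / 2)) ≤ m B := by
    rw [← measure_biUnion_finset]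
    · refine measure_mono (iUnion₂_subset fun z hz => Metric.ball_subset_ball' ?_)
      have := (hT hz).2
      rw [Metric.mem_ball] at this
      linarith
    · intro a ha b hb hab
      refine Metric.ball_disjoint_ball ?_
      have := hZ (hT ha).1 (hT hb).1 hab
      linarith
    · exact fun z _ => Metric.isOpen_ball.measurableSet
  have h2 : ∀ z ∈ T, m B ≤ D * m (Metric.ball z (ε / 2)) := fun z hz => by
    refine hD z x (ε / 2) _ (by positivity) ?_
    have := (hT hz).2
    rw [Metric.mem_ball] at this
    linarith
  have h3 : ((N + 1 : ℕ) : ℝ≥0∞) * m B ≤ D * m B := by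
    calc ((N + 1 : ℕ) : ℝ≥0∞) * m B = ∑ z ∈ T, m B := by rw [Finset.sum_const, hcard, nsmul_eq_mul]
      _ ≤ ∑ z ∈ T, D * m (Metric.ball z (ε / 2)) := Finset.sum_le_sum h2
      _ ≤ D * m B := by rw [← Finset.mul_sum]; gcongr
  rw [ENNReal.mul_le_mul_iff_left hBpos.ne' hBfin.ne] at h3
  have h4 : ((N + 1 : ℕ) : ℝ≥0) ≤ D := by exact_mod_cast h3
  have h5 := h4.trans hN
  norm_cast at h5
  omega

/-- By the packing bound, finitely many points of a maximal ε-separated set serve a given ball, so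
closed balls are totally bounded; completeness makes them compact. -/
theorem VolumeDoubling.properSpace [CompleteSpace X] (hVD : VolumeDoubling m) : ProperSpace X := by
  refine ⟨fun x r => isCompact_iff_totallyBounded_isComplete.2 ⟨?_, Metric.isClosed_closedBall.isComplete⟩⟩
  refine Metric.totallyBounded_iff.2 fun ε hε => ?_
  obtain ⟨Z, hZ, hZcov⟩ := exists_maximal_separated X hε
  obtain ⟨N, hN⟩ := hVD.exists_card_le ((r + 2 * ε) / ε)
  have h1 := hN Z ε hε hZ x
  rw [div_mul_cancel₀ _ hε.ne'] at h1
  refine ⟨_, finite_of_encard_le_coe h1, fun y hy => ?_⟩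
  obtain ⟨z, hz, hyz⟩ := hZcov y
  refine mem_iUnion₂.2 ⟨z, ⟨hz, ?_⟩, hyz⟩
  rw [Metric.mem_ball]
  rw [Metric.mem_closedBall] at hy
  have := dist_triangle z y x
  rw [dist_comm z y] at this
  linarith

end Doubling

/-- Bounded overlap: after exchanging sum and integral, each point of U is counted at most N times.
-/
theorem tsum_setLIntegral_le {X : Type*} [MeasurableSpace X] (μ : Measure X) {ι : Type*} [Countable ι]
    (S : ι → Set X) (hS : ∀ i, MeasurableSet (S i)) (U : Set X) (hSU : ∀ i, S i ⊆ U) (N : ℕ)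
    (hN : ∀ x, {i | x ∈ S i}.encard ≤ N) (f : X → ℝ≥0∞) (hf : Measurable f)
    (hU : MeasurableSet U) :
    ∑' i, ∫⁻ x in S i, f x ∂μ ≤ N * ∫⁻ x in U, f x ∂μ := by
  have h1 : ∀ i, ∫⁻ x in S i, f x ∂μ = ∫⁻ x, (S i).indicator f x ∂μ := fun i =>
    (lintegral_indicator (hS i) f).symm
  simp only [h1]
  rw [← lintegral_tsum fun i => (hf.indicator (hS i)).aemeasurable, ← lintegral_indicator hU,
    ← lintegral_const_mul _ (hf.indicator hU)]
  refine lintegral_mono fun x => ?_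
  have h2 : ∀ i, (S i).indicator f x = f x * {i | x ∈ S i}.indicator (fun _ => (1 : ℝ≥0∞)) i := by
    intro i
    by_cases hi : x ∈ S i <;> simp [hi]
  simp only [h2, ENNReal.tsum_mul_left]
  rw [← tsum_subtype, ENNReal.tsum_set_one]
  by_cases hx : x ∈ U
  · rw [indicator_of_mem hx, mul_comm]
    gcongr
    exact_mod_cast ENat.toENNReal_le.2 (hN x)
  · have : {i | x ∈ S i} = ∅ := eq_empty_of_forall_notMem fun i hi => hx (hSU i hi)
    simp [this]

theorem tsum_measure_le {X : Type*} [MeasurableSpace X] (μ : Measure X) {ι : Type*} [Countable ι]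
    (S : ι → Set X) (hS : ∀ i, MeasurableSet (S i)) (U : Set X) (hSU : ∀ i, S i ⊆ U) (N : ℕ)
    (hN : ∀ x, {i | x ∈ S i}.encard ≤ N) (hU : MeasurableSet U) :
    ∑' i, μ (S i) ≤ N * μ U := by
  simpa using tsum_setLIntegral_le μ S hS U hSU N hN (fun _ => 1) measurable_const hU

theorem encard_setOf_mem_ball_le {X : Type*} [MetricSpace X] {Z Z' : Set X} (hZ' : Z' ⊆ Z) {s : ℝ}
    {N : ℕ} {x : X} (hN : (Z ∩ Metric.ball x s).encard ≤ N) :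
    {z : Z' | x ∈ Metric.ball (z : X) s}.encard ≤ N := by
  refine le_trans ?_ hN
  rw [← (Subtype.val_injective).encard_image]
  refine encard_le_encard ?_
  rintro _ ⟨z, hz, rfl⟩
  exact ⟨hZ' z.2, by rwa [Metric.mem_ball, dist_comm]⟩

theorem Separated.countable {X : Type*} [MetricSpace X] [TopologicalSpace.SeparableSpace X]
    {Z : Set X} {ε : ℝ} (hε : 0 < ε) (hZ : Separated Z ε) : Z.Countable := by
  refine Set.PairwiseDisjoint.countable_of_isOpen (s := fun z => Metric.ball z (ε / 2)) ?_
    (fun _ _ => Metric.isOpen_ball) (fun z _ => ⟨z, Metric.mem_ball_self (by positivity)⟩)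
  intro a ha b hb hab
  refine Metric.ball_disjoint_ball ?_
  have := hZ ha hb hab
  linarith

/-! ### Exhaustions and the local energy measure -/

theorem exists_relCompact_exhaustion {X : Type*} [MetricSpace X] [ProperSpace X] [Nonempty X] {Ω : Set X} (hΩ : IsOpen Ω) :
    ∃ A : ℕ → Set X, Monotone A ∧ (∀ n, IsRelCompactOpen (A n) Ω) ∧ ⋃ n, A n = Ω := by
  obtain ⟨o⟩ := ‹Nonempty X›
  have hsub : ∀ n : ℕ, {x | ((n : ℝ≥0∞) + 1)⁻¹ ≤ Metric.infEDist x Ωᶜ} ⊆ Ω := fun n x hx => by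
    by_contra h
    have h1 : Metric.infEDist x Ωᶜ = 0 := Metric.infEDist_zero_of_mem h
    have h2 : ((n : ℝ≥0∞) + 1)⁻¹ ≤ Metric.infEDist x Ωᶜ := hx
    rw [h1, nonpos_iff_eq_zero, ENNReal.inv_eq_zero] at h2
    simp at h2
  -- The extended distance is infinite when Ω is the whole space, so that case needs no separate
  -- treatment; bounded balls supply compactness.
  refine ⟨fun n => {x | ((n : ℝ≥0∞) + 1)⁻¹ < Metric.infEDist x Ωᶜ} ∩ Metric.ball o n, ?_, fun n => ?_, ?_⟩
  · intro i j hij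
    refine inter_subset_inter (fun x hx => ?_) (Metric.ball_subset_ball (by exact_mod_cast hij))
    refine lt_of_le_of_lt (ENNReal.inv_le_inv.2 ?_) (show _ < _ from hx)
    gcongr
  · refine ⟨(isOpen_lt continuous_const Metric.continuous_infEDist).inter Metric.isOpen_ball, ?_, ?_⟩
    · exact (isCompact_closedBall o n).of_isClosed_subset isClosed_closure
        (closure_minimal (inter_subset_right.trans Metric.ball_subset_closedBall) Metric.isClosed_closedBall)
    · refine (closure_minimal ?_ (isClosed_le continuous_const Metric.continuous_infEDist)).trans (hsub n)
      exact fun x hx => le_of_lt (mem_ofPred.1 hx.1)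
  · refine subset_antisymm (iUnion_subset fun n x hx => hsub n (le_of_lt (mem_ofPred.1 hx.1))) fun x hx => ?_
    have h1 : 0 < Metric.infEDist x Ωᶜ := by
      rw [pos_iff_ne_zero, Ne, ← Metric.mem_iff_infEDist_zero_of_closed hΩ.isClosed_compl]
      exact fun h => h hx
    obtain ⟨n₁, hn₁⟩ := ENNReal.exists_inv_nat_lt h1.ne'
    obtain ⟨n₂, hn₂⟩ := exists_nat_gt (dist x o)
    refine mem_iUnion.2 ⟨max n₁ n₂, ?_, ?_⟩
    · refine lt_of_le_of_lt (ENNReal.inv_le_inv.2 ?_) hn₁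
      refine le_trans ?_ le_self_add
      exact_mod_cast le_max_left _ _
    · rw [Metric.mem_ball]
      exact hn₂.trans_le (by exact_mod_cast le_max_right _ _)

namespace PEnergyStructure

variable {X : Type*} [MetricSpace X] [MeasurableSpace X] {m : Measure X} {p : ℝ} [hp : Fact (1 < p)]
variable {𝓔 : PEnergyStructure m p}

/-- By strong locality every local representative on A has the same energy measure on A as F, so the
supremum over A is the mass of Ω by monotone exhaustion. -/
theorem localΓ_eq [ProperSpace X] [TopologicalSpace.SeparableSpace X] [BorelSpace X] [Nonempty X]
    {Ω : Set X} (hΩ : IsOpen Ω) {u : X → ℝ} {F : 𝓔.Dom} (hF : u =ᵐ[m.restrict Ω] F.toLp) :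
    𝓔.localΓ Ω u Ω = 𝓔.Γ F Ω := by
  refine le_antisymm ?_ ?_
  · refine iSup_le fun A => iSup_le fun hA => iSup_le fun v => iSup_le fun hv => ?_
    have hAΩ : A ⊆ Ω := subset_closure.trans hA.2.2
    have h1 : ∀ᵐ y ∂m, y ∈ A → v.toLp y - F.toLp y = 0 := by
      filter_upwards [(ae_restrict_iff' hA.1.measurableSet).1 hv,
        (ae_restrict_iff' hΩ.measurableSet).1 hF] with y h1 h2 hy
      rw [← h1 hy, ← h2 (hAΩ hy), sub_self]
    rw [Γ_eq_of_sub_eq_const v F hA.1 0 h1 inter_subset_right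
      (hΩ.inter hA.1).measurableSet]
    exact measure_mono inter_subset_left
  · obtain ⟨A, hmono, hA, hAU⟩ := exists_relCompact_exhaustion hΩ
    have h1 : 𝓔.Γ F Ω = ⨆ n, 𝓔.Γ F (A n) := by
      rw [← hmono.measure_iUnion, hAU]
    rw [h1]
    refine iSup_le fun n => ?_
    have hAΩ : A n ⊆ Ω := subset_closure.trans (hA n).2.2
    have h2 : u =ᵐ[m.restrict (A n)] F.toLp := ae_restrict_of_ae_restrict_of_subset hAΩ hF
    refine le_trans ?_ (le_iSup_of_le (A n) (le_iSup_of_le (hA n) (le_iSup_of_le F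
      (le_iSup_of_le h2 le_rfl))))
    rw [inter_eq_right.2 hAΩ]

end PEnergyStructure

/-! ### Scale functions -/

namespace IsScaleFunction

variable {Ψ : ℝ → ℝ}

theorem pos (hΨ : IsScaleFunction Ψ) {r : ℝ} (hr : 0 < r) : 0 < Ψ r := hΨ.bijOn.mapsTo hr

theorem ofReal_pos (hΨ : IsScaleFunction Ψ) {r : ℝ} (hr : 0 < r) : ENNReal.ofReal (Ψ r) ≠ 0 := by
  simpa using hΨ.pos hr

theorem ofReal_mono (hΨ : IsScaleFunction Ψ) {r R : ℝ} (hr : 0 < r) (h : r ≤ R) :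
    ENNReal.ofReal (Ψ r) ≤ ENNReal.ofReal (Ψ R) :=
  ENNReal.ofReal_le_ofReal (hΨ.strictMonoOn.monotoneOn hr (hr.trans_le h) h)

theorem exists_doubling (hΨ : IsScaleFunction Ψ) (K : ℝ) :
    ∃ D : ℝ≥0, 1 ≤ D ∧ ∀ r s : ℝ, 0 < r → 0 < s → s ≤ K * r →
      ENNReal.ofReal (Ψ s) ≤ D * ENNReal.ofReal (Ψ r) := by
  obtain ⟨C, β₁, β₂, hC, -, hβ₂, h⟩ := hΨ.scaling
  have hK : 1 ≤ max K 1 := le_max_right _ _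
  have h1 : 1 ≤ C * max K 1 ^ β₂ := by
    have := Real.one_le_rpow hK hβ₂.le
    nlinarith
  refine ⟨(C * max K 1 ^ β₂).toNNReal, Real.one_le_toNNReal.2 h1, fun r s hr hs hsK => ?_⟩
  have h2 : s ≤ max K 1 * r := hsK.trans (by gcongr; exact le_max_left _ _)
  refine (hΨ.ofReal_mono hs h2).trans ?_
  rw [← ENNReal.ofReal_coe_nnreal, ← ENNReal.ofReal_mul (by positivity),
    Real.coe_toNNReal _ (by positivity)]
  refine ENNReal.ofReal_le_ofReal ?_
  have h3 := (h r (max K 1 * r) hr (le_mul_of_one_le_left hr.le hK)).2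
  rwa [mul_div_cancel_right₀ _ hr.ne', div_le_iff₀ (hΨ.pos hr)] at h3

theorem tendsto_zero (hΨ : IsScaleFunction Ψ) :
    Tendsto (fun r => ENNReal.ofReal (Ψ r)) (𝓝[>] 0) (𝓝 0) := by
  rw [ENNReal.tendsto_nhds_zero]
  intro η hη
  rcases eq_or_ne η ∞ with rfl | hη'
  · exact Eventually.of_forall fun _ => le_top
  obtain ⟨r₀, hr₀, hr₀η⟩ := hΨ.bijOn.surjOn (show η.toReal ∈ Ioi 0 from ENNReal.toReal_pos hη.ne' hη')
  filter_upwards [Ioc_mem_nhdsGT (show (0 : ℝ) < r₀ from hr₀)] with r hr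
  refine (hΨ.ofReal_mono hr.1 hr.2).trans ?_
  rw [hr₀η, ENNReal.ofReal_toReal hη']

end IsScaleFunction

/-! ### Powers of increments -/

/-- The `p`-th power `|a - b| ^ p` as an extended nonnegative real. -/
noncomputable def gap (p a b : ℝ) : ℝ≥0∞ := ENNReal.ofReal (|a - b| ^ p)

section Gap

variable {p : ℝ}

theorem gap_comm (a b : ℝ) : gap p a b = gap p b a := by rw [gap, gap, abs_sub_comm]

theorem gap_self (hp : 0 < p) (a : ℝ) : gap p a a = 0 := by
  rw [gap, sub_self, abs_zero, Real.zero_rpow hp.ne', ENNReal.ofReal_zero]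

theorem gap_mono (hp : 0 < p) {a b c d : ℝ} (h : |a - b| ≤ |c - d|) : gap p a b ≤ gap p c d :=
  ENNReal.ofReal_le_ofReal (Real.rpow_le_rpow (abs_nonneg _) h hp.le)

theorem gap_le_of_abs_le (hp : 0 < p) {a b s t : ℝ} (hs : 0 ≤ s) (ht : 0 ≤ t) (h : |a - b| ≤ s + t) :
    gap p a b ≤ ((2 : ℝ≥0) ^ p : ℝ≥0) * (ENNReal.ofReal (s ^ p) + ENNReal.ofReal (t ^ p)) := by
  have h1 : |a - b| ^ p ≤ 2 ^ p * (s ^ p + t ^ p) := by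
    have h2 : |a - b| ≤ 2 * max s t :=
      h.trans (by linarith [le_max_left s t, le_max_right s t])
    have hs' : 0 ≤ s ^ p := Real.rpow_nonneg hs _
    have ht' : 0 ≤ t ^ p := Real.rpow_nonneg ht _
    calc |a - b| ^ p ≤ (2 * max s t) ^ p := Real.rpow_le_rpow (abs_nonneg _) h2 hp.le
      _ = 2 ^ p * max s t ^ p := Real.mul_rpow (by norm_num) (le_max_of_le_left hs)
      _ ≤ 2 ^ p * (s ^ p + t ^ p) := by
        gcongr
        rcases max_choice s t with h | h <;> rw [h] <;> linarith
  rw [gap, ← ENNReal.ofReal_add (Real.rpow_nonneg hs _) (Real.rpow_nonneg ht _),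
    ← ENNReal.ofReal_coe_nnreal, ← ENNReal.ofReal_mul (by positivity)]
  exact ENNReal.ofReal_le_ofReal (by simpa using h1)

theorem gap_triangle (hp : 0 < p) (a b c : ℝ) :
    gap p a b ≤ ((2 : ℝ≥0) ^ p : ℝ≥0) * (gap p a c + gap p c b) :=
  gap_le_of_abs_le hp (abs_nonneg _) (abs_nonneg _) (abs_sub_le a c b)

theorem measurable_gap : Measurable fun z : ℝ × ℝ => gap p z.1 z.2 :=
  (((measurable_fst.sub measurable_snd).abs).pow_const p).ennreal_ofReal

theorem Measurable.gap_const {X : Type*} [MeasurableSpace X] {u : X → ℝ} (hu : Measurable u) (a : ℝ) :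
    Measurable fun x => gap p (u x) a := measurable_gap.comp (hu.prodMk measurable_const)

/-- The double integral of `|u(x) - u(y)| ^ p` over `B × B` is controlled by the deviation from
any constant. -/
theorem lintegral_lintegral_gap_le {X : Type*} [MeasurableSpace X] {m : Measure X} (hp : 0 < p)
    {u : X → ℝ} (hu : Measurable u) (a : ℝ) (B : Set X) :
    ∫⁻ y in B, ∫⁻ x in B, gap p (u x) (u y) ∂m ∂m
      ≤ 2 * ((2 : ℝ≥0) ^ p : ℝ≥0) * (m B * ∫⁻ x in B, gap p (u x) a ∂m) := by
  have hm := hu.gap_const (p := p) a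
  calc ∫⁻ y in B, ∫⁻ x in B, gap p (u x) (u y) ∂m ∂m
      ≤ ∫⁻ y in B, ∫⁻ x in B, ((2 : ℝ≥0) ^ p : ℝ≥0) * (gap p (u x) a + gap p (u y) a) ∂m ∂m := by
        gcongr with y x
        exact (gap_triangle hp _ _ a).trans (by rw [gap_comm a])
    _ = ∫⁻ y in B, ((2 : ℝ≥0) ^ p : ℝ≥0) *
          ((∫⁻ x in B, gap p (u x) a ∂m) + gap p (u y) a * m B) ∂m := by
        refine lintegral_congr fun y => ?_
        rw [lintegral_const_mul' _ _ ENNReal.coe_ne_top, lintegral_add_left hm, setLIntegral_const]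
    _ = _ := by
        rw [lintegral_const_mul' _ _ ENNReal.coe_ne_top,
          lintegral_add_left measurable_const, setLIntegral_const, lintegral_mul_const _ hm]
        ring

end Gap

theorem ENNReal.inv_le_mul_inv {a b : ℝ≥0∞} {D : ℝ≥0} (hD : 1 ≤ D) (h : b ≤ D * a) :
    a⁻¹ ≤ D * b⁻¹ := by
  have hD0 : (D : ℝ≥0∞) ≠ 0 := by
    have : (0 : ℝ≥0) < D := zero_lt_one.trans_le hD
    exact_mod_cast this.ne'
  rcases eq_or_ne b 0 with rfl | hb
  · simp [ENNReal.mul_top hD0]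
  rw [← div_eq_mul_inv, ENNReal.le_div_iff_mul_le (Or.inl hb) (Or.inr ENNReal.coe_ne_top)]
  calc a⁻¹ * b ≤ a⁻¹ * (D * a) := by gcongr
    _ = D * (a⁻¹ * a) := by ring
    _ ≤ D * 1 := by gcongr; exact ENNReal.inv_mul_le_one a
    _ = D := mul_one _

/-! ### Korevaar–Schoen energies and the Poincaré upper bound -/

section KorevaarSchoen

variable {X : Type*} [MetricSpace X] [MeasurableSpace X]

/-- The (unnormalised) Korevaar–Schoen energy
`∫_Ω m(B(y,r))⁻¹ ∫_{Ω ∩ B(y,r)} |u(x) - u(y)|^p m(dx) m(dy)`. -/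
noncomputable def ksEnergy (m : Measure X) (p r : ℝ) (Ω : Set X) (u : X → ℝ) : ℝ≥0∞ :=
  ∫⁻ y in Ω, (∫⁻ x in Ω ∩ Metric.ball y r, gap p (u x) (u y) ∂m) / m (Metric.ball y r) ∂m

variable {m : Measure X} {p : ℝ}

theorem ksEnergy_mono {Ω Ω' : Set X} (h : Ω ⊆ Ω') (r : ℝ) (u : X → ℝ) :
    ksEnergy m p r Ω u ≤ ksEnergy m p r Ω' u := by
  refine (lintegral_mono fun y => ?_).trans (lintegral_mono_set h)
  gcongr

theorem ksEnergy_le_of_abs_le (hp : 0 < p) {Ω : Set X} (hΩ : MeasurableSet Ω) {r : ℝ} {u v : X → ℝ}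
    (huv : ∀ᵐ y ∂m, y ∈ Ω → ∀ᵐ x ∂m, x ∈ Ω → |u x - u y| ≤ |v x - v y|) :
    ksEnergy m p r Ω u ≤ ksEnergy m p r Ω v := by
  refine lintegral_mono_ae ((ae_restrict_iff' hΩ).2 ?_)
  filter_upwards [huv] with y hy hyΩ
  gcongr ?_ / _
  refine (lintegral_mono_ae (ae_restrict_of_ae_restrict_of_subset inter_subset_left
    ((ae_restrict_iff' hΩ).2 ?_)))
  filter_upwards [hy hyΩ] with x hx hxΩ
  exact gap_mono hp (hx hxΩ)

theorem ksEnergy_congr (hp : 0 < p) {Ω : Set X} (hΩ : MeasurableSet Ω) {r : ℝ} {u v : X → ℝ}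
    (huv : ∀ᵐ y ∂m, y ∈ Ω → u y = v y) : ksEnergy m p r Ω u = ksEnergy m p r Ω v := by
  refine le_antisymm (ksEnergy_le_of_abs_le hp hΩ ?_) (ksEnergy_le_of_abs_le hp hΩ ?_) <;>
  · filter_upwards [huv] with y hy hyΩ
    filter_upwards [huv] with x hx hxΩ
    rw [hy hyΩ, hx hxΩ]

variable [SecondCountableTopology X] [BorelSpace X] [IsLocallyFiniteMeasure m]

theorem measurable_measure_ball (r : ℝ) : Measurable fun y : X => m (Metric.ball y r) := by
  have h : MeasurableSet {z : X × X | dist z.2 z.1 < r} :=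
    (isOpen_lt (continuous_snd.dist continuous_fst) continuous_const).measurableSet
  exact measurable_measure_prodMk_left h

theorem measurable_lintegral_gap {u : X → ℝ} (hu : Measurable u) {Ω : Set X} (r : ℝ) :
    Measurable fun y => ∫⁻ x in Ω ∩ Metric.ball y r, gap p (u x) (u y) ∂m := by
  have h : MeasurableSet {z : X × X | dist z.2 z.1 < r} :=
    (isOpen_lt (continuous_snd.dist continuous_fst) continuous_const).measurableSet
  have h1 : Measurable fun z : X × X => gap p (u z.2) (u z.1) :=
    measurable_gap.comp ((hu.comp measurable_snd).prodMk (hu.comp measurable_fst))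
  have h2 := (h1.indicator h).lintegral_prod_right' (ν := m.restrict Ω)
  convert h2 using 2 with y
  rw [inter_comm, ← Measure.restrict_restrict Metric.isOpen_ball.measurableSet,
    ← lintegral_indicator Metric.isOpen_ball.measurableSet]
  rfl

end KorevaarSchoen

namespace PEnergyStructure

variable {X : Type*} [MetricSpace X] [MeasurableSpace X] {m : Measure X} {p : ℝ} [hp : Fact (1 < p)]
variable {𝓔 : PEnergyStructure m p}

theorem measurable_toLp (u : 𝓔.Dom) : Measurable u.toLp :=
  (Lp.stronglyMeasurable u.toLp).measurable

variable [SecondCountableTopology X] [BorelSpace X] [IsLocallyFiniteMeasure m]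
  [m.IsOpenPosMeasure]

/-- For y in a net ball B(z,r) the ball B(y,r) lies in B(z,2r), so the density is dominated by a
double integral over B(z,2r), which the Poincaré inequality bounds by the energy of B(z,2Ar). These
dilated balls overlap boundedly. -/
theorem exists_ksEnergy_le {Ψ : ℝ → ℝ} (hΨ : IsScaleFunction Ψ) (hVD : VolumeDoubling m)
    (hPI : 𝓔.Poincare Ψ) : ∃ (C : ℝ≥0) (κ : ℝ), 1 ≤ C ∧ 0 < κ ∧ ∀ (r : ℝ) (Ω : Set X) (u : 𝓔.Dom),
      0 < r → ksEnergy m p r Ω u.toLp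
        ≤ C * ENNReal.ofReal (Ψ r) * 𝓔.Γ u (Metric.thickening (κ * r) Ω) := by
  have hp0 : 0 < p := exponent_pos
  obtain ⟨CP, A, hCP, hA, hP⟩ := hPI
  obtain ⟨D, hD1, hD⟩ := hVD.exists_compare 3
  obtain ⟨N, hN⟩ := hVD.exists_card_le (A * 2)
  obtain ⟨DΨ, -, hDΨ⟩ := hΨ.exists_doubling 2
  set T : ℝ≥0 := (2 : ℝ≥0) ^ p with hT
  -- κ = 2A + 1: a dilated ball reaches 2Ar from its centre, and the centre is within r of Ω.
  refine ⟨max 1 (D * (2 * T) * (CP.toNNReal * DΨ) * N), A * 2 + 1, le_max_left _ _, by positivity,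
    fun r Ω u hr => ?_⟩
  obtain ⟨Z, hZ, hZcov⟩ := exists_maximal_separated X hr
  -- Only net balls that meet Ω are kept, which confines the energy to a neighbourhood of Ω.
  set Z' : Set X := {z ∈ Z | (Metric.ball z r ∩ Ω).Nonempty}
  have hZ'Z : Z' ⊆ Z := fun z hz => hz.1
  have : Countable Z' := ((hZ.countable hr).mono hZ'Z).to_subtype
  have hu := measurable_toLp u
  have hcov : Ω ⊆ ⋃ z : Z', Metric.ball (z : X) r := fun y hy => by
    obtain ⟨z, hz, hyz⟩ := hZcov y
    exact mem_iUnion.2 ⟨⟨z, hz, y, hyz, hy⟩, hyz⟩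
  have hstep : ∀ z : Z', ∫⁻ y in Metric.ball (z : X) r,
      (∫⁻ x in Ω ∩ Metric.ball y r, gap p (u.toLp x) (u.toLp y) ∂m) / m (Metric.ball y r) ∂m
      ≤ D * (2 * T) * (CP.toNNReal * DΨ * ENNReal.ofReal (Ψ r)) *
        𝓔.Γ u (Metric.ball (z : X) (A * 2 * r)) := by
    intro z
    set B := Metric.ball (z : X) (2 * r) with hB
    have hB0 : m B ≠ 0 := (Metric.measure_ball_pos m (z : X) (by positivity)).ne'
    have hBt : m B ≠ ∞ := (hVD.measure_ball_lt_top _ _).ne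
    set a := ⨍ z in B, u.toLp z ∂m with ha
    have h1 : ∀ y ∈ Metric.ball (z : X) r,
        (∫⁻ x in Ω ∩ Metric.ball y r, gap p (u.toLp x) (u.toLp y) ∂m) / m (Metric.ball y r)
        ≤ D * (m B)⁻¹ * ∫⁻ x in B, gap p (u.toLp x) (u.toLp y) ∂m := by
      intro y hy
      rw [Metric.mem_ball] at hy
      rw [div_eq_mul_inv, mul_comm]
      refine mul_le_mul' ?_ (lintegral_mono_set ?_)
      · exact ENNReal.inv_le_mul_inv hD1 (hD y z r (2 * r) hr (by linarith))
      · exact inter_subset_right.trans (Metric.ball_subset_ball' (by linarith))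
    calc _ ≤ ∫⁻ y in Metric.ball (z : X) r, D * (m B)⁻¹ * ∫⁻ x in B, gap p (u.toLp x) (u.toLp y) ∂m ∂m :=
          setLIntegral_mono' Metric.isOpen_ball.measurableSet h1
      _ ≤ ∫⁻ y in B, D * (m B)⁻¹ * ∫⁻ x in B, gap p (u.toLp x) (u.toLp y) ∂m ∂m :=
          lintegral_mono_set (Metric.ball_subset_ball (by linarith))
      _ = D * (m B)⁻¹ * ∫⁻ y in B, ∫⁻ x in B, gap p (u.toLp x) (u.toLp y) ∂m ∂m :=
          lintegral_const_mul' _ _ (ENNReal.mul_ne_top ENNReal.coe_ne_top (ENNReal.inv_ne_top.2 hB0))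
      _ ≤ D * (m B)⁻¹ * (2 * T * (m B * ∫⁻ x in B, gap p (u.toLp x) a ∂m)) := by
          gcongr; exact lintegral_lintegral_gap_le hp0 hu a B
      _ = D * (2 * T) * ((m B)⁻¹ * m B) * ∫⁻ x in B, gap p (u.toLp x) a ∂m := by ring
      _ = D * (2 * T) * ∫⁻ x in B, gap p (u.toLp x) a ∂m := by
          rw [ENNReal.inv_mul_cancel hB0 hBt, mul_one]
      _ ≤ D * (2 * T) * (ENNReal.ofReal (CP * Ψ (2 * r)) * 𝓔.Γ u (Metric.ball z (A * (2 * r)))) := by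
          gcongr; exact hP z (2 * r) (by positivity) u
      _ ≤ D * (2 * T) * ((CP.toNNReal * (DΨ * ENNReal.ofReal (Ψ r))) *
            𝓔.Γ u (Metric.ball z (A * (2 * r)))) := by
          gcongr
          rw [ENNReal.ofReal_mul hCP.le]
          exact mul_le_mul' le_rfl (hDΨ r (2 * r) hr (by positivity) le_rfl)
      _ = _ := by rw [mul_assoc A 2 r]; ring
  calc ksEnergy m p r Ω u.toLp
      ≤ ∑' z : Z', ∫⁻ y in Metric.ball (z : X) r,
      (∫⁻ x in Ω ∩ Metric.ball y r, gap p (u.toLp x) (u.toLp y) ∂m) / m (Metric.ball y r) ∂m :=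
        (lintegral_mono_set hcov).trans (lintegral_iUnion_le _ _)
    _ ≤ ∑' z : Z', D * (2 * T) * (CP.toNNReal * DΨ * ENNReal.ofReal (Ψ r)) *
        𝓔.Γ u (Metric.ball (z : X) (A * 2 * r)) := ENNReal.tsum_le_tsum hstep
    _ ≤ D * (2 * T) * (CP.toNNReal * DΨ * ENNReal.ofReal (Ψ r)) *
        (N * 𝓔.Γ u (Metric.thickening ((A * 2 + 1) * r) Ω)) := by
        rw [ENNReal.tsum_mul_left]
        gcongr
        refine tsum_measure_le (𝓔.Γ u) _ (fun _ => Metric.isOpen_ball.measurableSet) _ (fun z w hw => ?_)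
          N (fun x => encard_setOf_mem_ball_le hZ'Z (hN Z r hr hZ x)) Metric.isOpen_thickening.measurableSet
        obtain ⟨y, hyz, hyΩ⟩ := z.2.2
        refine Metric.mem_thickening_iff.2 ⟨y, hyΩ, ?_⟩
        rw [Metric.mem_ball] at hw hyz
        have := dist_triangle_right w y z
        linarith
    _ = (D * (2 * T) * (CP.toNNReal * DΨ) * N : ℝ≥0) * ENNReal.ofReal (Ψ r) *
        𝓔.Γ u (Metric.thickening ((A * 2 + 1) * r) Ω) := by
        push_cast; ring
    _ ≤ _ := by
        gcongr
        exact le_max_right _ _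

/-- On the j-th annulus d(x,y) is comparable to r_j = 2^{-j}R, so Ψ(d(x,y)) may be replaced by
Ψ(r_j). The j-th term becomes b_j/Ψ(r_j) times a Korevaar–Schoen energy of size O(Ψ(r_j)). Only
scales at most δ carry weight, so all neighbourhoods lie in the κδ-neighbourhood. -/
theorem exists_dyadicKernel_le {Ψ : ℝ → ℝ} (hΨ : IsScaleFunction Ψ) (hVD : VolumeDoubling m)
    (hPI : 𝓔.Poincare Ψ) : ∃ (C : ℝ≥0) (κ : ℝ), 1 ≤ C ∧ 0 < κ ∧
      ∀ (R δ : ℝ) (b : ℕ → ℝ≥0) (Ω : Set X) (u : 𝓔.Dom), 0 < R →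
      (∀ j, b j ≠ 0 → (1 / 2) ^ j * R ≤ δ) →
      nonlocalEnergy m p Ψ (dyadicKernel m b R) Ω u.toLp
        ≤ C * (∑' j, (b j : ℝ≥0∞)) * 𝓔.Γ u (Metric.thickening (κ * δ) Ω) := by
  have hp0 : 0 < p := exponent_pos
  obtain ⟨C, κ, hC1, hκ, hC⟩ := exists_ksEnergy_le hΨ hVD hPI
  obtain ⟨D, hD1, hD⟩ := hΨ.exists_doubling 2
  refine ⟨D * C, κ, one_le_mul_of_one_le_of_one_le hD1 hC1, hκ, fun R δ b Ω u hR hb => ?_⟩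
  have hu := measurable_toLp u
  set r : ℕ → ℝ := fun j => (1 / 2) ^ j * R with hr
  have hr0 : ∀ j, 0 < r j := fun j => by positivity
  have hpt : ∀ y x : X, ENNReal.ofReal (|u.toLp x - u.toLp y| ^ p) / ENNReal.ofReal (Ψ (dist x y)) *
      dyadicKernel m b R x y ≤ ∑' j, D * b j * (ENNReal.ofReal (Ψ (r j)))⁻¹ * (m (Metric.ball y (r j)))⁻¹ *
        (Metric.ball y (r j)).indicator (fun x => gap p (u.toLp x) (u.toLp y)) x := by
    intro y x
    rw [dyadicKernel, ← ENNReal.tsum_mul_left]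
    refine ENNReal.tsum_le_tsum fun j => ?_
    by_cases hx : x ∈ Metric.ball y ((1 / 2) ^ j * R) \ Metric.ball y ((1 / 2) ^ (j + 1) * R)
    · rw [indicator_of_mem hx, indicator_of_mem (show x ∈ Metric.ball y (r j) from hx.1)]
      have h1 : r (j + 1) ≤ dist x y := not_lt.1 hx.2
      have h2 : (ENNReal.ofReal (Ψ (dist x y)))⁻¹ ≤ D * (ENNReal.ofReal (Ψ (r j)))⁻¹ := by
        refine ENNReal.inv_le_mul_inv hD1 (hD _ _ ((hr0 _).trans_le h1) (hr0 j) ?_)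
        refine le_trans (le_of_eq ?_) (mul_le_mul_of_nonneg_left h1 zero_le_two)
        simp only [hr]; ring
      calc _ = (ENNReal.ofReal (Ψ (dist x y)))⁻¹ * (gap p (u.toLp x) (u.toLp y) * b j *
              (m (Metric.ball y (r j)))⁻¹) := by
            simp only [gap, div_eq_mul_inv, one_mul, hr]; ring
        _ ≤ D * (ENNReal.ofReal (Ψ (r j)))⁻¹ * (gap p (u.toLp x) (u.toLp y) * b j *
              (m (Metric.ball y (r j)))⁻¹) := by gcongr
        _ = _ := by ring
    · rw [indicator_of_notMem hx]; simp
  have hball : ∀ y s, MeasurableSet (Metric.ball (y : X) s) := fun y s =>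
    Metric.isOpen_ball.measurableSet
  have hinner : ∀ y, ∫⁻ x in Ω, ∑' j, D * b j * (ENNReal.ofReal (Ψ (r j)))⁻¹ *
      (m (Metric.ball y (r j)))⁻¹ *
      (Metric.ball y (r j)).indicator (fun x => gap p (u.toLp x) (u.toLp y)) x ∂m
      = ∑' j, D * b j * (ENNReal.ofReal (Ψ (r j)))⁻¹ *
        ((∫⁻ x in Ω ∩ Metric.ball y (r j), gap p (u.toLp x) (u.toLp y) ∂m) / m (Metric.ball y (r j))) := by
    intro y
    have hmeas : ∀ j, Measurable ((Metric.ball y (r j)).indicator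
        (fun x => gap p (u.toLp x) (u.toLp y))) := fun j =>
      (hu.gap_const _).indicator (hball _ _)
    rw [lintegral_tsum fun j => ((hmeas j).const_mul _).aemeasurable]
    refine tsum_congr fun j => ?_
    rw [lintegral_const_mul _ (hmeas j), lintegral_indicator (hball _ _),
      Measure.restrict_restrict (hball _ _), inter_comm, div_eq_mul_inv]
    ring
  calc nonlocalEnergy m p Ψ (dyadicKernel m b R) Ω u.toLp
      ≤ ∫⁻ y in Ω, ∑' j, D * b j * (ENNReal.ofReal (Ψ (r j)))⁻¹ *
        ((∫⁻ x in Ω ∩ Metric.ball y (r j), gap p (u.toLp x) (u.toLp y) ∂m) /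
          m (Metric.ball y (r j))) ∂m := by
        refine lintegral_mono fun y => ?_
        simp only
        rw [← hinner]
        exact lintegral_mono fun x => hpt y x
    _ = ∑' j, D * b j * (ENNReal.ofReal (Ψ (r j)))⁻¹ * ksEnergy m p (r j) Ω u.toLp := by
        have hmeas : ∀ j, Measurable fun y => (∫⁻ x in Ω ∩ Metric.ball y (r j),
            gap p (u.toLp x) (u.toLp y) ∂m) / m (Metric.ball y (r j)) := fun j =>
          (measurable_lintegral_gap hu _).div (measurable_measure_ball _)
        rw [lintegral_tsum fun j => ((hmeas j).const_mul _).aemeasurable]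
        exact tsum_congr fun j => lintegral_const_mul _ (hmeas j)
    _ ≤ ∑' j, D * b j * (C * 𝓔.Γ u (Metric.thickening (κ * δ) Ω)) := by
        refine ENNReal.tsum_le_tsum fun j => ?_
        rcases eq_or_ne (b j) 0 with hj | hj
        · simp [hj]
        have h0 := hΨ.ofReal_pos (hr0 j)
        calc _ ≤ D * b j * (ENNReal.ofReal (Ψ (r j)))⁻¹ * (C * ENNReal.ofReal (Ψ (r j)) *
              𝓔.Γ u (Metric.thickening (κ * r j) Ω)) := by gcongr; exact hC _ _ _ (hr0 j)
          _ = D * b j * ((ENNReal.ofReal (Ψ (r j)))⁻¹ * ENNReal.ofReal (Ψ (r j))) *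
              (C * 𝓔.Γ u (Metric.thickening (κ * r j) Ω)) := by ring
          _ ≤ _ := by
              rw [ENNReal.inv_mul_cancel h0 ENNReal.ofReal_ne_top, mul_one]
              gcongr
              exact hb j hj
    _ = _ := by
        simp only [mul_assoc]
        rw [ENNReal.tsum_mul_left, ENNReal.tsum_mul_right]
        push_cast; ring

end PEnergyStructure

/-! ### Typical values, capacity cutoffs and partitions of unity -/

/-- Some point of B does no worse than the average. Using a value of G instead of its mean requires
no integrability and gives 0 wherever G vanishes on B. -/
theorem exists_deviation_le {X : Type*} [MetricSpace X] [MeasurableSpace X] {m : Measure X} [SFinite m]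
    {p : ℝ} {G : X → ℝ} (hG : Measurable G) {B : Set X} (hB0 : m B ≠ 0) (hB : m B ≠ ∞) :
    ∃ y ∈ B, ∫⁻ x in B, gap p (G x) (G y) ∂m
      ≤ (∫⁻ y in B, ∫⁻ x in B, gap p (G x) (G y) ∂m ∂m) / m B := by
  have h1 : Measurable fun z : X × X => gap p (G z.2) (G z.1) :=
    measurable_gap.comp ((hG.comp measurable_snd).prodMk (hG.comp measurable_fst))
  have h2 := h1.lintegral_prod_right' (ν := m.restrict B)
  obtain ⟨y, hy, h⟩ := exists_le_setLAverage hB0 hB h2.aemeasurable.restrict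
  refine ⟨y, hy, ?_⟩
  rwa [setLAverage_eq] at h

/-- `1 / max 1 s - 1`. -/
noncomputable def invMaxOne (s : ℝ) : ℝ := (max 1 s)⁻¹ - 1

theorem invMaxOne_zero : invMaxOne 0 = 0 := by simp [invMaxOne]

theorem invMaxOne_mem (s : ℝ) : -1 ≤ invMaxOne s ∧ invMaxOne s ≤ 0 := by
  have h1 : (1 : ℝ) ≤ max 1 s := le_max_left _ _
  have h2 : 0 < (max 1 s)⁻¹ := by positivity
  have h3 : (max 1 s)⁻¹ ≤ 1 := inv_le_one_of_one_le₀ h1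
  constructor <;> simp only [invMaxOne] <;> linarith

theorem lipschitzWith_invMaxOne : LipschitzWith 1 invMaxOne := by
  refine LipschitzWith.of_dist_le_mul fun s t => ?_
  have h1 : |max 1 s - max 1 t| ≤ |s - t| := by
    simpa [Real.dist_eq] using ((LipschitzWith.id (α := ℝ)).const_max 1).dist_le_mul s t
  have hs : (1 : ℝ) ≤ max 1 s := le_max_left _ _
  have ht : (1 : ℝ) ≤ max 1 t := le_max_left _ _
  rw [Real.dist_eq, Real.dist_eq, NNReal.coe_one, one_mul]
  simp only [invMaxOne]
  rw [sub_sub_sub_cancel_right, inv_sub_inv (by positivity) (by positivity), abs_div, abs_sub_comm]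
  refine (div_le_self (abs_nonneg _) ?_).trans h1
  rw [abs_of_pos (by positivity)]
  nlinarith

namespace PEnergyStructure

variable {X : Type*} [MetricSpace X] [MeasurableSpace X] {m : Measure X} {p : ℝ} [hp : Fact (1 < p)]
variable {𝓔 : PEnergyStructure m p}

/-- A near-minimiser of the capacity problem is clipped to [0, 1] and corrected on a null set, so
that its constraints hold at every point. -/
theorem exists_capacity_cutoff [Nontrivial X] [m.IsOpenPosMeasure] [IsLocallyFiniteMeasure m]
    {Ψ : ℝ → ℝ} (hΨ : IsScaleFunction Ψ) (hVD : VolumeDoubling m) (hcap : 𝓔.CapacityUpper Ψ) :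
    ∃ C A r₀ : ℝ, 0 < C ∧ 1 < A ∧ 0 < r₀ ∧ ∀ (x : X) (ε : ℝ), 0 < ε → ε < r₀ → ∃ φ : X → ℝ,
      (∀ y, 0 ≤ φ y ∧ φ y ≤ 1) ∧ (∀ y ∈ Metric.ball x ε, φ y = 1) ∧
      (∀ y, y ∉ Metric.ball x (A * ε) → φ y = 0) ∧
      𝓔.EnergyLE φ (C * (m.real (Metric.ball x ε) / Ψ ε) ^ (1 / p)) := by
  obtain ⟨C, A, A₂, hC, hA, hA₂, h⟩ := hcap
  obtain ⟨a, b, hab⟩ := exists_pair_ne X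
  have hd : 0 < dist a b := dist_pos.2 hab
  have hC0 : 0 < C := by linarith
  -- The infimum need not be attained, so C is doubled to obtain a strict inequality. Two distinct
  -- points bound the diameter below, which gives a uniform range of radii.
  refine ⟨(2 * C) ^ (1 / p), A, dist a b / A₂, by positivity, hA, by positivity, fun x ε hε hεr => ?_⟩
  have hm0 : 0 < m.real (Metric.ball x ε) :=
    ENNReal.toReal_pos (Metric.measure_ball_pos m x hε).ne' (hVD.measure_ball_lt_top x ε).ne
  have hΨ0 := hΨ.pos hε
  have h1 := h x ε hε (by
    refine lt_of_lt_of_le ((ENNReal.ofReal_lt_ofReal_iff (by positivity)).2 hεr) ?_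
    rw [ENNReal.ofReal_div_of_pos (by positivity), ← edist_dist]
    exact ENNReal.div_le_div_right (Metric.edist_le_ediam_of_mem (mem_univ a) (mem_univ b)) _)
  have h2 : ENNReal.ofReal C * (m (Metric.ball x ε) / ENNReal.ofReal (Ψ ε))
      = ENNReal.ofReal (C * (m.real (Metric.ball x ε) / Ψ ε)) := by
    rw [ENNReal.ofReal_mul hC0.le, ENNReal.ofReal_div_of_pos hΨ0,
      ofReal_measureReal (hVD.measure_ball_lt_top x ε).ne]
  have h3 : ENNReal.ofReal (C * (m.real (Metric.ball x ε) / Ψ ε))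
      < ENNReal.ofReal (2 * C * (m.real (Metric.ball x ε) / Ψ ε)) := by
    have : 0 < C * (m.real (Metric.ball x ε) / Ψ ε) := by positivity
    exact (ENNReal.ofReal_lt_ofReal_iff (by linarith)).2 (by linarith)
  rw [h2] at h1
  have h4 := h1.trans_lt h3
  simp only [iInf_lt_iff] at h4
  obtain ⟨u, ⟨hu1, hu0⟩, hu⟩ := h4
  have hEu : 𝓔.semi univ u ≤ (2 * C) ^ (1 / p) * (m.real (Metric.ball x ε) / Ψ ε) ^ (1 / p) := by
    rw [semi_univ, ← Real.mul_rpow (by positivity) (by positivity)]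
    refine Real.rpow_le_rpow (𝓔.E_nonneg u) ?_ (one_div_nonneg.2 exponent_pos.le)
    exact (ENNReal.ofReal_le_ofReal_iff (by positivity)).1 hu.le
  classical
  have hlip : LipschitzWith 1 (fun t : ℝ => max 0 (min t 1)) :=
    (LipschitzWith.id.min_const 1).const_max 0
  refine ⟨fun y => if y ∈ Metric.ball x ε then 1 else if y ∈ Metric.ball x (A * ε) then
    max 0 (min (u.toLp y) 1) else 0, fun y => ?_, fun y hy => if_pos hy, fun y hy => ?_, ?_⟩
  · beta_reduce
    split_ifs
    · exact ⟨zero_le_one, le_rfl⟩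
    · exact ⟨le_max_left _ _, max_le zero_le_one (min_le_right _ _)⟩
    · exact ⟨le_rfl, zero_le_one⟩
  · have : y ∉ Metric.ball x ε := fun h => hy (Metric.ball_subset_ball (by nlinarith) h)
    simp only
    rw [if_neg this, if_neg hy]
  · have h5 := ((energyLE_self u).comp_lipschitz hlip (by simp)).mono
      (e' := (2 * C) ^ (1 / p) * (m.real (Metric.ball x ε) / Ψ ε) ^ (1 / p)) (by simpa using hEu)
    refine h5.congr ?_
    filter_upwards [hu1, hu0] with y hy1 hy0
    split_ifs with ha hb
    · rw [hy1 ha]; simp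
    · rfl
    · rw [hy0 hb]; simp

/-- Partitions of unity with controlled energy, subordinate to the balls around the points of a
maximal separated set. -/
theorem exists_partition [Nontrivial X] [OpensMeasurableSpace X] [m.IsOpenPosMeasure]
    [IsLocallyFiniteMeasure m]
    {Ψ : ℝ → ℝ} (hΨ : IsScaleFunction Ψ) (hVD : VolumeDoubling m) (hcap : 𝓔.CapacityUpper Ψ) :
    ∃ C A r₀ : ℝ, 0 < C ∧ 1 < A ∧ 0 < r₀ ∧ ∀ (ε : ℝ) (Z : Set X), 0 < ε → ε < r₀ → Separated Z ε →
      (∀ x, ∃ z ∈ Z, dist x z < ε) → ∃ ψ : X → X → ℝ,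
        (∀ z ∈ Z, (∀ x, |ψ z x| ≤ 1) ∧ (∀ x, x ∉ Metric.ball z (A * ε) → ψ z x = 0) ∧
          𝓔.EnergyLE (ψ z) (C * (m.real (Metric.ball z ε) / Ψ ε) ^ (1 / p))) ∧
        ∀ (x : X) (F : Finset X), ↑F ⊆ Z → (∀ z ∈ Z, dist x z < A * ε → z ∈ F) →
          ∑ z ∈ F, ψ z x = 1 := by
  obtain ⟨C, A, r₀, hC, hA, hr₀, h⟩ := exists_capacity_cutoff (𝓔 := 𝓔) hΨ hVD hcap
  obtain ⟨D, hD1, hD⟩ := hVD.exists_compare (1 + 2 * A)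
  obtain ⟨N, hN⟩ := hVD.exists_card_le (2 * A)
  -- The leading 1 accounts for φ_z itself; the rest is the product rule applied to φ_z and a
  -- function of at most N neighbouring cutoffs, whose masses are comparable by the factor D.
  refine ⟨C * (1 + 2 * (1 + N * (D : ℝ) ^ (1 / p))), A, r₀, by positivity, hA, hr₀,
    fun ε Z hε hεr hZ hZcov => ?_⟩
  choose φ hφ01 hφ1 hφ0 hφE using fun x => h x ε hε hεr
  have hfin : ∀ z, (Z ∩ Metric.ball z (2 * A * ε)).Finite := fun z =>
    finite_of_encard_le_coe (hN Z ε hε hZ z)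
  have hcard : ∀ z, (hfin z).toFinset.card ≤ N := fun z => by
    have := hN Z ε hε hZ z
    rw [(hfin z).encard_eq_coe_toFinset_card] at this
    exact_mod_cast this
  have habs : ∀ z x, |φ z x| ≤ 1 := fun z x => by rw [abs_of_nonneg (hφ01 z x).1]; exact (hφ01 z x).2
  have hψ : ∀ z x, φ z x + φ z x * invMaxOne (∑ i ∈ (hfin z).toFinset, φ i x)
      = φ z x * (max 1 (∑ i ∈ (hfin z).toFinset, φ i x))⁻¹ := fun z x => by
    rw [invMaxOne]; ring
  -- This is φ_z / max(1, Σφ_i). Splitting off φ_z leaves a Lipschitz function of the sum that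
  -- vanishes at 0, as the contraction property demands. The sum runs only over neighbours, so the
  -- energy bound does not depend on the size of the net.
  refine ⟨fun z x => φ z x + φ z x * invMaxOne (∑ i ∈ (hfin z).toFinset, φ i x),
    fun z hz => ⟨fun x => ?_, fun x hx => ?_, ?_⟩, fun x F hFZ hF => ?_⟩
  · have h1 := invMaxOne_mem (∑ i ∈ (hfin z).toFinset, φ i x)
    have h2 := hφ01 z x
    beta_reduce
    rw [show ∀ a b : ℝ, a + a * b = a * (1 + b) from fun a b => by ring, abs_mul]
    refine mul_le_one₀ (habs z x) (abs_nonneg _) ?_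
    rw [abs_le]; constructor <;> linarith
  · simp [hφ0 z x hx]
  · have hS := (energyLE_sum (hfin z).toFinset fun i _ => hφE i).comp_lipschitz
      lipschitzWith_invMaxOne invMaxOne_zero
    have h1 := (hφE z).add ((hφE z).mul hS (habs z) fun x => by
      have h1 := invMaxOne_mem (∑ i ∈ (hfin z).toFinset, φ i x)
      rw [abs_le]; constructor <;> linarith)
    refine h1.mono ?_
    set M := (m.real (Metric.ball z ε) / Ψ ε) ^ (1 / p) with hM
    have hΨ0 := hΨ.pos hε
    have hM0 : 0 ≤ M := by positivity
    have h2 : ∑ i ∈ (hfin z).toFinset, C * (m.real (Metric.ball i ε) / Ψ ε) ^ (1 / p)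
        ≤ N * (C * ((D : ℝ) ^ (1 / p) * M)) := by
      calc _ ≤ ∑ i ∈ (hfin z).toFinset, C * ((D : ℝ) ^ (1 / p) * M) := by
            refine Finset.sum_le_sum fun i hi => mul_le_mul_of_nonneg_left ?_ hC.le
            rw [hM, ← Real.mul_rpow (by positivity) (by positivity)]
            refine Real.rpow_le_rpow (by positivity) ?_ (one_div_nonneg.2 exponent_pos.le)
            rw [← mul_div_assoc]
            gcongr
            have hi' := ((hfin z).mem_toFinset.1 hi).2
            rw [Metric.mem_ball] at hi'
            have h3 := hD z i ε ε hε (by rw [dist_comm]; linarith)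
            have h4 := ENNReal.toReal_mono
              (ENNReal.mul_ne_top ENNReal.coe_ne_top (hVD.measure_ball_lt_top z ε).ne) h3
            rwa [ENNReal.toReal_mul, ENNReal.coe_toReal] at h4
        _ = (hfin z).toFinset.card * (C * ((D : ℝ) ^ (1 / p) * M)) := by
            rw [Finset.sum_const, nsmul_eq_mul]
        _ ≤ _ := by
            gcongr
            exact hcard z
    simp only [NNReal.coe_one, one_mul]
    calc _ ≤ C * M + 2 * (C * M + N * (C * ((D : ℝ) ^ (1 / p) * M))) := by gcongr
      _ = _ := by ring
  -- Where φ_z(x) ≠ 0, every other cutoff nonzero at x has its centre within 2Aε of z, so the sum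
  -- over neighbours agrees with the sum over F.
  · have hS : ∀ z ∈ F, φ z x + φ z x * invMaxOne (∑ i ∈ (hfin z).toFinset, φ i x)
        = φ z x * (max 1 (∑ i ∈ F, φ i x))⁻¹ := by
      intro z hz
      rw [hψ]
      by_cases hzx : φ z x = 0
      · rw [hzx, zero_mul, zero_mul]
      have hdist : ∀ i, φ i x ≠ 0 → dist x i < A * ε := fun i hi => by
        by_contra hcon
        exact hi (hφ0 i x hcon)
      congr 3
      refine Finset.sum_congr_of_eq_on_inter (fun i hi hiF => ?_) (fun i hi hiz => ?_) fun _ _ _ => rfl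
      · by_contra hne
        exact hiF (hF i ((hfin z).mem_toFinset.1 hi).1 (hdist i hne))
      · by_contra hne
        refine hiz ((hfin z).mem_toFinset.2 ⟨hFZ hi, ?_⟩)
        rw [Metric.mem_ball]
        have h1 := dist_triangle_left i z x
        have h2 := hdist i hne
        have h3 := hdist z hzx
        linarith
    rw [Finset.sum_congr rfl hS, ← Finset.sum_mul]
    obtain ⟨z, hz, hzx⟩ := hZcov x
    have hzF : z ∈ F := hF z hz (hzx.trans (by nlinarith))
    have h1 : 1 ≤ ∑ i ∈ F, φ i x := by
      rw [← hφ1 z x hzx]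
      exact Finset.single_le_sum (fun i _ => (hφ01 i x).1) hzF
    rw [max_eq_right h1, mul_inv_cancel₀ (by linarith)]

end PEnergyStructure

/-! ### Mean oscillation and coefficients on a net -/

section Oscillation

variable {X : Type*} [MeasurableSpace X]

/-- The mean oscillation `m(B)⁻¹ ∫_B ∫_B |G(x) - G(y)|^p`. -/
noncomputable def meanOsc (m : Measure X) (p : ℝ) (G : X → ℝ) (B : Set X) : ℝ≥0∞ :=
  (∫⁻ y in B, ∫⁻ x in B, gap p (G x) (G y) ∂m ∂m) / m B

variable {m : Measure X} {p : ℝ}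

theorem meanOsc_le_of_subset {D : ℝ≥0} (hD1 : 1 ≤ D) {G : X → ℝ} {B B' : Set X} (h : B ⊆ B')
    (hD : m B' ≤ D * m B) : meanOsc m p G B ≤ D * meanOsc m p G B' := by
  rw [meanOsc, meanOsc, div_eq_mul_inv, div_eq_mul_inv]
  calc _ ≤ (∫⁻ y in B', ∫⁻ x in B', gap p (G x) (G y) ∂m ∂m) * (D * (m B')⁻¹) := by
        refine mul_le_mul' ?_ (ENNReal.inv_le_mul_inv hD1 hD)
        refine (lintegral_mono_set h).trans (lintegral_mono fun y => lintegral_mono_set h)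
    _ = _ := by ring

variable [MetricSpace X] [SecondCountableTopology X] [IsLocallyFiniteMeasure m] [m.IsOpenPosMeasure]

/-- Each c_j is a typical value of G on B(j,ε). Neighbouring coefficients are compared through a
typical value b on the larger ball: the triangle inequality is integrated over the small ball, and
doubling equates the masses. -/
theorem VolumeDoubling.exists_coefficients (hVD : VolumeDoubling m) (hp : 0 < p) {A : ℝ} (hA : 1 < A) :
    ∃ K : ℝ≥0, 1 ≤ K ∧ ∀ (G : X → ℝ) (ε : ℝ), Measurable G → 0 < ε → ∃ c : X → ℝ,
      ∀ j, (∃ y ∈ Metric.ball j ε, c j = G y) ∧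
        ∫⁻ x in Metric.ball j ε, gap p (G x) (c j) ∂m
          ≤ K * meanOsc m p G (Metric.ball j ((A + 3) * ε)) ∧
        ∀ n, dist n j < (A + 1) * ε → gap p (c n) (c j) * m (Metric.ball j ε)
          ≤ K * meanOsc m p G (Metric.ball j ((A + 3) * ε)) := by
  obtain ⟨D, hD1, hD⟩ := hVD.exists_compare (2 * A + 4)
  set T : ℝ≥0 := (2 : ℝ≥0) ^ p with hT
  have hT1 : 1 ≤ T := NNReal.one_le_rpow (by norm_num) hp.le
  refine ⟨T * (D + 1) * (T * (D + 1)), ?_, fun G ε hG hε => ?_⟩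
  · have : 1 ≤ T * (D + 1) := one_le_mul_of_one_le_of_one_le hT1 le_add_self
    exact one_le_mul_of_one_le_of_one_le this this
  have hball0 : ∀ (z : X) (r : ℝ), 0 < r → m (Metric.ball z r) ≠ 0 := fun z r hr =>
    (Metric.measure_ball_pos m z hr).ne'
  have hballt : ∀ (z : X) (r : ℝ), m (Metric.ball z r) ≠ ∞ := fun z r =>
    (hVD.measure_ball_lt_top z r).ne
  choose y hyB hy using fun z => exists_deviation_le (p := p) hG (hball0 z ε hε) (hballt z ε)
  have hs : 0 < (A + 3) * ε := by positivity
  have hosc : ∀ n j, dist n j < (A + 1) * ε → meanOsc m p G (Metric.ball n ε)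
      ≤ D * meanOsc m p G (Metric.ball j ((A + 3) * ε)) := fun n j hnj =>
    meanOsc_le_of_subset hD1 (Metric.ball_subset_ball' (by linarith)) (hD n j ε _ hε (by linarith))
  have hK : (D : ℝ≥0∞) ≤ (T * (D + 1) * (T * (D + 1)) : ℝ≥0) := by
    norm_cast
    have h1 : D ≤ T * (D + 1) := le_self_add.trans (le_mul_of_one_le_left (by positivity) hT1)
    exact h1.trans (le_mul_of_one_le_right (by positivity)
      (one_le_mul_of_one_le_of_one_le hT1 le_add_self))
  refine ⟨fun z => G (y z), fun j => ⟨⟨y j, hyB j, rfl⟩, ?_, fun n hn => ?_⟩⟩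
  · refine ((hy j).trans (hosc j j ?_)).trans (mul_le_mul' hK le_rfl)
    rw [dist_self]; positivity
  · obtain ⟨b, hbB, hb⟩ := exists_deviation_le (p := p) hG (hball0 j _ hs) (hballt j ((A + 3) * ε))
    set q := meanOsc m p G (Metric.ball j ((A + 3) * ε)) with hq
    have key : ∀ n, dist n j < (A + 1) * ε → gap p (G (y n)) (G b) * m (Metric.ball n ε)
        ≤ (T * (D + 1) : ℝ≥0) * q := by
      intro n hn
      calc gap p (G (y n)) (G b) * m (Metric.ball n ε)
          = ∫⁻ x in Metric.ball n ε, gap p (G (y n)) (G b) ∂m := (setLIntegral_const _ _).symm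
        _ ≤ ∫⁻ x in Metric.ball n ε, T * (gap p (G x) (G (y n)) + gap p (G x) (G b)) ∂m := by
            refine lintegral_mono fun x => (gap_triangle hp _ _ (G x)).trans ?_
            rw [gap_comm (G (y n))]
        _ = T * (∫⁻ x in Metric.ball n ε, gap p (G x) (G (y n)) ∂m
              + ∫⁻ x in Metric.ball n ε, gap p (G x) (G b) ∂m) := by
            rw [lintegral_const_mul' _ _ ENNReal.coe_ne_top, lintegral_add_left (hG.gap_const _)]
        _ ≤ T * (D * q + q) := by
            gcongr
            · exact (hy n).trans (hosc n j hn)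
            · exact (lintegral_mono_set (Metric.ball_subset_ball' (by linarith))).trans hb
        _ = _ := by push_cast; ring
    have hDn : m (Metric.ball j ε) ≤ D * m (Metric.ball n ε) :=
      hD n j ε ε hε (by nlinarith)
    have hjj : dist j j < (A + 1) * ε := by rw [dist_self]; positivity
    calc gap p (G (y n)) (G (y j)) * m (Metric.ball j ε)
        ≤ T * (gap p (G (y n)) (G b) + gap p (G (y j)) (G b)) * m (Metric.ball j ε) := by
          gcongr
          refine (gap_triangle hp _ _ (G b)).trans ?_
          rw [gap_comm (G b)]
      _ = T * (gap p (G (y n)) (G b) * m (Metric.ball j ε)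
            + gap p (G (y j)) (G b) * m (Metric.ball j ε)) := by ring
      _ ≤ T * (gap p (G (y n)) (G b) * (D * m (Metric.ball n ε))
            + gap p (G (y j)) (G b) * m (Metric.ball j ε)) := by gcongr
      _ = T * (D * (gap p (G (y n)) (G b) * m (Metric.ball n ε))
            + gap p (G (y j)) (G b) * m (Metric.ball j ε)) := by ring
      _ ≤ T * (D * ((T * (D + 1) : ℝ≥0) * q) + (T * (D + 1) : ℝ≥0) * q) := by
          exact mul_le_mul' le_rfl (add_le_add (mul_le_mul' le_rfl (key n hn)) (key j hjj))
      _ = _ := by push_cast; ring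

/-- Two points of a ball of radius (A+3)ε are at distance below 2(A+3)ε, so the mean oscillation is
at most a constant times the integral over the ball of the Korevaar–Schoen density at that larger
radius; bounded overlap sums these. -/
theorem VolumeDoubling.exists_tsum_meanOsc_le [BorelSpace X] (hVD : VolumeDoubling m) {A : ℝ} (hA : 1 < A) :
    ∃ K : ℝ≥0, 1 ≤ K ∧ ∀ (G : X → ℝ) (ε : ℝ) (Z Z' U : Set X), Measurable G → 0 < ε →
      Separated Z ε → Z' ⊆ Z → MeasurableSet U → (∀ z ∈ Z', Metric.ball z ((A + 3) * ε) ⊆ U) →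
      ∑' z : Z', meanOsc m p G (Metric.ball (z : X) ((A + 3) * ε))
        ≤ K * ksEnergy m p (2 * (A + 3) * ε) U G := by
  obtain ⟨D, hD1, hD⟩ := hVD.exists_compare 3
  obtain ⟨N, hN⟩ := hVD.exists_card_le (A + 3)
  refine ⟨max 1 (D * N), le_max_left _ _, fun G ε Z Z' U hG hε hZ hZ' hU hsub => ?_⟩
  have hs : 0 < (A + 3) * ε := by positivity
  have : Countable Z' := ((hZ.countable hε).mono hZ').to_subtype
  set f : X → ℝ≥0∞ := fun y => (∫⁻ x in U ∩ Metric.ball y (2 * (A + 3) * ε), gap p (G x) (G y) ∂m) /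
    m (Metric.ball y (2 * (A + 3) * ε)) with hf
  have hfm : Measurable f := (measurable_lintegral_gap hG _).div (measurable_measure_ball _)
  have h1 : ∀ z : Z', meanOsc m p G (Metric.ball (z : X) ((A + 3) * ε))
      ≤ D * ∫⁻ y in Metric.ball (z : X) ((A + 3) * ε), f y ∂m := by
    intro z
    set B := Metric.ball (z : X) ((A + 3) * ε) with hB
    have hB0 : m B ≠ 0 := (Metric.measure_ball_pos m (z : X) hs).ne'
    rw [meanOsc, div_eq_mul_inv, mul_comm, ← lintegral_const_mul' _ _ (ENNReal.inv_ne_top.2 hB0),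
      ← lintegral_const_mul' _ _ ENNReal.coe_ne_top]
    refine setLIntegral_mono' Metric.isOpen_ball.measurableSet fun y hy => ?_
    rw [hB, Metric.mem_ball] at hy
    rw [hf]
    simp only
    rw [div_eq_mul_inv, mul_comm (lintegral _ _) (_)⁻¹, ← mul_assoc]
    refine mul_le_mul' (ENNReal.inv_le_mul_inv hD1 (hD z y _ _ hs ?_)) (lintegral_mono_set fun x hx => ?_)
    · rw [dist_comm]; linarith
    · refine ⟨hsub z z.2 hx, ?_⟩
      rw [hB, Metric.mem_ball] at hx
      rw [Metric.mem_ball]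
      have := dist_triangle_right x y z
      linarith
  calc _ ≤ ∑' z : Z', D * ∫⁻ y in Metric.ball (z : X) ((A + 3) * ε), f y ∂m := ENNReal.tsum_le_tsum h1
    _ = D * ∑' z : Z', ∫⁻ y in Metric.ball (z : X) ((A + 3) * ε), f y ∂m := ENNReal.tsum_mul_left
    _ ≤ D * (N * ∫⁻ y in U, f y ∂m) := by
        gcongr
        exact tsum_setLIntegral_le m (fun z : Z' => Metric.ball (z : X) ((A + 3) * ε)) (fun _ => Metric.isOpen_ball.measurableSet) U
          (fun z => hsub z z.2) N (fun x => encard_setOf_mem_ball_le hZ' (hN Z ε hε hZ x)) f hfm hU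
    _ = (D * N : ℝ≥0) * ksEnergy m p (2 * (A + 3) * ε) U G := by
        rw [ksEnergy]; push_cast; ring
    _ ≤ _ := by gcongr; exact le_max_right _ _

end Oscillation

section Gap

variable {X : Type*} [MeasurableSpace X] {m : Measure X} {p : ℝ}

theorem abs_sub_le_of_gap_mul_le (hp : 0 < p) {a b : ℝ} {B : Set X} (hB0 : m B ≠ 0) (hB : m B ≠ ∞) {q : ℝ≥0∞}
    (hq : q ≠ ∞) (h : gap p a b * m B ≤ q) : |a - b| ≤ (q.toReal / m.real B) ^ (1 / p) := by
  have hM : 0 < m.real B := ENNReal.toReal_pos hB0 hB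
  have h1 := ENNReal.toReal_mono hq h
  rw [ENNReal.toReal_mul, gap, ENNReal.toReal_ofReal (Real.rpow_nonneg (abs_nonneg _) _)] at h1
  have h2 : |a - b| ^ p ≤ q.toReal / m.real B := (le_div_iff₀ hM).2 h1
  calc |a - b| = (|a - b| ^ p) ^ (1 / p) := by
        rw [← Real.rpow_mul (abs_nonneg _), mul_one_div_cancel hp.ne', Real.rpow_one]
    _ ≤ _ := Real.rpow_le_rpow (Real.rpow_nonneg (abs_nonneg _) _) h2 (one_div_nonneg.2 hp.le)

theorem local_gap_le (hp : 0 < p) {B : Set X} (hB0 : m B ≠ 0) (hB : m B ≠ ∞) {ι : Type*} (F : Finset ι) {N : ℕ}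
    (hF : F.card ≤ N) {c : ι → ℝ} {b : ℝ} {q : ℝ≥0∞} (hq : q ≠ ∞)
    (hc : ∀ n ∈ F, gap p (c n) b * m B ≤ q) {t : ι → ℝ} (ht : ∀ n ∈ F, |t n| ≤ 1) :
    gap p (b + ∑ n ∈ F, (c n - b) * t n) b * m B ≤ ENNReal.ofReal ((N : ℝ) ^ p) * q := by
  have hM : 0 < m.real B := ENNReal.toReal_pos hB0 hB
  have hQ : 0 ≤ q.toReal / m.real B := by positivity
  have h1 : |b + ∑ n ∈ F, (c n - b) * t n - b| ≤ N * (q.toReal / m.real B) ^ (1 / p) := by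
    rw [add_sub_cancel_left]
    calc _ ≤ ∑ n ∈ F, |(c n - b) * t n| := Finset.abs_sum_le_sum_abs _ _
      _ ≤ ∑ n ∈ F, (q.toReal / m.real B) ^ (1 / p) := by
        refine Finset.sum_le_sum fun n hn => ?_
        rw [abs_mul]
        exact (mul_le_of_le_one_right (abs_nonneg _) (ht n hn)).trans
          (abs_sub_le_of_gap_mul_le hp hB0 hB hq (hc n hn))
      _ = F.card * (q.toReal / m.real B) ^ (1 / p) := by rw [Finset.sum_const, nsmul_eq_mul]
      _ ≤ _ := by gcongr
  calc _ ≤ ENNReal.ofReal ((N * (q.toReal / m.real B) ^ (1 / p)) ^ p) * ENNReal.ofReal (m.real B) := by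
        rw [ofReal_measureReal hB, gap]
        gcongr
    _ = ENNReal.ofReal ((N : ℝ) ^ p) * ENNReal.ofReal q.toReal := by
        rw [Real.mul_rpow (by positivity) (by positivity), ← Real.rpow_mul hQ,
          one_div_mul_cancel hp.ne', Real.rpow_one, ← ENNReal.ofReal_mul (by positivity),
          ← ENNReal.ofReal_mul (by positivity), mul_assoc, div_mul_cancel₀ _ hM.ne']
    _ = _ := by rw [ENNReal.ofReal_toReal hq]

end Gap

/-! ### Discrete approximation at a fixed scale -/

namespace PEnergyStructure

variable {X : Type*} [MetricSpace X] [MeasurableSpace X] {m : Measure X} {p : ℝ} [hp : Fact (1 < p)]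
variable {𝓔 : PEnergyStructure m p}

/-- Strong locality removes the constant b on B, leaving the combination of the ψ_n with
coefficients c_n - b. Each coefficient is at most (q/m(B))^{1/p} and each energy is of order
(m(B)/P)^{1/p}, so m(B) cancels. -/
theorem local_energy_le [LocallyCompactSpace X] [TopologicalSpace.SeparableSpace X] [BorelSpace X]
    {B : Set X} (hBo : IsOpen B) (hB0 : m B ≠ 0) (hB : m B ≠ ∞) {ι : Type*} (F : Finset ι) {N : ℕ}
    (hF : F.card ≤ N) {c : ι → ℝ} {b : ℝ} {q : ℝ≥0∞} (hq : q ≠ ∞)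
    (hc : ∀ n ∈ F, gap p (c n) b * m B ≤ q) {ψ : ι → X → ℝ} {C D P : ℝ} (hC : 0 ≤ C) (hD : 0 ≤ D)
    (hP : 0 < P) (hψ : ∀ n ∈ F, 𝓔.EnergyLE (ψ n) (C * (D * (m.real B / P)) ^ (1 / p)))
    (w : 𝓔.Dom) (hw : ∀ᵐ x ∂m, x ∈ B → w.toLp x = b + ∑ n ∈ F, (c n - b) * ψ n x) :
    𝓔.Γ w B ≤ ENNReal.ofReal ((N * C) ^ p * D) * (q / ENNReal.ofReal P) := by
  have hp0 : 0 < p := exponent_pos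
  have hM : 0 < m.real B := ENNReal.toReal_pos hB0 hB
  have hQ : 0 ≤ q.toReal / m.real B := by positivity
  obtain ⟨h, hh, hhE⟩ := energyLE_sum F fun n hn => (hψ n hn).const_mul (c n - b)
  have h1 : ∑ n ∈ F, |c n - b| * (C * (D * (m.real B / P)) ^ (1 / p))
      ≤ N * C * (D * (q.toReal / P)) ^ (1 / p) := by
    calc _ ≤ ∑ n ∈ F, C * (D * (q.toReal / P)) ^ (1 / p) := by
          refine Finset.sum_le_sum fun n hn => ?_
          have h2 := abs_sub_le_of_gap_mul_le hp0 hB0 hB hq (hc n hn)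
          calc _ ≤ (q.toReal / m.real B) ^ (1 / p) * (C * (D * (m.real B / P)) ^ (1 / p)) := by gcongr
            _ = C * ((q.toReal / m.real B) * (D * (m.real B / P))) ^ (1 / p) := by
                rw [Real.mul_rpow hQ (by positivity)]; ring
            _ = _ := by congr 2; field_simp
      _ = F.card * (C * (D * (q.toReal / P)) ^ (1 / p)) := by rw [Finset.sum_const, nsmul_eq_mul]
      _ ≤ N * (C * (D * (q.toReal / P)) ^ (1 / p)) := by gcongr
      _ = _ := by ring
  have h2 : 𝓔.semi B h ≤ N * C * (D * (q.toReal / P)) ^ (1 / p) :=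
    ((𝓔.semi_mono (subset_univ B) h).trans hhE).trans h1
  have h3 : 𝓔.Γ w B = 𝓔.Γ h B := by
    refine Γ_eq_of_sub_eq_const w h hBo b ?_ subset_rfl hBo.measurableSet
    filter_upwards [hw, hh] with x hx hx' hxB
    rw [hx hxB, hx']; ring
  rw [h3]
  refine ((𝓔.Γ_le_iff B h (by positivity)).1 h2).trans (le_of_eq ?_)
  rw [ENNReal.ofReal_rpow_of_nonneg (by positivity) hp0.le, Real.mul_rpow (by positivity) (by positivity),
    ← Real.rpow_mul (by positivity), one_div_mul_cancel hp0.ne', Real.rpow_one, ← mul_assoc,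
    ENNReal.ofReal_mul (by positivity), ENNReal.ofReal_div_of_pos hP, ENNReal.ofReal_toReal hq]

/-- W is the discrete convolution of G with a partition of unity. On each net ball both its energy
and its deviation from G are governed by the mean oscillation of G over a larger ball; summing these
recovers the Korevaar–Schoen energy. Restricting to the r-interior of U keeps the larger balls
inside U. -/
theorem exists_approximation [CompleteSpace X] [LocallyCompactSpace X] [Nontrivial X]
    [SecondCountableTopology X] [BorelSpace X] [IsLocallyFiniteMeasure m] [m.IsOpenPosMeasure]
    {Ψ : ℝ → ℝ} (hΨ : IsScaleFunction Ψ) (hVD : VolumeDoubling m) (hcap : 𝓔.CapacityUpper Ψ) :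
    ∃ (C : ℝ≥0) (r₀ : ℝ), 1 ≤ C ∧ 0 < r₀ ∧ ∀ (G : X → ℝ) (o : X) (R r : ℝ), Measurable G →
      (∀ y, y ∉ Metric.ball o R → G y = 0) → 0 < r → r < r₀ → ∃ (w : 𝓔.Dom) (W : X → ℝ),
        w.toLp =ᵐ[m] W ∧ ∫⁻ x, gap p (W x) (G x) ∂m ≤ C * ksEnergy m p r univ G ∧
        ∀ U, MeasurableSet U →
          𝓔.Γ w {x | Metric.ball x r ⊆ U} ≤ C * (ksEnergy m p r U G / ENNReal.ofReal (Ψ r)) := by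
  have hp0 : 0 < p := exponent_pos
  obtain ⟨Cψ, A, ρ₀, hCψ, hA, hρ₀, hpart⟩ := exists_partition (𝓔 := 𝓔) hΨ hVD hcap
  obtain ⟨K, hK1, hK⟩ := hVD.exists_coefficients hp0 hA
  obtain ⟨Ks, hKs1, hKs⟩ := hVD.exists_tsum_meanOsc_le hA
  obtain ⟨N, hN⟩ := hVD.exists_card_le (A + 1)
  obtain ⟨D, hD1, hD⟩ := hVD.exists_compare (A + 2)
  obtain ⟨DΨ, hDΨ1, hDΨ⟩ := hΨ.exists_doubling (2 * (A + 3))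
  set T : ℝ≥0 := (2 : ℝ≥0) ^ p with hT
  have hT1 : 1 ≤ T := NNReal.one_le_rpow (by norm_num) hp0.le
  set E₁ : ℝ≥0 := T * (((N : ℝ) ^ p).toNNReal * K + K) with hE₁
  -- The added 1 keeps the constant positive, so the bound is trivially true when the oscillation is
  -- infinite.
  set E₂ : ℝ≥0 := (((N * Cψ) ^ p * D).toNNReal + 1) * K with hE₂
  refine ⟨E₁ * Ks + E₂ * Ks * DΨ, 2 * (A + 3) * ρ₀, ?_, by positivity,
    fun G o R r hG hGR hr hrr => ?_⟩
  · refine le_add_of_nonneg_of_le (by positivity) ?_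
    refine one_le_mul_of_one_le_of_one_le (one_le_mul_of_one_le_of_one_le ?_ hKs1) hDΨ1
    exact one_le_mul_of_one_le_of_one_le le_add_self hK1
  -- With this mesh the radius 2(A+3)ε of the oscillation estimate is exactly r.
  set ε : ℝ := r / (2 * (A + 3)) with hε_def
  have hA3 : 0 < 2 * (A + 3) := by positivity
  have hε : 0 < ε := by positivity
  have hεr : 2 * (A + 3) * ε = r := by rw [hε_def]; field_simp
  have hερ : ε < ρ₀ := by rw [hε_def, div_lt_iff₀ hA3]; linarith
  obtain ⟨Z, hZ, hZcov⟩ := exists_maximal_separated X hε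
  obtain ⟨ψ, hψ, hψ1⟩ := hpart ε Z hε hερ hZ hZcov
  obtain ⟨c, hc⟩ := hK G ε hG hε
  -- Bounded support of G leaves finitely many possibly nonzero coefficients, so W is a finite sum
  -- in the domain.
  have hTfin : (Z ∩ Metric.ball o (R + ε)).Finite := by
    obtain ⟨N', hN'⟩ := hVD.exists_card_le ((R + ε) / ε)
    have := hN' Z ε hε hZ o
    rw [div_mul_cancel₀ _ hε.ne'] at this
    exact finite_of_encard_le_coe this
  have hfin : ∀ j, (Z ∩ Metric.ball j ((A + 1) * ε)).Finite := fun j =>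
    finite_of_encard_le_coe (hN Z ε hε hZ j)
  have hcard : ∀ j, (hfin j).toFinset.card ≤ N := fun j => by
    have := hN Z ε hε hZ j
    rw [(hfin j).encard_eq_coe_toFinset_card] at this
    exact_mod_cast this
  set W : X → ℝ := fun x => ∑ n ∈ hTfin.toFinset, c n * ψ n x with hW
  have hc0 : ∀ n, n ∉ Metric.ball o (R + ε) → c n = 0 := fun n hn => by
    obtain ⟨y, hy, hcy⟩ := (hc n).1
    rw [hcy]
    refine hGR y fun hyo => hn ?_
    rw [Metric.mem_ball] at hy hyo ⊢
    have := dist_triangle_left n o y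
    linarith
  obtain ⟨w, hw, -⟩ := energyLE_sum hTfin.toFinset (f := fun n x => c n * ψ n x) fun n hn =>
    ((hψ n (hTfin.mem_toFinset.1 hn).1).2.2).const_mul (c n)
  -- Near j the partition sums to 1, so c_j can be subtracted from every coefficient and only
  -- neighbours contribute.
  have hWloc : ∀ j, ∀ x ∈ Metric.ball j ε,
      W x = c j + ∑ n ∈ (hfin j).toFinset, (c n - c j) * ψ n x := by
    intro j x hx
    rw [Metric.mem_ball] at hx
    have hnear : ∀ n ∈ Z, dist x n < A * ε → n ∈ (hfin j).toFinset := fun n hn hxn => by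
      refine (hfin j).mem_toFinset.2 ⟨hn, ?_⟩
      rw [Metric.mem_ball]
      have := dist_triangle_left n j x
      linarith
    have h1 := hψ1 x (hfin j).toFinset (fun n hn => ((hfin j).mem_toFinset.1 hn).1) hnear
    have h2 : W x = ∑ n ∈ (hfin j).toFinset, c n * ψ n x := by
      refine Finset.sum_congr_of_eq_on_inter (fun n hn hnj => ?_) (fun n hn hnT => ?_) fun _ _ _ => rfl
      · have hnZ := (hTfin.mem_toFinset.1 hn).1
        rw [(hψ n hnZ).2.1 x fun h => hnj (hnear n hnZ h), mul_zero]
      · have hnZ := ((hfin j).mem_toFinset.1 hn).1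
        rw [hc0 n fun h => hnT (hTfin.mem_toFinset.2 ⟨hnZ, h⟩), zero_mul]
    rw [h2]
    simp only [sub_mul, Finset.sum_sub_distrib, ← Finset.mul_sum, h1]
    ring
  have hΨε := hΨ.pos hε
  have hB0 : ∀ j : X, m (Metric.ball j ε) ≠ 0 := fun j => (Metric.measure_ball_pos m j hε).ne'
  have hBt : ∀ j : X, m (Metric.ball j ε) ≠ ∞ := fun j => (hVD.measure_ball_lt_top j ε).ne
  set q : X → ℝ≥0∞ := fun j => meanOsc m p G (Metric.ball j ((A + 3) * ε)) with hq
  have hgap : ∀ j, ∀ n ∈ (hfin j).toFinset, gap p (c n) (c j) * m (Metric.ball j ε) ≤ K * q j :=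
    fun j n hn => (hc j).2.2 n ((hfin j).mem_toFinset.1 hn).2
  have hK0 : (K : ℝ≥0∞) ≠ 0 := by
    have : 0 < K := by positivity
    exact_mod_cast this.ne'
  have hL : ∀ j ∈ Z, ∫⁻ x in Metric.ball j ε, gap p (W x) (G x) ∂m ≤ E₁ * q j := by
    intro j hj
    rcases eq_or_ne (q j) ∞ with hqj | hqj
    · have : (E₁ : ℝ≥0∞) ≠ 0 := by
        have : 0 < E₁ := by positivity
        exact_mod_cast this.ne'
      rw [hqj, ENNReal.mul_top this]
      exact le_top
    have hKq : (K : ℝ≥0∞) * q j ≠ ∞ := ENNReal.mul_ne_top ENNReal.coe_ne_top hqj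
    have h1 : ∀ x ∈ Metric.ball j ε, gap p (W x) (c j)
        ≤ ENNReal.ofReal ((N : ℝ) ^ p) * (K * q j) / m (Metric.ball j ε) := fun x hx => by
      rw [ENNReal.le_div_iff_mul_le (Or.inl (hB0 j)) (Or.inl (hBt j)), hWloc j x hx]
      exact local_gap_le hp0 (hB0 j) (hBt j) _ (hcard j) hKq (hgap j) fun n hn =>
        (hψ n ((hfin j).mem_toFinset.1 hn).1).1 x
    calc ∫⁻ x in Metric.ball j ε, gap p (W x) (G x) ∂m
        ≤ ∫⁻ x in Metric.ball j ε, T * (ENNReal.ofReal ((N : ℝ) ^ p) * (K * q j) / m (Metric.ball j ε)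
            + gap p (G x) (c j)) ∂m := by
          refine setLIntegral_mono' Metric.isOpen_ball.measurableSet fun x hx => ?_
          refine (gap_triangle hp0 _ _ (c j)).trans ?_
          rw [gap_comm (c j)]
          gcongr
          exact h1 x hx
      _ = T * (ENNReal.ofReal ((N : ℝ) ^ p) * (K * q j) / m (Metric.ball j ε) * m (Metric.ball j ε)
            + ∫⁻ x in Metric.ball j ε, gap p (G x) (c j) ∂m) := by
          rw [lintegral_const_mul' _ _ ENNReal.coe_ne_top, lintegral_add_left measurable_const,
            setLIntegral_const]
      _ ≤ T * (ENNReal.ofReal ((N : ℝ) ^ p) * (K * q j) + K * q j) := by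
          rw [ENNReal.div_mul_cancel (hB0 j) (hBt j)]
          exact mul_le_mul' le_rfl (add_le_add le_rfl (hc j).2.1)
      _ = _ := by
          rw [hE₁, ENNReal.ofReal]
          push_cast; ring
  have hE : ∀ j ∈ Z, 𝓔.Γ w (Metric.ball j ε) ≤ E₂ * DΨ * (ENNReal.ofReal (Ψ r))⁻¹ * q j := by
    intro j hj
    rcases eq_or_ne (q j) ∞ with hqj | hqj
    · have : (E₂ : ℝ≥0∞) * DΨ * (ENNReal.ofReal (Ψ r))⁻¹ ≠ 0 := by
        refine mul_ne_zero ?_ (ENNReal.inv_ne_zero.2 ENNReal.ofReal_ne_top)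
        have : 0 < E₂ * DΨ := by positivity
        exact_mod_cast this.ne'
      rw [hqj, ENNReal.mul_top this]
      exact le_top
    have hKq : (K : ℝ≥0∞) * q j ≠ ∞ := ENNReal.mul_ne_top ENNReal.coe_ne_top hqj
    have h1 := local_energy_le (𝓔 := 𝓔) Metric.isOpen_ball (hB0 j) (hBt j) (hfin j).toFinset (hcard j)
      hKq (hgap j) (ψ := ψ) hCψ.le (NNReal.coe_nonneg D) hΨε (fun n hn => by
        obtain ⟨hnZ, hnj⟩ := (hfin j).mem_toFinset.1 hn
        rw [Metric.mem_ball, dist_comm] at hnj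
        refine ((hψ n hnZ).2.2).mono (mul_le_mul_of_nonneg_left ?_ hCψ.le)
        refine Real.rpow_le_rpow (by positivity) ?_ (one_div_nonneg.2 hp0.le)
        rw [← mul_div_assoc]
        gcongr
        have h4 := ENNReal.toReal_mono (ENNReal.mul_ne_top ENNReal.coe_ne_top (hBt j))
          (hD j n ε ε hε (by linarith))
        rwa [ENNReal.toReal_mul, ENNReal.coe_toReal] at h4) w (by
        filter_upwards [hw] with x hx hxB
        rw [hx, ← hWloc j x hxB])
    refine h1.trans ?_
    have h2 : (ENNReal.ofReal (Ψ ε))⁻¹ ≤ DΨ * (ENNReal.ofReal (Ψ r))⁻¹ :=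
      ENNReal.inv_le_mul_inv hDΨ1 (hDΨ ε r hε hr hεr.ge)
    calc _ ≤ ((((N * Cψ) ^ p * D).toNNReal + 1 : ℝ≥0) : ℝ≥0∞) *
          ((K * q j) * (DΨ * (ENNReal.ofReal (Ψ r))⁻¹)) := by
          rw [div_eq_mul_inv]
          refine mul_le_mul' ?_ (mul_le_mul' le_rfl h2)
          rw [ENNReal.ofReal]
          exact_mod_cast le_self_add
      _ = _ := by rw [hE₂]; push_cast; ring
  have hZc : Countable Z := (hZ.countable hε).to_subtype
  refine ⟨w, W, hw, ?_, fun U hU => ?_⟩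
  · have hcov : (univ : Set X) ⊆ ⋃ z : Z, Metric.ball (z : X) ε := fun x _ => by
      obtain ⟨z, hz, hxz⟩ := hZcov x
      exact mem_iUnion.2 ⟨⟨z, hz⟩, hxz⟩
    calc ∫⁻ x, gap p (W x) (G x) ∂m
        ≤ ∑' z : Z, ∫⁻ x in Metric.ball (z : X) ε, gap p (W x) (G x) ∂m := by
          rw [← setLIntegral_univ]
          exact (lintegral_mono_set hcov).trans (lintegral_iUnion_le _ _)
      _ ≤ ∑' z : Z, E₁ * q z := ENNReal.tsum_le_tsum fun z => hL z z.2
      _ ≤ E₁ * (Ks * ksEnergy m p r univ G) := by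
          rw [ENNReal.tsum_mul_left, ← hεr]
          gcongr
          exact hKs G ε Z Z univ hG hε hZ subset_rfl MeasurableSet.univ fun _ _ => subset_univ _
      _ = (E₁ * Ks : ℝ≥0) * ksEnergy m p r univ G := by push_cast; ring
      _ ≤ _ := by gcongr; exact le_self_add
  · set Z' : Set X := {z ∈ Z | (Metric.ball z ε ∩ {x | Metric.ball x r ⊆ U}).Nonempty} with hZ'
    have hZ'Z : Z' ⊆ Z := fun z hz => hz.1
    have : Countable Z' := ((hZ.countable hε).mono hZ'Z).to_subtype
    have hcov : {x | Metric.ball x r ⊆ U} ⊆ ⋃ z : Z', Metric.ball (z : X) ε := fun x hx => by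
      obtain ⟨z, hz, hxz⟩ := hZcov x
      exact mem_iUnion.2 ⟨⟨z, hz, x, hxz, hx⟩, hxz⟩
    have hsub : ∀ z ∈ Z', Metric.ball z ((A + 3) * ε) ⊆ U := fun z hz => by
      obtain ⟨x, hxz, hxU⟩ := hz.2
      refine (Metric.ball_subset_ball' ?_).trans (mem_ofPred.1 hxU)
      rw [Metric.mem_ball, dist_comm] at hxz
      nlinarith
    calc 𝓔.Γ w {x | Metric.ball x r ⊆ U} ≤ ∑' z : Z', 𝓔.Γ w (Metric.ball (z : X) ε) :=
          (measure_mono hcov).trans (measure_iUnion_le _)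
      _ ≤ ∑' z : Z', E₂ * DΨ * (ENNReal.ofReal (Ψ r))⁻¹ * q z :=
          ENNReal.tsum_le_tsum fun z => hE z (hZ'Z z.2)
      _ ≤ E₂ * DΨ * (ENNReal.ofReal (Ψ r))⁻¹ * (Ks * ksEnergy m p r U G) := by
          rw [ENNReal.tsum_mul_left, ← hεr]
          gcongr
          exact hKs G ε Z Z' U hG hε hZ hZ'Z hU hsub
      _ = (E₂ * Ks * DΨ : ℝ≥0) * (ksEnergy m p r U G / ENNReal.ofReal (Ψ r)) := by
          rw [div_eq_mul_inv]; push_cast; ring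
      _ ≤ _ := by gcongr; exact le_add_self

end PEnergyStructure

/-! ### Energy measures bounded by lower limits of Korevaar–Schoen energies -/

namespace PEnergyStructure

variable {X : Type*} [MetricSpace X] [MeasurableSpace X] {m : Measure X} {p : ℝ} [hp : Fact (1 < p)]
variable {𝓔 : PEnergyStructure m p}

theorem semi_le_iff (A : Set X) (u : 𝓔.Dom) {c : ℝ≥0∞} (hc : c ≠ ∞) :
    𝓔.semi A u ≤ c.toReal ^ (1 / p) ↔ 𝓔.Γ u A ≤ c := by
  rw [semi, Real.rpow_le_rpow_iff measureReal_nonneg ENNReal.toReal_nonneg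
    (one_div_pos.2 exponent_pos), Measure.real, ENNReal.toReal_le_toReal (measure_ne_top _ _) hc]

variable [CompleteSpace X] [LocallyCompactSpace X] [Nontrivial X]
    [SecondCountableTopology X] [BorelSpace X] [IsLocallyFiniteMeasure m] [m.IsOpenPosMeasure]

/-- Along scales r_n realising the lower limit, the discrete approximations converge to u in L^p
with bounded energy, so `exists_limit` applies on each fixed interior set of U, and these sets
exhaust U. -/
theorem exists_Γ_le_liminf_of_bounded_support {Ψ : ℝ → ℝ} (hΨ : IsScaleFunction Ψ)
    (hVD : VolumeDoubling m) (hPI : 𝓔.Poincare Ψ) (hcap : 𝓔.CapacityUpper Ψ) :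
    ∃ C : ℝ≥0, 1 ≤ C ∧ ∀ (u : 𝓔.Dom) (G : X → ℝ) (o : X) (R : ℝ) (U : Set X), Measurable G →
      u.toLp =ᵐ[m] G → (∀ y, y ∉ Metric.ball o R → G y = 0) → IsOpen U →
      𝓔.Γ u U ≤ C * liminf (fun r => ksEnergy m p r U G / ENNReal.ofReal (Ψ r)) (𝓝[>] 0) := by
  have hp0 : 0 < p := exponent_pos
  obtain ⟨C, r₀, hC1, hr₀, hC⟩ := exists_approximation (𝓔 := 𝓔) hΨ hVD hcap
  obtain ⟨C', κ, -, -, hC'⟩ := exists_ksEnergy_le (𝓔 := 𝓔) hΨ hVD hPI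
  refine ⟨C, hC1, fun u G o R U hGm hG hGR hU => ?_⟩
  have hC0 : (C : ℝ≥0∞) ≠ 0 := by
    have : 0 < C := by positivity
    exact_mod_cast this.ne'
  have hUc : MeasurableSet U := hU.measurableSet
  suffices h : ∀ c, liminf (fun r => ksEnergy m p r U G / ENNReal.ofReal (Ψ r)) (𝓝[>] 0) < c →
      𝓔.Γ u U ≤ C * c by
    rw [mul_comm, ← ENNReal.div_le_iff_le_mul (Or.inl hC0) (Or.inl ENNReal.coe_ne_top)]
    refine le_of_forall_gt_imp_ge_of_dense fun c hc => ?_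
    rw [ENNReal.div_le_iff_le_mul (Or.inl hC0) (Or.inl ENNReal.coe_ne_top), mul_comm]
    exact h c hc
  intro c hc
  rcases eq_or_ne c ∞ with rfl | hct
  · rw [ENNReal.mul_top hC0]; exact le_top
  -- The Poincaré bound is used only for convergence and boundedness of the approximations; its
  -- constant does not enter the conclusion.
  have hks : ∀ r, 0 < r → ksEnergy m p r univ G ≤ C' * ENNReal.ofReal (Ψ r) * 𝓔.Γ u univ := by
    intro r hr
    rw [← ksEnergy_congr hp0 MeasurableSet.univ (hG.mono fun x hx _ => hx)]
    refine (hC' r univ u hr).trans ?_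
    gcongr
    exact subset_univ _
  have hfreq := (frequently_lt_of_liminf_lt isCobounded_ge_of_top hc).and_eventually
    (Ioo_mem_nhdsGT hr₀)
  obtain ⟨r, hr, hrp⟩ := exists_seq_forall_of_frequently hfreq
  choose w W hwW hL hE using fun n => hC G o R (r n) hGm hGR (hrp n).2.1 (hrp n).2.2
  have hlim : Tendsto (fun n => (w n).toLp) atTop (𝓝 u.toLp) := by
    refine tendsto_toLp_of_tendsto_lintegral hwW ?_
    have h1 : Tendsto (fun n => C * (C' * ENNReal.ofReal (Ψ (r n)) * 𝓔.Γ u univ)) atTop (𝓝 0) := by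
      have h2 := hΨ.tendsto_zero.comp hr
      have h3 := ENNReal.Tendsto.const_mul (a := (C : ℝ≥0∞))
        (ENNReal.Tendsto.mul_const (b := 𝓔.Γ u univ) (ENNReal.Tendsto.const_mul (a := (C' : ℝ≥0∞)) h2
          (Or.inr ENNReal.coe_ne_top)) (Or.inr (measure_ne_top _ _))) (Or.inr ENNReal.coe_ne_top)
      simpa using h3
    refine tendsto_of_tendsto_of_tendsto_of_le_of_le tendsto_const_nhds h1 (fun _ => zero_le) fun n => ?_
    refine le_trans (le_of_eq (lintegral_congr_ae ?_)) ((hL n).trans (mul_le_mul' le_rfl (hks _ (hrp n).2.1)))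
    filter_upwards [hG] with x hx
    rw [hx, gap]
  have hbound : ∀ n, 𝓔.semi univ (w n) ≤ (C * (C' * 𝓔.Γ u univ)).toReal ^ (1 / p) := fun n => by
    rw [semi_le_iff _ _ (by finiteness)]
    have h1 := hE n univ MeasurableSet.univ
    simp only [subset_univ, ofPred_true] at h1
    refine h1.trans (mul_le_mul' le_rfl ?_)
    refine ENNReal.div_le_of_le_mul ((hks _ (hrp n).2.1).trans (le_of_eq (by ring)))
  obtain ⟨v, hv, hvA⟩ := 𝓔.exists_limit w _ hbound _ hlim
  obtain rfl : v = u := Subtype.ext hv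
  -- Once r_n < 1/(k+1), this set lies in the r_n-interior of U, where the approximation estimate
  -- holds.
  set V : ℕ → Set X := fun k => {x | Metric.ball x (1 / ((k : ℝ) + 1)) ⊆ U} with hV
  have hVm : ∀ k, MeasurableSet (V k) := fun k => by
    have h1 : V k = (Metric.thickening (1 / ((k : ℝ) + 1)) Uᶜ)ᶜ := by
      ext x
      simp only [hV, mem_ofPred_eq, mem_compl_iff, Metric.mem_thickening_iff, not_exists, not_and, not_lt]
      refine ⟨fun h z hz => ?_, fun h z hz => ?_⟩
      · by_contra! hcon
        exact hz (h (by rwa [Metric.mem_ball, dist_comm]))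
      · by_contra hzU
        have := h z hzU
        rw [Metric.mem_ball, dist_comm] at hz
        linarith
    rw [h1]
    exact Metric.isOpen_thickening.measurableSet.compl
  have hVU : ⋃ k, V k = U := by
    refine subset_antisymm (iUnion_subset fun k x hx => ?_) fun x hx => ?_
    · exact mem_ofPred.1 hx (Metric.mem_ball_self Nat.one_div_pos_of_nat)
    · obtain ⟨δ, hδ, hδU⟩ := Metric.isOpen_iff.1 hU x hx
      obtain ⟨k, hk⟩ := exists_nat_one_div_lt hδ
      exact mem_iUnion.2 ⟨k, (Metric.ball_subset_ball hk.le).trans hδU⟩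
  have hVmono : Monotone V := fun i j hij x hx =>
    (Metric.ball_subset_ball (Nat.one_div_le_one_div hij)).trans (mem_ofPred.1 hx)
  have hVle : ∀ k, 𝓔.Γ v (V k) ≤ C * c := fun k => by
    rw [← semi_le_iff _ _ (by finiteness)]
    refine hvA (V k) (hVm k) _ ?_
    have h1 : ∀ᶠ s in 𝓝[>] (0 : ℝ), s < 1 / ((k : ℝ) + 1) :=
      by
      filter_upwards [Ioo_mem_nhdsGT Nat.one_div_pos_of_nat] with s hs using hs.2
    filter_upwards [hr.eventually h1] with n hn
    rw [semi_le_iff _ _ (by finiteness)]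
    refine (measure_mono fun x hx => ?_).trans ((hE n U hUc).trans (mul_le_mul' le_rfl (hrp n).1.le))
    exact (Metric.ball_subset_ball hn.le).trans (mem_ofPred.1 hx)
  rw [← hVU, hVmono.measure_iUnion]
  exact iSup_le hVle

/-- Truncation does not increase |u(x) - u(y)|, and multiplication by a cutoff equal to 1 on B(o,l)
changes neither the energy measure nor the increments inside U ∩ B(o,l). So bounded support
suffices, after which l → ∞. -/
theorem exists_Γ_le_liminf {Ψ : ℝ → ℝ} (hΨ : IsScaleFunction Ψ)
    (hVD : VolumeDoubling m) (hPI : 𝓔.Poincare Ψ) (hcap : 𝓔.CapacityUpper Ψ) :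
    ∃ C : ℝ≥0, 1 ≤ C ∧ ∀ (u : 𝓔.Dom) (U : Set X), IsOpen U →
      𝓔.Γ u U ≤ C * liminf (fun r => ksEnergy m p r U u.toLp / ENNReal.ofReal (Ψ r)) (𝓝[>] 0) := by
  have hp0 : 0 < p := exponent_pos
  have : ProperSpace X := hVD.properSpace
  obtain ⟨C, hC1, hC⟩ := exists_Γ_le_liminf_of_bounded_support (𝓔 := 𝓔) hΨ hVD hPI hcap
  refine ⟨C, hC1, fun u U hU => ?_⟩
  refine Γ_le_of_forall_clamp u hU.measurableSet fun k v hv => ?_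
  obtain ⟨o⟩ : Nonempty X := inferInstance
  have hcov : ⋃ l : ℕ, U ∩ Metric.ball o l = U := by
    rw [← inter_iUnion, Metric.iUnion_ball_nat, inter_univ]
  have hmono : Monotone fun l : ℕ => U ∩ Metric.ball o l := fun i j hij =>
    inter_subset_inter_right _ (Metric.ball_subset_ball (by exact_mod_cast hij))
  rw [← hcov, hmono.measure_iUnion, hcov]
  refine iSup_le fun l => ?_
  obtain ⟨h, η, V, ⟨hηc, -, hhη⟩, hη01, -, hlV, hη1, hη0⟩ :=
    𝓔.exists_cutoff (isCompact_closedBall o (l : ℝ)) (Metric.isOpen_ball (x := o) (ε := l + 1))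
      (Metric.closedBall_subset_ball (by linarith))
  have hηball : ∀ x ∈ Metric.ball o (l : ℝ), η x = 1 := fun x hx =>
    hη1 x (hlV (Metric.ball_subset_closedBall hx))
  have hu := measurable_toLp u
  have hcl : Measurable fun x => clamp k (u.toLp x) :=
    (lipschitzWith_clamp k).continuous.measurable.comp hu
  obtain ⟨g, hg, -⟩ := ((energyLE_self h).congr hhη).mul_of_le
    ((energyLE_self u).clamp (Nat.cast_nonneg k)) (M := k + 1) (by positivity)
    (fun x => abs_le.2 ⟨by linarith [(hη01 x).1], (hη01 x).2⟩)
    fun x => (abs_clamp_le (Nat.cast_nonneg k) _).trans (by linarith)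
  have hopen : IsOpen (U ∩ Metric.ball o (l : ℝ)) := hU.inter Metric.isOpen_ball
  have h1 : 𝓔.Γ v (U ∩ Metric.ball o (l : ℝ)) = 𝓔.Γ g (U ∩ Metric.ball o (l : ℝ)) := by
    refine Γ_eq_of_sub_eq_const v g hopen 0 ?_ subset_rfl hopen.measurableSet
    filter_upwards [hv, hg] with x hx hx' hxU
    rw [hx, hx', hηball x hxU.2]; ring
  rw [h1]
  refine (hC g (fun x => η x * clamp k (u.toLp x)) o (l + 1) _ (hηc.measurable.mul hcl) hg (fun y hy => ?_) hopen).trans ?_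
  · rw [hη0 y hy, zero_mul]
  · refine mul_le_mul' le_rfl (liminf_le_liminf (Eventually.of_forall fun r => ?_))
    refine ENNReal.div_le_div_right ((ksEnergy_le_of_abs_le hp0 hopen.measurableSet ?_).trans
      (ksEnergy_mono inter_subset_left r _)) _
    refine Eventually.of_forall fun y hy => Eventually.of_forall fun x hx => ?_
    rw [hηball x hx.2, hηball y hy.2, one_mul, one_mul]
    exact abs_clamp_sub_clamp_le _ _ _

end PEnergyStructure

/-! ### Nonlocal energies compared with Korevaar–Schoen energies -/

section Kernels

variable {X : Type*} [MetricSpace X] [MeasurableSpace X] {m : Measure X} {p : ℝ} {Ψ : ℝ → ℝ}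

theorem nonlocalEnergy_eq (k : X → X → ℝ≥0∞) (Ω : Set X) (u : X → ℝ) :
    nonlocalEnergy m p Ψ k Ω u = ∫⁻ y in Ω, ∫⁻ x in Ω,
      gap p (u x) (u y) / ENNReal.ofReal (Ψ (dist x y)) * k x y ∂m ∂m := rfl

theorem nonlocalEnergy_mono_kernel (hp : 0 < p) {k k' : X → X → ℝ≥0∞}
    (h : ∀ x y, 0 < dist x y → k x y ≤ k' x y) (Ω : Set X) (u : X → ℝ) :
    nonlocalEnergy m p Ψ k Ω u ≤ nonlocalEnergy m p Ψ k' Ω u := by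
  rw [nonlocalEnergy_eq, nonlocalEnergy_eq]
  refine lintegral_mono fun y => lintegral_mono fun x => ?_
  rcases eq_or_ne x y with rfl | hxy
  · simp [gap_self hp]
  · exact mul_le_mul' le_rfl (h x y (dist_pos.2 hxy))

theorem nonlocalEnergy_congr {Ω : Set X} (k : X → X → ℝ≥0∞) {u v : X → ℝ}
    (huv : u =ᵐ[m.restrict Ω] v) : nonlocalEnergy m p Ψ k Ω u = nonlocalEnergy m p Ψ k Ω v := by
  rw [nonlocalEnergy_eq, nonlocalEnergy_eq]
  refine lintegral_congr_ae ?_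
  filter_upwards [huv] with y hy
  refine lintegral_congr_ae ?_
  filter_upwards [huv] with x hx
  rw [hx, hy]

/-- Measurability of one summand suffices, so none has to be checked for the dyadic part. -/
theorem lintegral_lintegral_add_right {Y : Type*} [MeasurableSpace Y] {μ : Measure Y} [SFinite μ]
    {ν : Measure Y} (f : Y → Y → ℝ≥0∞) {g : Y → Y → ℝ≥0∞} (hg : Measurable fun z : Y × Y => g z.1 z.2) :
    ∫⁻ y, ∫⁻ x, f y x + g y x ∂μ ∂ν = (∫⁻ y, ∫⁻ x, f y x ∂μ ∂ν) + ∫⁻ y, ∫⁻ x, g y x ∂μ ∂ν := by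
  have h1 : Measurable fun y => ∫⁻ x, g y x ∂μ := hg.lintegral_prod_right'
  rw [← lintegral_add_right _ h1]
  exact lintegral_congr fun y => lintegral_add_right _ (hg.comp measurable_prodMk_left)

/-- Needed for Tonelli: ν may have infinite mass near 0, but the part of (0, δ) away from 0 lies in
a compact interval. -/
theorem sigmaFinite_restrict_Ioo {ν : Measure ℝ} (hν : ∀ K ⊆ Ioi (0 : ℝ), IsCompact K → ν K < ∞)
    (δ : ℝ) : SigmaFinite (ν.restrict (Ioo 0 δ)) := by
  refine ⟨⟨⟨fun n => (Ioo (0 : ℝ) (1 / ((n : ℝ) + 1)))ᶜ, fun _ => mem_univ _, fun n => ?_, ?_⟩⟩⟩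
  · rw [Measure.restrict_apply measurableSet_Ioo.compl]
    refine (measure_mono (t := Icc (1 / ((n : ℝ) + 1)) δ) fun t ht => ?_).trans_lt (hν _ ?_ isCompact_Icc)
    · refine ⟨?_, ht.2.2.le⟩
      by_contra! hcon
      exact ht.1 ⟨ht.2.1, hcon⟩
    · exact fun t ht => lt_of_lt_of_le Nat.one_div_pos_of_nat ht.1
  · refine eq_univ_of_forall fun t => mem_iUnion.2 ?_
    rcases le_or_gt t 0 with ht | ht
    · exact ⟨0, fun h => absurd h.1 (not_lt.2 ht)⟩
    · obtain ⟨n, hn⟩ := exists_nat_one_div_lt ht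
      exact ⟨n, fun h => absurd h.2 (not_lt.2 hn.le)⟩

theorem ksEnergy_eq_lintegral [OpensMeasurableSpace X] {u : X → ℝ} {Ω : Set X} (t : ℝ) (hm : ∀ y, m (Metric.ball y t) ≠ 0) :
    ksEnergy m p t Ω u = ∫⁻ y in Ω, ∫⁻ x in Ω, (Metric.ball y t).indicator
      (fun x => (m (Metric.ball y t))⁻¹ * gap p (u x) (u y)) x ∂m ∂m := by
  refine lintegral_congr fun y => ?_
  rw [lintegral_indicator Metric.isOpen_ball.measurableSet,
    Measure.restrict_restrict Metric.isOpen_ball.measurableSet, inter_comm,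
    lintegral_const_mul' _ _ (ENNReal.inv_ne_top.2 (hm y)), div_eq_mul_inv, mul_comm]

/-- The factor Ψ(d(x,y)) in the kernel bound cancels the denominator of the integrand; ε ≤ 1 keeps
the pairs within the range of that bound. -/
theorem ksEnergy_le_nonlocalEnergy [OpensMeasurableSpace X] [m.IsOpenPosMeasure] (hp : 0 < p) (hΨ : IsScaleFunction Ψ)
    {u : X → ℝ} {Ω : Set X} {k : X → X → ℝ≥0∞} {Cρ : ℝ≥0} (hCρ : 0 < Cρ) {ε : ℝ} (hε : 0 < ε)
    (hε1 : ε ≤ 1) (hk : ∀ x y : X, 0 < dist x y → dist x y ≤ 1 →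
      (Cρ : ℝ≥0∞)⁻¹ * (ENNReal.ofReal (Ψ (dist x y)) / ENNReal.ofReal (Ψ ε)) *
        ((Metric.ball y ε).indicator (fun _ => (1 : ℝ≥0∞)) x / m (Metric.ball y ε)) ≤ k x y) :
    (Cρ : ℝ≥0∞)⁻¹ * (ksEnergy m p ε Ω u / ENNReal.ofReal (Ψ ε)) ≤ nonlocalEnergy m p Ψ k Ω u := by
  have hC : (Cρ : ℝ≥0∞)⁻¹ * (ENNReal.ofReal (Ψ ε))⁻¹ ≠ ∞ :=
    ENNReal.mul_ne_top (ENNReal.inv_ne_top.2 (by exact_mod_cast hCρ.ne'))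
      (ENNReal.inv_ne_top.2 (hΨ.ofReal_pos hε))
  rw [nonlocalEnergy_eq, div_eq_mul_inv, mul_left_comm, mul_comm, ksEnergy_eq_lintegral ε fun y =>
    (Metric.measure_ball_pos m y hε).ne', ← lintegral_const_mul' _ _ hC]
  refine lintegral_mono fun y => ?_
  simp only
  rw [← lintegral_const_mul' _ _ hC]
  refine lintegral_mono fun x => ?_
  simp only
  by_cases hx : x ∈ Metric.ball y ε
  · rw [indicator_of_mem hx]
    rcases eq_or_ne x y with rfl | hxy
    · simp [gap_self hp]
    have hd : 0 < dist x y := dist_pos.2 hxy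
    have hd1 : dist x y ≤ 1 := (le_of_lt hx).trans hε1
    have h0 := hΨ.ofReal_pos hd
    have h1 := hk x y hd hd1
    rw [indicator_of_mem hx] at h1
    refine le_trans (le_of_eq ?_) (mul_le_mul' le_rfl h1)
    calc _ = (Cρ : ℝ≥0∞)⁻¹ * (ENNReal.ofReal (Ψ ε))⁻¹ * ((m (Metric.ball y ε))⁻¹ * gap p (u x) (u y)) *
          ((ENNReal.ofReal (Ψ (dist x y)))⁻¹ * ENNReal.ofReal (Ψ (dist x y))) := by
          rw [ENNReal.inv_mul_cancel h0 ENNReal.ofReal_ne_top, mul_one]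
      _ = _ := by simp only [div_eq_mul_inv, one_mul]; ring
  · rw [indicator_of_notMem hx, mul_zero]; exact zero_le

variable [SecondCountableTopology X] [BorelSpace X] [IsLocallyFiniteMeasure m]

/-- Superposition of Korevaar–Schoen energies over scales. -/
theorem lintegral_ksEnergy_le [m.IsOpenPosMeasure] (hp : 0 < p) (hΨ : IsScaleFunction Ψ)
    {u : X → ℝ} (hu : Measurable u) {Ω : Set X} {k : X → X → ℝ≥0∞} {ν : Measure ℝ}
    (hν : ∀ K ⊆ Ioi (0 : ℝ), IsCompact K → ν K < ∞) {δ : ℝ} (hδ : δ ≤ 1)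
    (hk : ∀ x y : X, 0 < dist x y → dist x y ≤ 1 → ENNReal.ofReal (Ψ (dist x y)) *
      (ν (Ioi (dist x y)) / m (Metric.ball y (dist x y))) ≤ k x y) :
    ∫⁻ t in Ioo 0 δ, ksEnergy m p t Ω u ∂ν ≤ nonlocalEnergy m p Ψ k Ω u := by
  have := sigmaFinite_restrict_Ioo hν δ
  have hmeas3 : Measurable fun z : X × X × ℝ => (Metric.ball z.1 z.2.2).indicator
      (fun x => (m (Metric.ball z.1 z.2.2))⁻¹ * gap p (u x) (u z.1)) z.2.1 := by
    have h1 : MeasurableSet {z : X × X × ℝ | dist z.2.1 z.1 < z.2.2} :=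
      (isOpen_lt (by fun_prop) (by fun_prop)).measurableSet
    have h2 : Measurable fun w : X × ℝ => m (Metric.ball w.1 w.2) := by
      have : MeasurableSet {z : (X × ℝ) × X | dist z.2 z.1.1 < z.1.2} :=
        (isOpen_lt (by fun_prop) (by fun_prop)).measurableSet
      exact measurable_measure_prodMk_left this
    have h3 : Measurable fun z : X × X × ℝ => (m (Metric.ball z.1 z.2.2))⁻¹ * gap p (u z.2.1) (u z.1) := by
      refine (h2.comp (measurable_fst.prodMk measurable_snd.snd)).inv.mul ?_
      exact measurable_gap.comp ((hu.comp measurable_snd.fst).prodMk (hu.comp measurable_fst))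
    exact h3.indicator h1
  have hmeas2 : Measurable fun z : X × ℝ => ∫⁻ x in Ω, (Metric.ball z.1 z.2).indicator
      (fun x => (m (Metric.ball z.1 z.2))⁻¹ * gap p (u x) (u z.1)) x ∂m := by
    have h1 : Measurable fun z : (X × ℝ) × X => (Metric.ball z.1.1 z.1.2).indicator
        (fun x => (m (Metric.ball z.1.1 z.1.2))⁻¹ * gap p (u x) (u z.1.1)) z.2 :=
      hmeas3.comp (measurable_fst.fst.prodMk (measurable_snd.prodMk measurable_fst.snd))
    exact h1.lintegral_prod_right'
  calc ∫⁻ t in Ioo 0 δ, ksEnergy m p t Ω u ∂ν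
      = ∫⁻ t in Ioo 0 δ, ∫⁻ y in Ω, ∫⁻ x in Ω, (Metric.ball y t).indicator
          (fun x => (m (Metric.ball y t))⁻¹ * gap p (u x) (u y)) x ∂m ∂m ∂ν := by
        refine setLIntegral_congr_fun measurableSet_Ioo fun t ht => ?_
        exact ksEnergy_eq_lintegral t fun y => (Metric.measure_ball_pos m y ht.1).ne'
    _ = ∫⁻ y in Ω, ∫⁻ t in Ioo 0 δ, ∫⁻ x in Ω, (Metric.ball y t).indicator
          (fun x => (m (Metric.ball y t))⁻¹ * gap p (u x) (u y)) x ∂m ∂ν ∂m :=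
        (lintegral_lintegral_swap hmeas2.aemeasurable).symm
    _ = ∫⁻ y in Ω, ∫⁻ x in Ω, ∫⁻ t in Ioo 0 δ, (Metric.ball y t).indicator
          (fun x => (m (Metric.ball y t))⁻¹ * gap p (u x) (u y)) x ∂ν ∂m ∂m := by
        refine lintegral_congr fun y => ?_
        refine (lintegral_lintegral_swap (f := fun x t => (Metric.ball y t).indicator
          (fun x => (m (Metric.ball y t))⁻¹ * gap p (u x) (u y)) x) ?_).symm
        exact (hmeas3.comp (measurable_const.prodMk measurable_id)).aemeasurable
    _ ≤ nonlocalEnergy m p Ψ k Ω u := by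
        rw [nonlocalEnergy_eq]
        refine lintegral_mono fun y => lintegral_mono fun x => ?_
        rcases eq_or_ne x y with rfl | hxy
        · simp only [indicator, gap_self hp, mul_zero, ite_self, lintegral_const, zero_mul]
          exact zero_le
        have hd : 0 < dist x y := dist_pos.2 hxy
        rcases lt_or_ge 1 (dist x y) with hd1 | hd1
        · refine le_trans (le_of_eq ?_) zero_le
          refine setLIntegral_eq_zero measurableSet_Ioo fun t ht => ?_
          refine indicator_of_notMem (fun h => ?_) _
          rw [Metric.mem_ball] at h
          linarith [ht.2]
        · have h0 := hΨ.ofReal_pos hd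
          -- Only t > d(x,y) contributes, and there B(y,t) contains B(y,d(x,y)), so its inverse mass
          -- is smaller; integrating in t produces ν((d(x,y), ∞)).
          have hpt : ∀ t, (Metric.ball y t).indicator
              (fun x => (m (Metric.ball y t))⁻¹ * gap p (u x) (u y)) x ≤
              (Ioi (dist x y)).indicator (fun _ => (m (Metric.ball y (dist x y)))⁻¹ * gap p (u x) (u y)) t := by
            intro t
            by_cases ht : x ∈ Metric.ball y t
            · rw [indicator_of_mem ht, indicator_of_mem (show t ∈ Ioi (dist x y) from ht)]
              gcongr
              exact le_of_lt ht
            · rw [indicator_of_notMem ht]; exact zero_le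
          calc _ ≤ ∫⁻ t in Ioo 0 δ, (Ioi (dist x y)).indicator
                (fun _ => (m (Metric.ball y (dist x y)))⁻¹ * gap p (u x) (u y)) t ∂ν := lintegral_mono hpt
            _ ≤ ∫⁻ t, (Ioi (dist x y)).indicator
                (fun _ => (m (Metric.ball y (dist x y)))⁻¹ * gap p (u x) (u y)) t ∂ν := setLIntegral_le_lintegral _ _
            _ = (m (Metric.ball y (dist x y)))⁻¹ * gap p (u x) (u y) * ν (Ioi (dist x y)) := by
                rw [lintegral_indicator measurableSet_Ioi, setLIntegral_const]
            _ = gap p (u x) (u y) * ((ENNReal.ofReal (Ψ (dist x y)))⁻¹ * ENNReal.ofReal (Ψ (dist x y))) *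
                (ν (Ioi (dist x y)) / m (Metric.ball y (dist x y))) := by
                rw [ENNReal.inv_mul_cancel h0 ENNReal.ofReal_ne_top, div_eq_mul_inv]; ring
            _ = gap p (u x) (u y) / ENNReal.ofReal (Ψ (dist x y)) * (ENNReal.ofReal (Ψ (dist x y)) *
                (ν (Ioi (dist x y)) / m (Metric.ball y (dist x y)))) := by
                simp only [div_eq_mul_inv]; ring
            _ ≤ _ := by gcongr; exact hk x y hd hd1

/-- If c is below the lower limit, then cΨ(t) ≤ `ksEnergy` at every small scale t. The first
alternative uses t = ε; the second integrates over t ∈ (0, δ) against ν_ε, whose Ψ-mass there has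
lower limit at least 1/Cρ. -/
theorem KernelLower.liminf_le [m.IsOpenPosMeasure] (hp : 0 < p) (hΨ : IsScaleFunction Ψ)
    {ρ : ℝ → X → X → ℝ≥0∞} {Cρ : ℝ≥0} (hCρ : 0 < Cρ) (h : KernelLower m Ψ ρ Cρ)
    {u : X → ℝ} (hu : Measurable u) (Ω : Set X) :
    liminf (fun r => ksEnergy m p r Ω u / ENNReal.ofReal (Ψ r)) (𝓝[>] 0)
      ≤ Cρ * liminf (fun ε => nonlocalEnergy m p Ψ (ρ ε) Ω u) (𝓝[>] 0) := by
  have hC0 : (Cρ : ℝ≥0∞) ≠ 0 := by exact_mod_cast hCρ.ne'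
  refine le_of_forall_lt_imp_le_of_dense fun c hc => ?_
  rw [← ENNReal.inv_mul_le_iff hC0 ENNReal.coe_ne_top]
  have hev := eventually_lt_of_lt_liminf hc
  rcases h with h | ⟨ν, hν, hνlim, h⟩
  · refine le_liminf_of_le isCobounded_ge_of_top ?_
    filter_upwards [hev, Ioc_mem_nhdsGT one_pos] with ε hε hε1
    exact (mul_le_mul' le_rfl hε.le).trans (ksEnergy_le_nonlocalEnergy hp hΨ hCρ hε1.1 hε1.2 (h ε hε1.1))
  · obtain ⟨δ₀, hδ₀, hδ₀c⟩ := mem_nhdsGT_iff_exists_Ioo_subset.1 hev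
    set δ := min δ₀ 1 with hδ
    have hδpos : 0 < δ := lt_min hδ₀ one_pos
    calc (Cρ : ℝ≥0∞)⁻¹ * c ≤ liminf (fun ε => ∫⁻ t in Ioo 0 δ, ENNReal.ofReal (Ψ t) ∂(ν ε)) (𝓝[>] 0) * c :=
          mul_le_mul' (hνlim δ hδpos) le_rfl
      _ = liminf (fun ε => (∫⁻ t in Ioo 0 δ, ENNReal.ofReal (Ψ t) ∂(ν ε)) * c) (𝓝[>] 0) :=
          (mul_comm _ _).trans (ENNReal.liminf_mul_const_of_ne_top hc.ne_top).symm
      _ ≤ _ := by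
          refine liminf_le_liminf ?_
          filter_upwards [self_mem_nhdsWithin] with ε hε
          refine le_trans ?_ (lintegral_ksEnergy_le hp hΨ hu (hν ε hε) (min_le_right δ₀ 1) (h ε hε))
          rw [← lintegral_mul_const' _ _ hc.ne_top]
          refine setLIntegral_mono' measurableSet_Ioo fun t ht => ?_
          have h1 : c < ksEnergy m p t Ω u / ENNReal.ofReal (Ψ t) :=
            hδ₀c ⟨ht.1, ht.2.trans_le (min_le_left _ _)⟩
          rw [mul_comm, ← ENNReal.le_div_iff_mul_le (Or.inl (hΨ.ofReal_pos ht.1)) (Or.inl ENNReal.ofReal_ne_top)]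
          exact h1.le

/-- The part of the nonlocal energy coming from distances at least `δ`. -/
theorem lintegral_tail_le (hp : 0 < p) (hΨ : IsScaleFunction Ψ) {u : X → ℝ} (hu : Measurable u)
    (Ω : Set X) {k : X → X → ℝ≥0∞} (hk : Measurable fun z : X × X => k z.1 z.2) {δ : ℝ} (hδ : 0 < δ) :
    ∫⁻ y in Ω, ∫⁻ x in Ω, gap p (u x) (u y) *
      (Metric.ball y δ)ᶜ.indicator (fun x => k x y / ENNReal.ofReal (Ψ (dist x y))) x ∂m ∂m
      ≤ ((2 : ℝ≥0) ^ p : ℝ≥0) * (essSup (fun y => ∫⁻ x in (Metric.ball y δ)ᶜ,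
          k x y / ENNReal.ofReal (Ψ (dist x y)) ∂m) m
        + essSup (fun y => ∫⁻ x in (Metric.ball y δ)ᶜ, k y x / ENNReal.ofReal (Ψ (dist x y)) ∂m) m)
        * ∫⁻ x, gap p (u x) 0 ∂m
      ∧ Measurable fun z : X × X => gap p (u z.2) (u z.1) *
        (Metric.ball z.1 δ)ᶜ.indicator (fun x => k x z.1 / ENNReal.ofReal (Ψ (dist x z.1))) z.2 := by
  -- Ψ is uncontrolled outside (0, ∞); on distances at least δ it agrees with this continuous
  -- function.
  have hΨc : Continuous fun t => Ψ (max t δ) :=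
    hΨ.continuousOn.comp_continuous (continuous_id.max continuous_const)
      fun t => lt_of_lt_of_le hδ (le_max_right _ _)
  set κ : X × X → ℝ≥0∞ := fun z =>
    (Metric.ball z.1 δ)ᶜ.indicator (fun x => k x z.1 / ENNReal.ofReal (Ψ (dist x z.1))) z.2 with hκ
  have hκm : Measurable κ := by
    have h1 : MeasurableSet {z : X × X | δ ≤ dist z.2 z.1} :=
      (isClosed_le (by fun_prop) (by fun_prop)).measurableSet
    have h2 : Measurable fun z : X × X => k z.2 z.1 / ENNReal.ofReal (Ψ (max (dist z.2 z.1) δ)) := by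
      refine Measurable.div (hk.comp measurable_swap) (Measurable.ennreal_ofReal ?_)
      exact (hΨc.comp (continuous_snd.dist continuous_fst)).measurable
    convert h2.indicator h1 using 1
    ext z
    by_cases hz : δ ≤ dist z.2 z.1
    · rw [indicator_of_mem (show z ∈ {z : X × X | δ ≤ dist z.2 z.1} from hz), max_eq_left hz, hκ]
      exact indicator_of_mem (show z.2 ∈ (Metric.ball z.1 δ)ᶜ from fun h => absurd h (not_lt.2 hz)) _
    · rw [indicator_of_notMem (show z ∉ {z : X × X | δ ≤ dist z.2 z.1} from hz), hκ]
      exact indicator_of_notMem (show z.2 ∉ (Metric.ball z.1 δ)ᶜ by simpa using hz) _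
  have hgm : Measurable fun z : X × X => gap p (u z.2) (u z.1) :=
    measurable_gap.comp ((hu.comp measurable_snd).prodMk (hu.comp measurable_fst))
  refine ⟨?_, hgm.mul hκm⟩
  set S₁ := essSup (fun y => ∫⁻ x in (Metric.ball y δ)ᶜ, k x y / ENNReal.ofReal (Ψ (dist x y)) ∂m) m
  set S₂ := essSup (fun y => ∫⁻ x in (Metric.ball y δ)ᶜ, k y x / ENNReal.ofReal (Ψ (dist x y)) ∂m) m
  have hu0 := hu.gap_const (p := p) 0
  have hκ1 : ∀ y, Measurable fun x => κ (y, x) := fun y => hκm.comp measurable_prodMk_left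
  have hκ2 : ∀ x, Measurable fun y => κ (y, x) := fun x => hκm.comp measurable_prodMk_right
  have hA : ∫⁻ y, ∫⁻ x, gap p (u y) 0 * κ (y, x) ∂m ∂m ≤ S₁ * ∫⁻ x, gap p (u x) 0 ∂m := by
    rw [← lintegral_const_mul _ hu0]
    refine lintegral_mono_ae ?_
    filter_upwards [ENNReal.ae_le_essSup (μ := m) (fun y => ∫⁻ x in (Metric.ball y δ)ᶜ,
      k x y / ENNReal.ofReal (Ψ (dist x y)) ∂m)] with y hy
    rw [lintegral_const_mul _ (hκ1 y), mul_comm]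
    refine mul_le_mul' (le_trans (le_of_eq ?_) hy) le_rfl
    exact lintegral_indicator Metric.isOpen_ball.measurableSet.compl _
  have hB : ∫⁻ y, ∫⁻ x, gap p (u x) 0 * κ (y, x) ∂m ∂m ≤ S₂ * ∫⁻ x, gap p (u x) 0 ∂m := by
    rw [lintegral_lintegral_swap (f := fun y x => gap p (u x) 0 * κ (y, x))
      ((hu0.comp measurable_snd).mul hκm).aemeasurable, ← lintegral_const_mul _ hu0]
    refine lintegral_mono_ae ?_
    filter_upwards [ENNReal.ae_le_essSup (μ := m) (fun y => ∫⁻ x in (Metric.ball y δ)ᶜ,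
      k y x / ENNReal.ofReal (Ψ (dist x y)) ∂m)] with x hx
    rw [lintegral_const_mul _ (hκ2 x), mul_comm]
    refine mul_le_mul' (le_trans (le_of_eq ?_) hx) le_rfl
    rw [← lintegral_indicator Metric.isOpen_ball.measurableSet.compl]
    refine lintegral_congr fun y => ?_
    simp only [hκ, indicator, mem_compl_iff, Metric.mem_ball, dist_comm x y]
  calc _ ≤ ∫⁻ y, ∫⁻ x, gap p (u x) (u y) * κ (y, x) ∂m ∂m :=
        (setLIntegral_le_lintegral _ _).trans (lintegral_mono fun y => setLIntegral_le_lintegral _ _)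
    -- Splitting |u(x) - u(y)|^p into |u(x)|^p and |u(y)|^p leaves one free variable in each term;
    -- the two essential suprema bound the two resulting kernel integrals.
    _ ≤ ∫⁻ y, ∫⁻ x, ((2 : ℝ≥0) ^ p : ℝ≥0) * (gap p (u x) 0 * κ (y, x) + gap p (u y) 0 * κ (y, x)) ∂m ∂m := by
        refine lintegral_mono fun y => lintegral_mono fun x => ?_
        rw [← add_mul, ← mul_assoc]
        refine mul_le_mul' ((gap_triangle hp _ _ 0).trans ?_) le_rfl
        rw [gap_comm 0]
    _ = ((2 : ℝ≥0) ^ p : ℝ≥0) * ((∫⁻ y, ∫⁻ x, gap p (u x) 0 * κ (y, x) ∂m ∂m)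
          + ∫⁻ y, ∫⁻ x, gap p (u y) 0 * κ (y, x) ∂m ∂m) := by
        rw [← lintegral_add_left, ← lintegral_const_mul' _ _ ENNReal.coe_ne_top]
        · refine lintegral_congr fun y => ?_
          rw [lintegral_const_mul' _ _ ENNReal.coe_ne_top, lintegral_add_left (f := fun x => gap p (u x) 0 * κ (y, x)) (hu0.mul (hκ1 y))]
        · exact ((hu0.comp measurable_snd).mul hκm).lintegral_prod_right'
    _ ≤ ((2 : ℝ≥0) ^ p : ℝ≥0) * (S₂ * ∫⁻ x, gap p (u x) 0 ∂m + S₁ * ∫⁻ x, gap p (u x) 0 ∂m) := by gcongr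
    _ = _ := by ring

end Kernels

/-! ### Upper bounds for mollified energies -/

namespace PEnergyStructure

variable {X : Type*} [MetricSpace X] [MeasurableSpace X] {m : Measure X} {p : ℝ} [hp : Fact (1 < p)]
variable {𝓔 : PEnergyStructure m p}

theorem tendsto_Γ_thickening [OpensMeasurableSpace X] (u : 𝓔.Dom) (Ω : Set X) {κ : ℝ} (hκ : 0 < κ) :
    Tendsto (fun δ => 𝓔.Γ u (Metric.thickening (κ * δ) Ω)) (𝓝[>] 0) (𝓝 (𝓔.Γ u (closure Ω))) := by
  refine (tendsto_measure_thickening ⟨1, one_pos, measure_ne_top _ _⟩).comp ?_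
  refine tendsto_nhdsWithin_iff.2 ⟨?_, ?_⟩
  · have h1 : Tendsto (fun δ : ℝ => κ * δ) (𝓝 0) (𝓝 (κ * 0)) := tendsto_id.const_mul κ
    rw [mul_zero] at h1
    exact h1.mono_left nhdsWithin_le_nhds
  · filter_upwards [self_mem_nhdsWithin] with δ hδ
    exact mul_pos hκ hδ

variable [SecondCountableTopology X] [BorelSpace X]
  [IsLocallyFiniteMeasure m] [m.IsOpenPosMeasure] {Ψ : ℝ → ℝ} {ρ : ℝ → X → X → ℝ≥0∞}

/-- All dyadic scales are at most ε, so the energy is seen in a κε-neighbourhood of Ω, which shrinks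
to the closure. For the whole space no limit is needed. -/
theorem exists_nonlocalEnergy_le_of_localKernel (hΨ : IsScaleFunction Ψ) (hVD : VolumeDoubling m)
    (hPI : 𝓔.Poincare Ψ) (hρ : LocalKernel m Ψ ρ) : ∃ C : ℝ≥0, ∀ u : 𝓔.Dom,
      (∀ Ω : Set X, limsup (fun ε => nonlocalEnergy m p Ψ (ρ ε) Ω u.toLp) (𝓝[>] 0)
        ≤ C * 𝓔.Γ u (closure Ω)) ∧
      ∀ ε, 0 < ε → nonlocalEnergy m p Ψ (ρ ε) univ u.toLp ≤ C * 𝓔.Γ u univ := by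
  obtain ⟨C, κ, -, hκ, hC⟩ := exists_dyadicKernel_le (𝓔 := 𝓔) hΨ hVD hPI
  obtain ⟨Cρ, -, ⟨a, ha⟩, -⟩ := hρ
  have key : ∀ (u : 𝓔.Dom) (Ω : Set X) (ε : ℝ), 0 < ε → nonlocalEnergy m p Ψ (ρ ε) Ω u.toLp
      ≤ (C * Cρ : ℝ≥0) * 𝓔.Γ u (Metric.thickening (κ * ε) Ω) := by
    intro u Ω ε hε
    refine (nonlocalEnergy_mono_kernel exponent_pos (ha ε hε).2 Ω _).trans ?_
    refine (hC ε ε (a ε) Ω u hε fun j _ => ?_).trans ?_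
    · exact mul_le_of_le_one_left hε.le (pow_le_one₀ (by norm_num) (by norm_num))
    · rw [ENNReal.coe_mul]
      gcongr
      exact (ha ε hε).1
  refine ⟨C * Cρ, fun u => ⟨fun Ω => ?_, fun ε hε => ?_⟩⟩
  · have h1 := ENNReal.Tendsto.const_mul (a := ((C * Cρ : ℝ≥0) : ℝ≥0∞)) (tendsto_Γ_thickening u Ω hκ)
      (Or.inr ENNReal.coe_ne_top)
    rw [← h1.limsup_eq]
    refine limsup_le_limsup ?_
    filter_upwards [self_mem_nhdsWithin] with ε hε
    exact key u Ω ε hε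
  · refine (key u univ ε hε).trans ?_
    gcongr
    exact subset_univ _

/-- Distances are split at δ = 2^{-i}. The far part vanishes as ε ↓ 0, the near part sees a
κδ-neighbourhood of Ω, and i → ∞ afterwards. -/
theorem exists_limsup_le_of_nonlocalKernel (hΨ : IsScaleFunction Ψ) (hVD : VolumeDoubling m)
    (hPI : 𝓔.Poincare Ψ) (hρ_meas : ∀ ε : ℝ, 0 < ε → Measurable (fun z : X × X => ρ ε z.1 z.2))
    (hρ : NonlocalKernel m Ψ ρ) : ∃ C : ℝ≥0, ∀ (u : 𝓔.Dom) (Ω : Set X),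
      limsup (fun ε => nonlocalEnergy m p Ψ (ρ ε) Ω u.toLp) (𝓝[>] 0) ≤ C * 𝓔.Γ u (closure Ω) := by
  have hp0 : 0 < p := exponent_pos
  obtain ⟨C, κ, -, hκ, hC⟩ := exists_dyadicKernel_le (𝓔 := 𝓔) hΨ hVD hPI
  obtain ⟨Cρ, -, ⟨a, ha⟩, htail, -⟩ := hρ
  refine ⟨C * Cρ, fun u Ω => ?_⟩
  have hu := measurable_toLp u
  have hP : ∫⁻ x, gap p (u.toLp x) 0 ∂m ≠ ∞ := by
    have h1 : ∫⁻ x, gap p (u.toLp x) 0 ∂m = ENNReal.ofReal ‖u.toLp‖ ^ p := by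
      rw [← enorm_Lp_rpow]; simp [gap]
    rw [h1]
    exact (ENNReal.rpow_lt_top_of_nonneg hp0.le ENNReal.ofReal_ne_top).ne
  have key : ∀ i : ℕ, limsup (fun ε => nonlocalEnergy m p Ψ (ρ ε) Ω u.toLp) (𝓝[>] 0)
      ≤ (C * Cρ : ℝ≥0) * 𝓔.Γ u (Metric.thickening (κ * (1 / 2) ^ i) Ω) := by
    intro i
    set δ : ℝ := (1 / 2) ^ i with hδ
    have hδ0 : 0 < δ := by positivity
    have hδ1 : δ ≤ 1 := pow_le_one₀ (by norm_num) (by norm_num)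
    obtain ⟨ht1, ht2⟩ := htail δ hδ0
    have hlim : Tendsto (fun ε => (C * Cρ : ℝ≥0) * 𝓔.Γ u (Metric.thickening (κ * δ) Ω) +
        ((2 : ℝ≥0) ^ p : ℝ≥0) * (essSup (fun y => ∫⁻ x in (Metric.ball y δ)ᶜ,
          ρ ε x y / ENNReal.ofReal (Ψ (dist x y)) ∂m) m
        + essSup (fun y => ∫⁻ x in (Metric.ball y δ)ᶜ, ρ ε y x / ENNReal.ofReal (Ψ (dist x y)) ∂m) m)
        * ∫⁻ x, gap p (u.toLp x) 0 ∂m) (𝓝[>] 0)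
        (𝓝 ((C * Cρ : ℝ≥0) * 𝓔.Γ u (Metric.thickening (κ * δ) Ω))) := by
      have h1 := ENNReal.Tendsto.mul_const (b := ∫⁻ x, gap p (u.toLp x) 0 ∂m)
        (ENNReal.Tendsto.const_mul (a := (((2 : ℝ≥0) ^ p : ℝ≥0) : ℝ≥0∞)) (ht1.add ht2)
        (Or.inr ENNReal.coe_ne_top)) (Or.inr hP)
      have h2 := h1.const_add ((C * Cρ : ℝ≥0) * 𝓔.Γ u (Metric.thickening (κ * δ) Ω))
      simpa using h2
    rw [← hlim.limsup_eq]
    refine limsup_le_limsup ?_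
    filter_upwards [self_mem_nhdsWithin] with ε hε
    obtain ⟨hbound, hmeas⟩ := lintegral_tail_le (m := m) hp0 hΨ hu Ω (hρ_meas ε hε) hδ0
    -- Annuli with j < i lie outside B(y, 2^{-i}), so their weights can be dropped in the near part.
    set b : ℕ → ℝ≥0 := fun j => if i ≤ j then a ε j else 0 with hb
    have hba : ∀ j, b j ≤ a ε j := fun j => by
      simp only [hb]; split_ifs
      · exact le_rfl
      · exact zero_le
    have hpt : ∀ y x, gap p (u.toLp x) (u.toLp y) / ENNReal.ofReal (Ψ (dist x y)) * ρ ε x y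
        ≤ gap p (u.toLp x) (u.toLp y) / ENNReal.ofReal (Ψ (dist x y)) * dyadicKernel m b 1 x y
          + gap p (u.toLp x) (u.toLp y) *
          (Metric.ball y δ)ᶜ.indicator (fun x => ρ ε x y / ENNReal.ofReal (Ψ (dist x y))) x := by
      intro y x
      rcases eq_or_ne x y with rfl | hxy
      · simp [gap_self hp0]
      have hd : 0 < dist x y := dist_pos.2 hxy
      by_cases hx : x ∈ Metric.ball y δ
      · refine le_add_of_le_of_nonneg (mul_le_mul' le_rfl ?_) zero_le
        refine ((ha ε hε).2 x y hd ((show dist x y < δ from hx).trans_le hδ1)).trans ?_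
        refine ENNReal.tsum_le_tsum fun j => ?_
        by_cases hij : i ≤ j
        · rw [hb]; simp only; rw [if_pos hij]
        · rw [indicator_of_notMem]
          · simp
          · refine fun h => h.2 (Metric.ball_subset_ball ?_ hx)
            rw [mul_one]
            exact pow_le_pow_of_le_one (by norm_num) (by norm_num) (by omega)
      · refine le_add_of_nonneg_of_le zero_le ?_
        rw [indicator_of_mem (show x ∈ (Metric.ball y δ)ᶜ from hx), div_eq_mul_inv, div_eq_mul_inv]
        exact le_of_eq (by ring)
    calc nonlocalEnergy m p Ψ (ρ ε) Ω u.toLp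
        ≤ ∫⁻ y in Ω, ∫⁻ x in Ω, (gap p (u.toLp x) (u.toLp y) / ENNReal.ofReal (Ψ (dist x y)) *
          dyadicKernel m b 1 x y + gap p (u.toLp x) (u.toLp y) *
          (Metric.ball y δ)ᶜ.indicator (fun x => ρ ε x y / ENNReal.ofReal (Ψ (dist x y))) x) ∂m ∂m := by
          rw [nonlocalEnergy_eq]
          exact lintegral_mono fun y => lintegral_mono fun x => hpt y x
      _ = nonlocalEnergy m p Ψ (dyadicKernel m b 1) Ω u.toLp + ∫⁻ y in Ω, ∫⁻ x in Ω,
          gap p (u.toLp x) (u.toLp y) * (Metric.ball y δ)ᶜ.indicator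
            (fun x => ρ ε x y / ENNReal.ofReal (Ψ (dist x y))) x ∂m ∂m := by
          rw [nonlocalEnergy_eq]
          exact lintegral_lintegral_add_right _ hmeas
      _ ≤ _ := by
          refine add_le_add ((hC 1 δ b Ω u one_pos fun j hj => ?_).trans ?_) hbound
          · have hij : i ≤ j := by
              by_contra hij
              exact hj (if_neg hij)
            rw [mul_one]
            exact pow_le_pow_of_le_one (by norm_num) (by norm_num) hij
          · rw [ENNReal.coe_mul]
            gcongr
            refine le_trans (ENNReal.tsum_le_tsum fun j => ?_) (ha ε hε).1
            exact_mod_cast hba j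
  have hpow : Tendsto (fun i : ℕ => (1 / 2 : ℝ) ^ i) atTop (𝓝[>] 0) :=
    tendsto_nhdsWithin_iff.2 ⟨tendsto_pow_atTop_nhds_zero_of_lt_one (by norm_num) (by norm_num),
      Eventually.of_forall fun i => show (0 : ℝ) < (1 / 2) ^ i by positivity⟩
  refine ge_of_tendsto' (ENNReal.Tendsto.const_mul ((tendsto_Γ_thickening u Ω hκ).comp hpow)
    (Or.inr ENNReal.coe_ne_top)) key

end PEnergyStructure

/-! ### Conclusion -/

theorem mainTheorem1 {X : Type*} [MetricSpace X] [CompleteSpace X] [LocallyCompactSpace X]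
    [TopologicalSpace.SeparableSpace X] [Nontrivial X] [MeasurableSpace X] [BorelSpace X]
    (m : Measure X) [m.Regular] [m.IsOpenPosMeasure] (p : ℝ) [Fact (1 < p)]
    (𝓔 : PEnergyStructure m p) (Ψ : ℝ → ℝ) (hΨ : IsScaleFunction Ψ)
    (hVD : VolumeDoubling m) (hPI : 𝓔.Poincare Ψ) (hcap : 𝓔.CapacityUpper Ψ)
    (ρ : ℝ → X → X → ℝ≥0∞)
    (hρ_meas : ∀ ε : ℝ, 0 < ε → Measurable (fun z : X × X => ρ ε z.1 z.2))
    (hρ : NonlocalKernel m Ψ ρ ∨ LocalKernel m Ψ ρ) :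
    ∃ C : ℝ≥0, 1 ≤ C ∧
      (∀ Ω : Set X, IsOpen Ω → 𝓔.ExtensionProperty Ω → ∀ u : X → ℝ, 𝓔.MemOn Ω u →
        (C : ℝ≥0∞)⁻¹ * 𝓔.localΓ Ω u Ω
            ≤ liminf (fun ε => nonlocalEnergy m p Ψ (ρ ε) Ω u) (𝓝[>] (0 : ℝ)) ∧
        liminf (fun ε => nonlocalEnergy m p Ψ (ρ ε) Ω u) (𝓝[>] (0 : ℝ))
            ≤ limsup (fun ε => nonlocalEnergy m p Ψ (ρ ε) Ω u) (𝓝[>] (0 : ℝ)) ∧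
        limsup (fun ε => nonlocalEnergy m p Ψ (ρ ε) Ω u) (𝓝[>] (0 : ℝ))
            ≤ C * 𝓔.localΓ Ω u Ω) ∧
      (LocalKernel m Ψ ρ → ∀ u : 𝓔.Dom,
        ⨆ (ε : ℝ) (_ : 0 < ε), nonlocalEnergy m p Ψ (ρ ε) univ u.toLp
          ≤ C * liminf (fun ε => nonlocalEnergy m p Ψ (ρ ε) univ u.toLp) (𝓝[>] (0 : ℝ))) := by
  have hp0 : 0 < p := PEnergyStructure.exponent_pos
  have : SecondCountableTopology X := UniformSpace.secondCountable_of_separable X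
  have : ProperSpace X := hVD.properSpace
  obtain ⟨Cρ, hCρ, hlow⟩ : ∃ Cρ : ℝ≥0, 0 < Cρ ∧ KernelLower m Ψ ρ Cρ := by
    rcases hρ with ⟨Cρ, hCρ, -, -, h⟩ | ⟨Cρ, hCρ, -, h⟩ <;> exact ⟨Cρ, hCρ, h⟩
  obtain ⟨C₁, hC₁1, hC₁⟩ := PEnergyStructure.exists_Γ_le_liminf (𝓔 := 𝓔) hΨ hVD hPI hcap
  have hlower : ∀ (F : 𝓔.Dom) (Ω : Set X), IsOpen Ω → 𝓔.Γ F Ω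
      ≤ (C₁ * Cρ : ℝ≥0) * liminf (fun ε => nonlocalEnergy m p Ψ (ρ ε) Ω F.toLp) (𝓝[>] 0) := by
    intro F Ω hΩ
    refine (hC₁ F Ω hΩ).trans ?_
    rw [ENNReal.coe_mul, mul_assoc]
    exact mul_le_mul' le_rfl (hlow.liminf_le hp0 hΨ hCρ (PEnergyStructure.measurable_toLp F) Ω)
  obtain ⟨C₂, hupper, hsup⟩ : ∃ C₂ : ℝ≥0,
      (∀ (F : 𝓔.Dom) (Ω : Set X), limsup (fun ε => nonlocalEnergy m p Ψ (ρ ε) Ω F.toLp) (𝓝[>] 0)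
        ≤ C₂ * 𝓔.Γ F (closure Ω)) ∧
      (LocalKernel m Ψ ρ → ∀ (F : 𝓔.Dom) (ε : ℝ), 0 < ε →
        nonlocalEnergy m p Ψ (ρ ε) univ F.toLp ≤ C₂ * 𝓔.Γ F univ) := by
    -- The two assumptions may hold together, so the split is on the local one: a single constant
    -- must serve both the upper limit and the bound at every ε.
    by_cases hloc : LocalKernel m Ψ ρ
    · obtain ⟨C₂, h⟩ := PEnergyStructure.exists_nonlocalEnergy_le_of_localKernel (𝓔 := 𝓔) hΨ hVD hPI hloc
      exact ⟨C₂, fun F => (h F).1, fun _ F => (h F).2⟩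
    · obtain ⟨C₂, h⟩ := PEnergyStructure.exists_limsup_le_of_nonlocalKernel (𝓔 := 𝓔) hΨ hVD hPI hρ_meas
        (hρ.resolve_right hloc)
      exact ⟨C₂, h, fun h => absurd h hloc⟩
  -- The summands dominate, in order, 1 and the constants of the lower, upper and supremum
  -- estimates.
  refine ⟨1 + C₁ * Cρ + C₂ + C₂ * (C₁ * Cρ), ?_, fun Ω hΩ hE u hu => ?_, fun hloc u => ?_⟩
  · rw [add_assoc, add_assoc]
    exact le_self_add
  · obtain ⟨F, hF, hFr⟩ := hE.2 u hu
    have hcongr : ∀ ε, nonlocalEnergy m p Ψ (ρ ε) Ω u = nonlocalEnergy m p Ψ (ρ ε) Ω F.toLp :=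
      fun ε => nonlocalEnergy_congr _ hF
    simp only [hcongr, PEnergyStructure.localΓ_eq hΩ hF]
    refine ⟨?_, liminf_le_limsup, ?_⟩
    · rw [ENNReal.inv_mul_le_iff _ ENNReal.coe_ne_top]
      · refine (hlower F Ω hΩ).trans (mul_le_mul' (ENNReal.coe_le_coe.2 ?_) le_rfl)
        exact (le_add_self.trans le_self_add).trans le_self_add
      · have : 0 < 1 + C₁ * Cρ + C₂ + C₂ * (C₁ * Cρ) := by positivity
        exact_mod_cast this.ne'
    · refine (hupper F Ω).trans ?_
      rw [measure_closure_of_null_frontier hFr]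
      refine mul_le_mul' (ENNReal.coe_le_coe.2 ?_) le_rfl
      exact le_add_self.trans le_self_add
  · refine iSup₂_le fun ε hε => ?_
    refine (hsup hloc u ε hε).trans ((mul_le_mul' le_rfl (hlower u univ isOpen_univ)).trans ?_)
    rw [← mul_assoc, ← ENNReal.coe_mul]
    exact mul_le_mul' (ENNReal.coe_le_coe.2 le_add_self) le_rfl
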